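/- Let $(\Omega,\mathcal F,\mathbb P)$ be a probability space with an invertible (bimeasurable), $\mathbb P$-preserving, ergodic transformation $\sigma$, and let $m$ be Lebesgue measure on $[0,1]$. For $\gamma\in(0,1)$ let $T_\gamma\colon[0,1]\to[0,1]$ be the Liverani–Saussol–Vaienti map, $T_\gamma(x)=x(1+2^\gamma x^\gamma)$ for $0\le x<\frac12$ and $T_\gamma(x)=2x-1$ for $\frac12\le x\le 1$. Let $\varepsilon_0>0$ and let $\beta,\delta\colon\Omega\to(0,1)$ be measurable with $$\operatorname{ess\,sup}_{\omega}\beta(\omega)+\varepsilon_0<\tfrac12,\qquad \operatorname{ess\,inf}_{\omega}\beta(\omega)-\varepsilon_0>0.$$ For $\varepsilon\in(-\varepsilon_0,\varepsilon_0)$ put $T_{\omega,\varepsilon}:=T_{\beta(\omega)+\varepsilon\delta(\omega)}$ (defined for $\mathbb P$-a.e. $\omega$) and $T^n_{\omega,\varepsilon}:=T_{\sigma^{n-1}\omega,\varepsilon}\circ\dots\circ T_{\sigma\omega,\varepsilon}\circ T_{\omega,\varepsilon}$. Let $F\colon\Omega\times[0,1]\to\mathbb R$ be measurable with $F_\omega:=F(\omega,\cdot)\in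 C^1[0,1]$ for every $\omega$ and $\operatorname{ess\,sup}_\omega\|F_\omega\|_{C^1}<\infty$. Then for every $\varepsilon\in(-\varepsilon_0,\varepsilon_0)$ there is a random absolutely continuous invariant probability measure, unique up to $\mathbb P$-null sets, that is, a measurable family $(\mu_{\omega,\varepsilon})_{\omega\in\Omega}$ of probability measures on $[0,1]$ such that, for $\mathbb P$-a.e. $\omega$, $\mu_{\omega,\varepsilon}\ll m$ and the push-forward of $\mu_{\omega,\varepsilon}$ under $T_{\omega,\varepsilon}$ is $\mu_{\sigma\omega,\varepsilon}$. With $f_{\omega,\varepsilon}:=F_\omega-\int_0^1F_\omega\,d\mu_{\omega,\varepsilon}$, all integrals in $$\Sigma_\varepsilon^2:=\int_\Omega\int_0^1 f_{\omega,\varepsilon}^2\,d\mu_{\omega,\varepsilon}\,d\mathbb P(\omega)+2\sum_{n=1}^\infty\int_\Omega\int_0^1 f_{\omega,\varepsilon}\cdot(f_{\sigma^n\omega,\varepsilon}\circ T^n_{\omega,\varepsilon})\,d\mu_{\omega,\varepsilon}\,d\mathbb P(\omega)$$ exist and the series converges absolutely, for every $\varepsilon\in(-\varepsilon_0,\varepsilon_0)$,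 and the map $\varepsilon\mapsto\Sigma_\varepsilon^2$ is continuous at $\varepsilon=0$. -/

import Mathlib

open MeasureTheory ProbabilityTheory Set
open scoped ENNReal

noncomputable section

namespace RandomLSV

/-- The Liverani--Saussol--Vaienti map with parameter `γ`, given by its two branches. It is
only ever used at points of `[0, 1]`, which it maps to `[0, 1]` when `0 < γ < 1`. -/
def lsvMap (γ x : ℝ) : ℝ :=
  if x < 1 / 2 then x * (1 + 2 ^ γ * x ^ γ) else 2 * x - 1

/-- The random composition `T_{σ^{n-1} ω} ∘ ⋯ ∘ T_{σ ω} ∘ T_ω`, where `T_ω` is the LSV map with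
parameter `a ω`. -/
def cocycle {Ω : Type*} (σ : Ω → Ω) (a : Ω → ℝ) : ℕ → Ω → ℝ → ℝ
  | 0, _, x => x
  | n + 1, ω, x => lsvMap (a (σ^[n] ω)) (cocycle σ a n ω x)

/-- `μ` is (the disintegration over `P` of) a random absolutely continuous invariant probability
measure of the cocycle of LSV maps with parameters `a`: a measurable family of probability
measures, absolutely continuous with respect to Lebesgue measure on `[0, 1]`, such that `T_ω`
pushes `μ ω` forward to `μ (σ ω)`, for almost every `ω`. -/
structure IsRandomACIM {Ω : Type*} [MeasurableSpace Ω] (P : Measure Ω) (σ : Ω → Ω) (a : Ω → ℝ)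
    (μ : Kernel Ω ℝ) : Prop where
  isMarkovKernel : IsMarkovKernel μ
  absolutelyContinuous : ∀ᵐ ω ∂P, μ ω ≪ volume.restrict (Icc (0 : ℝ) 1)
  equivariant : ∀ᵐ ω ∂P, (μ ω).map (lsvMap (a ω)) = μ (σ ω)

/-- The `C^1` norm on `[0, 1]`, as an extended nonnegative number. -/
def c1Norm (f : ℝ → ℝ) : ℝ≥0∞ :=
  (⨆ x ∈ Icc (0 : ℝ) 1, ‖f x‖ₑ) + ⨆ x ∈ Icc (0 : ℝ) 1, ‖derivWithin f (Icc (0 : ℝ) 1) x‖ₑ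

/-- The fibrewise centred observable `f_ω = F_ω - ∫ F_ω dμ_ω`. -/
def centred {Ω : Type*} [MeasurableSpace Ω] (μ : Kernel Ω ℝ) (F : Ω → ℝ → ℝ) (ω : Ω) (x : ℝ) : ℝ :=
  F ω x - ∫ y, F ω y ∂(μ ω)

/-- The product `f_ω(x) * f_{σ^n ω}(T_ω^n x)`; for `n = 0` it is `f_ω(x)^2`. -/
def corrIntegrand {Ω : Type*} [MeasurableSpace Ω] (σ : Ω → Ω) (a : Ω → ℝ) (μ : Kernel Ω ℝ)
    (F : Ω → ℝ → ℝ) (n : ℕ) (ω : Ω) (x : ℝ) : ℝ :=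
  centred μ F ω x * centred μ F (σ^[n] ω) (cocycle σ a n ω x)

/-- The `n`-th correlation `∫_Ω ∫_0^1 f_ω * (f_{σ^n ω} ∘ T_ω^n) dμ_ω dP(ω)`. -/
def correlation {Ω : Type*} [MeasurableSpace Ω] (P : Measure Ω) (σ : Ω → Ω) (a : Ω → ℝ)
    (μ : Kernel Ω ℝ) (F : Ω → ℝ → ℝ) (n : ℕ) : ℝ :=
  ∫ ω, ∫ x, corrIntegrand σ a μ F n ω x ∂(μ ω) ∂P

/-- The limit variance `Σ²` of the quenched central limit theorem. -/
def limitVariance {Ω : Type*} [MeasurableSpace Ω] (P : Measure Ω) (σ : Ω → Ω) (a : Ω → ℝ)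
    (μ : Kernel Ω ℝ) (F : Ω → ℝ → ℝ) : ℝ :=
  (∫ ω, ∫ x, centred μ F ω x ^ 2 ∂(μ ω) ∂P) + 2 * ∑' n : ℕ, correlation P σ a μ F (n + 1)

end RandomLSV

end

/-! Write `α` for a common upper bound, below `1/2`, of all the parameters. Everything rests on one
estimate, uniform over all sequences of LSV maps with parameters in `(0, α]`: compositions of
transfer operators forget their initial density at a summable rate in `L¹`. The estimate uses a cone
of decreasing densities `f` with `x ^ p * f x` increasing and with `∫_0^x f ≤ A x ^ (1 - α) ∫ f`,
which is preserved by every such transfer operator (`LSVCone.transfer`).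

Loss of memory is a coupling argument. A density of mass `M` in the cone is at least `κ M`
(`LSVCone.exists_lower_bound`), so `κ M / 2` may be removed from two densities of equal mass without
changing their difference. What is left may violate the tail bound, but the right branch repairs it:
after `N` steps the part that has used the right branch lies in the cone again, and the part that
has not has mass of order `N ^ (-(1 - α) / α)` (`exists_split`). The optimal rate `D` therefore
satisfies `D (N + n) ≤ q * D n + t N` with `q < 1`, and `t` is summable precisely because `(1 - α) /
α > 1`. This makes `D` summable (`summable_decayRate`). A centred Lipschitz function times a density
in the cone is a difference of two members of a larger cone, so correlations decay at the same kind
of rate.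

For the random system, let `P × Lebesgue` evolve under the skew product. Its images are Cauchy in
total variation, and disintegrating their limit gives the random a.c.i.m. (`exists_isRandomACIM`).
Density of polynomials in `L¹` gives loss of memory for every integrable density, so the images
converge to any random a.c.i.m., whence uniqueness and a rate.

Continuity needs no control of the invariant densities in `ε`. Each correlation is a limit, uniform
in `ε`, of covariances with respect to the `k`-th image of Lebesgue measure
(`abs_covApprox_sub_correlation_le`). These involve finitely many iterates and are continuous at `0`
by dominated convergence, since almost no orbit meets the jump at `1/2`. The correlations are
bounded by a summable sequence independent of `ε`, so the series may be summed in the limit. -/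

noncomputable section

/-! ### The branches of the LSV map and their inverses. -/

namespace RandomLSV

/-- The left branch of the LSV map, as a function on `[0, 1 / 2]`. -/
def leftBranch (γ x : ℝ) : ℝ := x * (1 + (2 * x) ^ γ)

/-- The derivative of the left branch of the LSV map. -/
def leftDeriv (γ x : ℝ) : ℝ := 1 + (1 + γ) * (2 * x) ^ γ

/-- The inverse of the left branch of the LSV map. -/
def leftInv (γ : ℝ) : ℝ → ℝ := Function.invFunOn (leftBranch γ) (Icc 0 (1 / 2))

lemma lsvMap_eq_leftBranch {γ x : ℝ} (h0 : 0 ≤ x) (h : x < 1 / 2) :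
    lsvMap γ x = leftBranch γ x := by
  simp only [lsvMap, if_pos h, leftBranch]
  rw [Real.mul_rpow (by norm_num) h0]

lemma lsvMap_of_le {γ x : ℝ} (h : 1 / 2 ≤ x) : lsvMap γ x = 2 * x - 1 := by
  simp only [lsvMap, if_neg (not_lt.2 h)]

lemma leftBranch_zero (γ : ℝ) : leftBranch γ 0 = 0 := by simp [leftBranch]

lemma leftBranch_half (γ : ℝ) : leftBranch γ (1 / 2) = 1 := by
  norm_num [leftBranch]

lemma two_mul_rpow_le_one {γ x : ℝ} (hγ : 0 < γ) (h0 : 0 ≤ x) (h : x ≤ 1 / 2) :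
    (2 * x) ^ γ ≤ 1 :=
  Real.rpow_le_one (by linarith) (by linarith) hγ.le

lemma leftBranch_strictMonoOn {γ : ℝ} (hγ : 0 < γ) :
    StrictMonoOn (leftBranch γ) (Icc 0 (1 / 2)) := by
  intro x hx y _ hxy
  have h1 : (2 * x) ^ γ ≤ (2 * y) ^ γ :=
    Real.rpow_le_rpow (by linarith [hx.1]) (by linarith) hγ.le
  have h2 : 0 ≤ (2 * x) ^ γ := Real.rpow_nonneg (by linarith [hx.1]) _
  unfold leftBranch
  nlinarith [hx.1]

lemma leftBranch_continuous {γ : ℝ} (hγ : 0 < γ) : Continuous (leftBranch γ) := by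
  unfold leftBranch
  exact continuous_id.mul (continuous_const.add
    ((Real.continuous_rpow_const hγ.le).comp (continuous_const.mul continuous_id)))

lemma leftBranch_hasDerivAt {γ x : ℝ} (hx : 0 < x) :
    HasDerivAt (leftBranch γ) (leftDeriv γ x) x := by
  have h1 : HasDerivAt (fun x : ℝ => 2 * x) 2 x := by
    simpa using (hasDerivAt_id x).const_mul 2
  have h2 := h1.rpow_const (p := γ) (Or.inl (by positivity))
  have h3 := (hasDerivAt_id x).mul (h2.const_add 1)
  refine h3.congr_deriv ?_
  have h4 : (2 * x) ^ γ = (2 * x) ^ (γ - 1) * (2 * x) := by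
    rw [← Real.rpow_add_one (by positivity)]; ring_nf
  simp only [leftDeriv, id, h4]
  ring

lemma leftBranch_surjOn {γ x : ℝ} (hγ : 0 < γ) (hx : x ∈ Icc (0 : ℝ) 1) :
    ∃ y ∈ Icc (0 : ℝ) (1 / 2), leftBranch γ y = x := by
  have := intermediate_value_Icc (a := (0 : ℝ)) (b := 1 / 2) (by norm_num)
    (leftBranch_continuous hγ).continuousOn
  rw [leftBranch_zero, leftBranch_half] at this
  exact this hx

lemma leftInv_mem {γ x : ℝ} (hγ : 0 < γ) (hx : x ∈ Icc (0 : ℝ) 1) :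
    leftInv γ x ∈ Icc (0 : ℝ) (1 / 2) :=
  Function.invFunOn_mem (leftBranch_surjOn hγ hx)

lemma leftBranch_leftInv {γ x : ℝ} (hγ : 0 < γ) (hx : x ∈ Icc (0 : ℝ) 1) :
    leftBranch γ (leftInv γ x) = x :=
  Function.invFunOn_eq (leftBranch_surjOn hγ hx)

lemma leftInv_leftBranch {γ y : ℝ} (hγ : 0 < γ) (hy : y ∈ Icc (0 : ℝ) (1 / 2)) :
    leftInv γ (leftBranch γ y) = y :=
  (leftBranch_strictMonoOn hγ).injOn.leftInvOn_invFunOn hy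

lemma leftInv_pos {γ x : ℝ} (hγ : 0 < γ) (hx : x ∈ Ioc (0 : ℝ) 1) : 0 < leftInv γ x := by
  have hm := leftInv_mem hγ (Ioc_subset_Icc_self hx)
  rcases hm.1.eq_or_lt with h | h
  · have := leftBranch_leftInv hγ (Ioc_subset_Icc_self hx)
    rw [← h, leftBranch_zero] at this
    exact absurd this hx.1.ne
  · exact h

lemma leftInv_mem_Ioc {γ x : ℝ} (hγ : 0 < γ) (hx : x ∈ Ioc (0 : ℝ) 1) :
    leftInv γ x ∈ Ioc (0 : ℝ) (1 / 2) :=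
  ⟨leftInv_pos hγ hx, (leftInv_mem hγ (Ioc_subset_Icc_self hx)).2⟩

lemma leftInv_mem_unit {γ x : ℝ} (hγ : 0 < γ) (hx : x ∈ Ioc (0 : ℝ) 1) :
    leftInv γ x ∈ Ioc (0 : ℝ) 1 :=
  ⟨leftInv_pos hγ hx, (leftInv_mem_Ioc hγ hx).2.trans (by norm_num)⟩

lemma leftInv_monotoneOn {γ : ℝ} (hγ : 0 < γ) : MonotoneOn (leftInv γ) (Ioc 0 1) := by
  intro x hx y hy hxy
  have hx' := Ioc_subset_Icc_self hx
  have hy' := Ioc_subset_Icc_self hy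
  rw [← (leftBranch_strictMonoOn hγ).le_iff_le (leftInv_mem hγ hx') (leftInv_mem hγ hy'),
    leftBranch_leftInv hγ hx', leftBranch_leftInv hγ hy']
  exact hxy

lemma one_le_leftDeriv {γ x : ℝ} (hγ : 0 < γ) (hx : 0 ≤ x) : 1 ≤ leftDeriv γ x := by
  unfold leftDeriv
  have : 0 ≤ (1 + γ) * (2 * x) ^ γ := by positivity
  linarith

lemma leftDeriv_mono {γ x y : ℝ} (hγ : 0 < γ) (hx : 0 ≤ x) (hxy : x ≤ y) :
    leftDeriv γ x ≤ leftDeriv γ y := by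
  unfold leftDeriv
  have := Real.rpow_le_rpow (z := γ) (by linarith : 0 ≤ 2 * x) (by linarith : 2 * x ≤ 2 * y) hγ.le
  gcongr

lemma image_leftBranch {γ b : ℝ} (hγ : 0 < γ) (hb : b ∈ Ioc (0 : ℝ) 1) :
    leftBranch γ '' Ioc 0 (leftInv γ b) = Ioc 0 b := by
  have hm := leftInv_mem hγ (Ioc_subset_Icc_self hb)
  have hb' := leftBranch_leftInv hγ (Ioc_subset_Icc_self hb)
  ext x
  constructor
  · rintro ⟨y, hy, rfl⟩
    have hy' : y ∈ Icc (0 : ℝ) (1 / 2) := ⟨hy.1.le, hy.2.trans hm.2⟩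
    refine ⟨?_, ?_⟩
    · rw [← leftBranch_zero γ]
      exact leftBranch_strictMonoOn hγ ⟨le_rfl, by norm_num⟩ hy' hy.1
    · rw [← hb']
      exact (leftBranch_strictMonoOn hγ).monotoneOn hy' hm hy.2
  · intro hx
    have hx1 : x ∈ Ioc (0 : ℝ) 1 := ⟨hx.1, hx.2.trans hb.2⟩
    exact ⟨leftInv γ x, ⟨leftInv_pos hγ hx1, leftInv_monotoneOn hγ hx1 hb hx.2⟩,
      leftBranch_leftInv hγ (Ioc_subset_Icc_self hx1)⟩

/-! ### The transfer operator and its duality. -/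

/-- The contribution of the left branch to the transfer operator of the LSV map. -/
def leftTransfer (γ : ℝ) (f : ℝ → ℝ) (x : ℝ) : ℝ :=
  f (leftInv γ x) / leftDeriv γ (leftInv γ x)

/-- The contribution of the right branch to the transfer operator of the LSV map. -/
def rightTransfer (f : ℝ → ℝ) (x : ℝ) : ℝ := f ((x + 1) / 2) / 2

/-- The transfer operator of the LSV map. -/
def transfer (γ : ℝ) (f : ℝ → ℝ) (x : ℝ) : ℝ := leftTransfer γ f x + rightTransfer f x

section ChangeOfVariables

variable {γ b : ℝ} (hγ : 0 < γ) (hb : b ∈ Ioc (0 : ℝ) 1) (φ f : ℝ → ℝ)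
include hγ hb

lemma leftTransfer_integrand_eq {y : ℝ} (hy : y ∈ Ioc (0 : ℝ) (leftInv γ b)) :
    |leftDeriv γ y| • (φ (leftBranch γ y) * leftTransfer γ f (leftBranch γ y))
      = φ (leftBranch γ y) * f y := by
  have hm := leftInv_mem hγ (Ioc_subset_Icc_self hb)
  have h1 := one_le_leftDeriv hγ hy.1.le
  rw [leftTransfer, leftInv_leftBranch hγ ⟨hy.1.le, hy.2.trans hm.2⟩, abs_of_pos (by linarith),
    smul_eq_mul]
  field_simp

lemma leftBranch_injOn_Ioc : InjOn (leftBranch γ) (Ioc 0 (leftInv γ b)) :=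
  (leftBranch_strictMonoOn hγ).injOn.mono <| Ioc_subset_Icc_self.trans <|
    Icc_subset_Icc_right (leftInv_mem hγ (Ioc_subset_Icc_self hb)).2

lemma integral_mul_leftTransfer :
    ∫ x in Ioc 0 b, φ x * leftTransfer γ f x
      = ∫ y in Ioc 0 (leftInv γ b), φ (leftBranch γ y) * f y := by
  rw [← image_leftBranch hγ hb, integral_image_eq_integral_abs_deriv_smul measurableSet_Ioc
    (fun y hy => (leftBranch_hasDerivAt hy.1).hasDerivWithinAt) (leftBranch_injOn_Ioc hγ hb)]
  exact setIntegral_congr_fun measurableSet_Ioc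
    fun y hy => leftTransfer_integrand_eq hγ hb φ f hy

lemma integrableOn_mul_leftTransfer :
    IntegrableOn (fun x => φ x * leftTransfer γ f x) (Ioc 0 b)
      ↔ IntegrableOn (fun y => φ (leftBranch γ y) * f y) (Ioc 0 (leftInv γ b)) := by
  rw [← image_leftBranch hγ hb, integrableOn_image_iff_integrableOn_abs_deriv_smul
    measurableSet_Ioc (fun y hy => (leftBranch_hasDerivAt hy.1).hasDerivWithinAt)
    (leftBranch_injOn_Ioc hγ hb)]
  exact integrableOn_congr_fun (fun y hy => leftTransfer_integrand_eq hγ hb φ f hy)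
    measurableSet_Ioc

end ChangeOfVariables

lemma image_rightBranch (b : ℝ) :
    (fun y : ℝ => 2 * y - 1) '' Ioc (1 / 2) ((b + 1) / 2) = Ioc 0 b := by
  ext x
  constructor
  · rintro ⟨y, hy, rfl⟩
    exact ⟨by linarith [hy.1], by linarith [hy.2]⟩
  · intro hx
    exact ⟨(x + 1) / 2, ⟨by linarith [hx.1], by linarith [hx.2]⟩, by ring⟩

lemma rightBranch_hasDerivWithinAt (s : Set ℝ) (y : ℝ) :
    HasDerivWithinAt (fun y : ℝ => 2 * y - 1) 2 s y := by
  simpa using (((hasDerivAt_id y).const_mul (2 : ℝ)).sub_const 1).hasDerivWithinAt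

lemma rightBranch_injective : Function.Injective (fun y : ℝ => 2 * y - 1) := by
  intro x y h
  simp only at h
  linarith

lemma integral_mul_rightTransfer (b : ℝ) (φ f : ℝ → ℝ) :
    ∫ x in Ioc 0 b, φ x * rightTransfer f x
      = ∫ y in Ioc (1 / 2) ((b + 1) / 2), φ (2 * y - 1) * f y := by
  rw [← image_rightBranch b, integral_image_eq_integral_abs_deriv_smul measurableSet_Ioc
    (fun y _ => rightBranch_hasDerivWithinAt _ y) rightBranch_injective.injOn]
  refine setIntegral_congr_fun measurableSet_Ioc fun y _ => ?_
  have : (2 * y - 1 + 1) / 2 = y := by ring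
  simp only [rightTransfer, smul_eq_mul, this]
  norm_num
  ring

lemma integrableOn_mul_rightTransfer (b : ℝ) (φ f : ℝ → ℝ) :
    IntegrableOn (fun x => φ x * rightTransfer f x) (Ioc 0 b)
      ↔ IntegrableOn (fun y => φ (2 * y - 1) * f y) (Ioc (1 / 2) ((b + 1) / 2)) := by
  rw [← image_rightBranch b, integrableOn_image_iff_integrableOn_abs_deriv_smul measurableSet_Ioc
    (fun y _ => rightBranch_hasDerivWithinAt _ y) rightBranch_injective.injOn]
  refine integrableOn_congr_fun (fun y _ => ?_) measurableSet_Ioc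
  have : (2 * y - 1 + 1) / 2 = y := by ring
  simp only [rightTransfer, smul_eq_mul, this]
  norm_num
  ring

lemma leftInv_one {γ : ℝ} (hγ : 0 < γ) : leftInv γ 1 = 1 / 2 := by
  have := leftInv_leftBranch hγ (y := 1 / 2) ⟨by norm_num, le_rfl⟩
  rwa [leftBranch_half] at this

lemma integrableOn_leftTransfer {γ : ℝ} (hγ : 0 < γ) {f : ℝ → ℝ} (hf : IntegrableOn f (Ioc 0 1)) :
    IntegrableOn (leftTransfer γ f) (Ioc 0 1) := by
  have := integrableOn_mul_leftTransfer hγ (b := 1) ⟨zero_lt_one, le_rfl⟩ (fun _ => 1) f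
  simp only [one_mul] at this
  rw [this, leftInv_one hγ]
  exact hf.mono_set (Ioc_subset_Ioc_right (by norm_num))

lemma integrableOn_rightTransfer {f : ℝ → ℝ} (hf : IntegrableOn f (Ioc 0 1)) :
    IntegrableOn (rightTransfer f) (Ioc 0 1) := by
  have := integrableOn_mul_rightTransfer 1 (fun _ => 1) f
  simp only [one_mul] at this
  rw [this]
  exact hf.mono_set (Ioc_subset_Ioc (by norm_num) (by norm_num))

lemma integrableOn_transfer {γ : ℝ} (hγ : 0 < γ) {f : ℝ → ℝ} (hf : IntegrableOn f (Ioc 0 1)) :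
    IntegrableOn (transfer γ f) (Ioc 0 1) :=
  (integrableOn_leftTransfer hγ hf).add (integrableOn_rightTransfer hf)

lemma integral_leftTransfer {γ b : ℝ} (hγ : 0 < γ) (hb : b ∈ Ioc (0 : ℝ) 1) (f : ℝ → ℝ) :
    ∫ x in Ioc 0 b, leftTransfer γ f x = ∫ y in Ioc 0 (leftInv γ b), f y := by
  simpa using integral_mul_leftTransfer hγ hb (fun _ => 1) f

lemma integral_rightTransfer (b : ℝ) (f : ℝ → ℝ) :
    ∫ x in Ioc 0 b, rightTransfer f x = ∫ y in Ioc (1 / 2) ((b + 1) / 2), f y := by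
  simpa using integral_mul_rightTransfer b (fun _ => 1) f

lemma lsvMap_mem {γ x : ℝ} (hγ : 0 < γ) (hx : x ∈ Icc (0 : ℝ) 1) :
    lsvMap γ x ∈ Icc (0 : ℝ) 1 := by
  rcases lt_or_ge x (1 / 2) with h | h
  · rw [lsvMap_eq_leftBranch hx.1 h]
    have hx' : x ∈ Icc (0 : ℝ) (1 / 2) := ⟨hx.1, h.le⟩
    have hm := (leftBranch_strictMonoOn hγ).monotoneOn
    constructor
    · rw [← leftBranch_zero γ]; exact hm ⟨le_rfl, by norm_num⟩ hx' hx.1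
    · rw [← leftBranch_half γ]; exact hm hx' ⟨by norm_num, le_rfl⟩ h.le
  · rw [lsvMap_of_le h]
    exact ⟨by linarith, by linarith [hx.2]⟩

lemma Ioc_unit_eq_union : Ioc (0 : ℝ) 1 = Ioc 0 (1 / 2) ∪ Ioc (1 / 2) 1 :=
  (Ioc_union_Ioc_eq_Ioc (by norm_num) (by norm_num)).symm

/-- The defining duality of the transfer operator. -/
lemma integral_mul_transfer {γ : ℝ} (hγ : 0 < γ) {φ f : ℝ → ℝ}
    (h : IntegrableOn (fun x => φ (lsvMap γ x) * f x) (Ioc 0 1)) :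
    IntegrableOn (fun x => φ x * transfer γ f x) (Ioc 0 1) ∧
    ∫ x in Ioc 0 1, φ x * transfer γ f x = ∫ x in Ioc 0 1, φ (lsvMap γ x) * f x := by
  have one_mem : (1 : ℝ) ∈ Ioc (0 : ℝ) 1 := ⟨zero_lt_one, le_rfl⟩
  -- At `y = 1/2` the map follows the right branch, so the agreement with the left branch is only
  -- almost everywhere.
  have hl : ∀ᵐ y ∂volume.restrict (Ioc (0 : ℝ) (1 / 2)),
      φ (lsvMap γ y) * f y = φ (leftBranch γ y) * f y := by
    rw [ae_restrict_iff' measurableSet_Ioc]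
    have : ∀ᵐ y : ℝ, y ≠ 1 / 2 := by simp [ae_iff]
    filter_upwards [this] with y hy hy'
    rw [lsvMap_eq_leftBranch hy'.1.le (lt_of_le_of_ne hy'.2 hy)]
  have hr : EqOn (fun y => φ (lsvMap γ y) * f y) (fun y => φ (2 * y - 1) * f y)
      (Ioc (1 / 2) 1) := fun y hy => by
    simp only [lsvMap_of_le hy.1.le]
  have h' := h
  rw [Ioc_unit_eq_union, integrableOn_union] at h'
  have il : IntegrableOn (fun x => φ x * leftTransfer γ f x) (Ioc 0 1) := by
    rw [integrableOn_mul_leftTransfer hγ one_mem, leftInv_one hγ]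
    exact h'.1.congr_fun_ae hl
  have ir : IntegrableOn (fun x => φ x * rightTransfer f x) (Ioc 0 1) := by
    rw [integrableOn_mul_rightTransfer]
    norm_num only
    exact h'.2.congr_fun hr measurableSet_Ioc
  simp only [transfer, mul_add]
  refine ⟨il.add ir, ?_⟩
  rw [integral_add il ir, integral_mul_leftTransfer hγ one_mem, integral_mul_rightTransfer,
    leftInv_one hγ, Ioc_unit_eq_union, setIntegral_union
      (Ioc_disjoint_Ioc_of_le le_rfl) measurableSet_Ioc h'.1 h'.2]
  norm_num only
  congr 1
  · exact (integral_congr_ae hl).symm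
  · exact (setIntegral_congr_fun measurableSet_Ioc hr).symm

lemma integral_transfer {γ : ℝ} (hγ : 0 < γ) {f : ℝ → ℝ} (hf : IntegrableOn f (Ioc 0 1)) :
    ∫ x in Ioc 0 1, transfer γ f x = ∫ x in Ioc 0 1, f x := by
  simpa using (integral_mul_transfer hγ (φ := fun _ => 1) (f := f) (by simpa using hf)).2

lemma transfer_add (γ : ℝ) (f g : ℝ → ℝ) :
    transfer γ (fun x => f x + g x) = fun x => transfer γ f x + transfer γ g x := by
  funext x; simp only [transfer, leftTransfer, rightTransfer]; ring

lemma transfer_sub (γ : ℝ) (f g : ℝ → ℝ) :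
    transfer γ (fun x => f x - g x) = fun x => transfer γ f x - transfer γ g x := by
  funext x; simp only [transfer, leftTransfer, rightTransfer]; ring

lemma transfer_const_mul (γ c : ℝ) (f : ℝ → ℝ) :
    transfer γ (fun x => c * f x) = fun x => c * transfer γ f x := by
  funext x; simp only [transfer, leftTransfer, rightTransfer]; ring

lemma half_add_mem {x : ℝ} (hx : x ∈ Ioc (0 : ℝ) 1) : (x + 1) / 2 ∈ Ioc (0 : ℝ) 1 :=
  ⟨by linarith [hx.1], by linarith [hx.2]⟩

lemma transfer_mono {γ : ℝ} (hγ : 0 < γ) {f g : ℝ → ℝ} (h : ∀ x ∈ Ioc (0 : ℝ) 1, f x ≤ g x)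
    {x : ℝ} (hx : x ∈ Ioc (0 : ℝ) 1) : transfer γ f x ≤ transfer γ g x := by
  have h1 := one_le_leftDeriv hγ (leftInv_pos hγ hx).le
  have h2 := h _ (leftInv_mem_unit hγ hx)
  have h3 := h _ (half_add_mem hx)
  unfold transfer leftTransfer rightTransfer
  gcongr

/-- Positivity gives `|L f| ≤ L |f|` pointwise, and `L` preserves the integral of `|f|`. -/
lemma integral_abs_transfer_le {γ : ℝ} (hγ : 0 < γ) {f : ℝ → ℝ} (hf : IntegrableOn f (Ioc 0 1)) :
    ∫ x in Ioc 0 1, |transfer γ f x| ≤ ∫ x in Ioc 0 1, |f x| := by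
  rw [← integral_transfer hγ hf.abs]
  refine setIntegral_mono_on (integrableOn_transfer hγ hf).abs (integrableOn_transfer hγ hf.abs)
    measurableSet_Ioc fun x hx => ?_
  rw [abs_le]
  constructor
  · have := transfer_mono hγ (f := fun y => (-1) * |f y|) (g := f)
      (fun y _ => by linarith [neg_abs_le (f y)]) hx
    rw [transfer_const_mul] at this
    linarith
  · exact transfer_mono hγ (fun y _ => le_abs_self _) hx

/-! ### Compositions along a sequence of parameters. -/

/-- The transfer operator of the composition of the LSV maps with parameters `g 0, …, g (n - 1)`. -/
def transferIter (g : ℕ → ℝ) : ℕ → (ℝ → ℝ) → ℝ → ℝ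
  | 0, f => f
  | n + 1, f => transfer (g n) (transferIter g n f)

/-- The composition of the LSV maps with parameters `g 0, …, g (n - 1)`. -/
def lsvIter (g : ℕ → ℝ) : ℕ → ℝ → ℝ
  | 0, x => x
  | n + 1, x => lsvMap (g n) (lsvIter g n x)

lemma cocycle_eq_lsvIter {Ω : Type*} (σ : Ω → Ω) (a : Ω → ℝ) (n : ℕ) (ω : Ω) (x : ℝ) :
    cocycle σ a n ω x = lsvIter (fun i => a (σ^[i] ω)) n x := by
  induction n with
  | zero => rfl
  | succ n ih => simp only [cocycle, lsvIter, ih]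

section Iterates

variable {g : ℕ → ℝ} (hg : ∀ i, 0 < g i)

lemma transferIter_add (g : ℕ → ℝ) (m n : ℕ) (f : ℝ → ℝ) :
    transferIter g (m + n) f = transferIter (fun i => g (m + i)) n (transferIter g m f) := by
  induction n with
  | zero => rfl
  | succ n ih => rw [← add_assoc]; simp only [transferIter, ih]

lemma lsvIter_add (g : ℕ → ℝ) (m n : ℕ) (x : ℝ) :
    lsvIter g (m + n) x = lsvIter (fun i => g (m + i)) n (lsvIter g m x) := by
  induction n with
  | zero => rfl
  | succ n ih => rw [← add_assoc]; simp only [lsvIter, ih]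

lemma transferIter_add_fun (g : ℕ → ℝ) (n : ℕ) (u v : ℝ → ℝ) :
    transferIter g n (fun x => u x + v x)
      = fun x => transferIter g n u x + transferIter g n v x := by
  induction n with
  | zero => rfl
  | succ n ih => simp only [transferIter, ih, transfer_add]

lemma transferIter_sub_fun (g : ℕ → ℝ) (n : ℕ) (u v : ℝ → ℝ) :
    transferIter g n (fun x => u x - v x)
      = fun x => transferIter g n u x - transferIter g n v x := by
  induction n with
  | zero => rfl
  | succ n ih => simp only [transferIter, ih, transfer_sub]

lemma transferIter_const_mul (g : ℕ → ℝ) (n : ℕ) (c : ℝ) (u : ℝ → ℝ) :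
    transferIter g n (fun x => c * u x) = fun x => c * transferIter g n u x := by
  induction n with
  | zero => rfl
  | succ n ih => simp only [transferIter, ih, transfer_const_mul]

include hg

lemma lsvIter_mem (n : ℕ) {x : ℝ} (hx : x ∈ Icc (0 : ℝ) 1) : lsvIter g n x ∈ Icc (0 : ℝ) 1 := by
  induction n with
  | zero => exact hx
  | succ n ih => exact lsvMap_mem (hg n) ih

lemma integrableOn_transferIter (n : ℕ) {f : ℝ → ℝ} (hf : IntegrableOn f (Ioc 0 1)) :
    IntegrableOn (transferIter g n f) (Ioc 0 1) := by
  induction n with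
  | zero => exact hf
  | succ n ih => exact integrableOn_transfer (hg n) ih

lemma integral_transferIter (n : ℕ) {f : ℝ → ℝ} (hf : IntegrableOn f (Ioc 0 1)) :
    ∫ x in Ioc 0 1, transferIter g n f x = ∫ x in Ioc 0 1, f x := by
  induction n with
  | zero => rfl
  | succ n ih => rw [transferIter, integral_transfer (hg n) (integrableOn_transferIter hg n hf), ih]

lemma integral_abs_transferIter_le (n : ℕ) {f : ℝ → ℝ} (hf : IntegrableOn f (Ioc 0 1)) :
    ∫ x in Ioc 0 1, |transferIter g n f x| ≤ ∫ x in Ioc 0 1, |f x| := by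
  induction n with
  | zero => exact le_rfl
  | succ n ih =>
    exact (integral_abs_transfer_le (hg n) (integrableOn_transferIter hg n hf)).trans ih

end Iterates

lemma measurable_lsvMap_uncurry : Measurable (fun p : ℝ × ℝ => lsvMap p.1 p.2) := by
  unfold lsvMap
  refine Measurable.ite (measurableSet_lt measurable_snd measurable_const) ?_ ?_
  · fun_prop
  · fun_prop

lemma measurable_lsvMap (γ : ℝ) : Measurable (lsvMap γ) :=
  measurable_lsvMap_uncurry.comp (measurable_const.prodMk measurable_id)

lemma measurable_lsvIter (g : ℕ → ℝ) (n : ℕ) : Measurable (lsvIter g n) := by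
  induction n with
  | zero => exact measurable_id
  | succ n ih => exact (measurable_lsvMap (g n)).comp ih

lemma integrableOn_bdd_mul {φ f : ℝ → ℝ} {K : ℝ} (hφ : Measurable φ)
    (hK : ∀ x ∈ Icc (0 : ℝ) 1, |φ x| ≤ K) (hf : IntegrableOn f (Ioc 0 1)) :
    IntegrableOn (fun x => φ x * f x) (Ioc 0 1) := by
  refine Integrable.bdd_mul (c := K) hf hφ.aestronglyMeasurable ?_
  rw [ae_restrict_iff' measurableSet_Ioc]
  exact Filter.Eventually.of_forall fun x hx => hK x (Ioc_subset_Icc_self hx)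

lemma integral_mul_transferIter {g : ℕ → ℝ} (hg : ∀ i, 0 < g i) (n : ℕ) {φ f : ℝ → ℝ} {K : ℝ}
    (hφ : Measurable φ) (hK : ∀ x ∈ Icc (0 : ℝ) 1, |φ x| ≤ K) (hf : IntegrableOn f (Ioc 0 1)) :
    ∫ x in Ioc 0 1, φ x * transferIter g n f x = ∫ x in Ioc 0 1, φ (lsvIter g n x) * f x := by
  -- Duality peels off the last map and replaces `φ` by its composition with that map, which is
  -- still bounded by `K` on `[0, 1]`.
  induction n generalizing φ with
  | zero => rfl
  | succ n ih =>
    have hm : Measurable fun x => φ (lsvMap (g n) x) := hφ.comp (measurable_lsvMap _)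
    have hb : ∀ x ∈ Icc (0 : ℝ) 1, |φ (lsvMap (g n) x)| ≤ K :=
      fun x hx => hK _ (lsvMap_mem (hg n) hx)
    rw [transferIter, (integral_mul_transfer (hg n) (integrableOn_bdd_mul hm hb
      (integrableOn_transferIter hg n hf))).2, ih hm hb]
    rfl

end RandomLSV

/-! ### The invariant cone. -/

namespace RandomLSV

/-- Nonnegative, decreasing functions on `(0, 1]` which do not decrease faster than `x ^ (-p)`. -/
structure DecayClass (p : ℕ) (f : ℝ → ℝ) : Prop where
  nonneg : ∀ x ∈ Ioc (0 : ℝ) 1, 0 ≤ f x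
  anti : AntitoneOn f (Ioc 0 1)
  mono : MonotoneOn (fun x => x ^ p * f x) (Ioc 0 1)
  integrable : IntegrableOn f (Ioc 0 1)

/-- The Liverani--Saussol--Vaienti cone. -/
structure LSVCone (α : ℝ) (p : ℕ) (A : ℝ) (f : ℝ → ℝ) : Prop extends DecayClass p f where
  tail : ∀ x ∈ Ioc (0 : ℝ) 1,
    ∫ y in Ioc 0 x, f y ≤ A * x ^ (1 - α) * ∫ y in Ioc 0 1, f y

namespace DecayClass

variable {p : ℕ} {f g : ℝ → ℝ}

lemma add (hf : DecayClass p f) (hg : DecayClass p g) : DecayClass p (fun x => f x + g x) where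
  nonneg x hx := add_nonneg (hf.nonneg x hx) (hg.nonneg x hx)
  anti := hf.anti.add hg.anti
  mono := by
    have := hf.mono.add hg.mono
    refine this.congr fun x _ => ?_
    simp only [mul_add]
  integrable := hf.integrable.add hg.integrable

lemma const_mul {c : ℝ} (hc : 0 ≤ c) (hf : DecayClass p f) : DecayClass p (fun x => c * f x) where
  nonneg x hx := mul_nonneg hc (hf.nonneg x hx)
  anti x hx y hy hxy := mul_le_mul_of_nonneg_left (hf.anti hx hy hxy) hc
  mono x hx y hy hxy := by
    have := mul_le_mul_of_nonneg_left (hf.mono hx hy hxy) hc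
    simp only at this ⊢
    linarith
  integrable := hf.integrable.const_mul c

/-- The right branch halves the decay exponent because it only sees `f` on `[1/2, 1]`: the weight `x
^ p` equals `(x / z ^ 2) ^ p * z ^ (2 * p)` with `z = (x + 1) / 2`, and both factors cooperate. This
undoes the doubling caused by `sub_const`. -/
lemma rightTransfer (hf : DecayClass (2 * p) f) : DecayClass p (rightTransfer f) where
  nonneg x hx := div_nonneg (hf.nonneg _ (half_add_mem hx)) (by norm_num)
  anti x hx y hy hxy := by
    unfold RandomLSV.rightTransfer
    have := hf.anti (half_add_mem hx) (half_add_mem hy) (by linarith)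
    linarith
  mono x hx y hy hxy := by
    have h := hf.mono (half_add_mem hx) (half_add_mem hy) (by linarith)
    simp only [RandomLSV.rightTransfer] at h ⊢
    have hx0 := hx.1
    have hy0 := hy.1
    have h0 := hf.nonneg _ (half_add_mem hx)
    have h1 := hf.nonneg _ (half_add_mem hy)
    -- After clearing denominators this is `(y - x) * (1 - x * y) ≥ 0`.
    have e : x / ((x + 1) / 2) ^ 2 ≤ y / ((y + 1) / 2) ^ 2 := by
      rw [div_le_div_iff₀ (by positivity) (by positivity)]
      nlinarith [mul_nonneg (sub_nonneg.2 hxy) (sub_nonneg.2 (mul_le_one₀ hx.2 hy0.le hy.2))]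
    have key : ∀ z : ℝ, 0 < z → z ^ p * (f ((z + 1) / 2) / 2)
        = (z / ((z + 1) / 2) ^ 2) ^ p * (((z + 1) / 2) ^ (2 * p) * f ((z + 1) / 2)) / 2 := by
      intro z hz
      rw [div_pow, pow_mul]
      field_simp
    rw [key x hx0, key y hy0]
    gcongr
  integrable := integrableOn_rightTransfer hf.integrable

/-- For exponent `2` the cross-multiplied difference is `(t - s) * ((1 - γ) + (s + t) + (1 + γ) * s
* t)`; the remaining powers of `1 + t` are increasing. This is where `p ≥ 2` and `γ ≤ 1` enter. -/
lemma pow_div_leftDeriv_mono {p : ℕ} (hp : 2 ≤ p) {γ s t : ℝ} (hγ0 : 0 ≤ γ) (hγ : γ ≤ 1)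
    (hs : 0 ≤ s) (hst : s ≤ t) :
    (1 + s) ^ p / (1 + (1 + γ) * s) ≤ (1 + t) ^ p / (1 + (1 + γ) * t) := by
  have ht : 0 ≤ t := hs.trans hst
  obtain ⟨k, rfl⟩ := Nat.exists_eq_add_of_le hp
  have key : (1 + s) ^ 2 / (1 + (1 + γ) * s) ≤ (1 + t) ^ 2 / (1 + (1 + γ) * t) := by
    rw [div_le_div_iff₀ (by positivity) (by positivity)]
    have h1 : 0 ≤ (t - s) * (1 - γ) := mul_nonneg (by linarith) (by linarith)
    have h2 : 0 ≤ (t - s) * ((s + t) + (1 + γ) * (s * t)) := by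
      apply mul_nonneg (by linarith); positivity
    nlinarith
  have e : ∀ r : ℝ, (1 + r) ^ (2 + k) / (1 + (1 + γ) * r)
      = (1 + r) ^ 2 / (1 + (1 + γ) * r) * (1 + r) ^ k := fun r => by rw [pow_add]; ring
  rw [e, e]
  gcongr

/-- With `x = y * (1 + t)` and `t = (2 * y) ^ γ`, the function `x ^ p * (L f) x` factors as `(1 + t)
^ p / (1 + (1 + γ) * t)` times `y ^ p * f y`, and both factors increase with `y`. -/
lemma leftTransfer (hp : 2 ≤ p) {γ : ℝ} (hγ0 : 0 < γ) (hγ : γ ≤ 1) (hf : DecayClass p f) :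
    DecayClass p (leftTransfer γ f) where
  nonneg x hx := div_nonneg (hf.nonneg _ (leftInv_mem_unit hγ0 hx))
    (zero_le_one.trans (one_le_leftDeriv hγ0 (leftInv_pos hγ0 hx).le))
  anti x hx y hy hxy := by
    have hm := leftInv_monotoneOn hγ0 hx hy hxy
    have h1 := hf.anti (leftInv_mem_unit hγ0 hx) (leftInv_mem_unit hγ0 hy) hm
    have h2 := leftDeriv_mono hγ0 (leftInv_pos hγ0 hx).le hm
    have h3 := one_le_leftDeriv hγ0 (leftInv_pos hγ0 hx).le
    exact div_le_div₀ (hf.nonneg _ (leftInv_mem_unit hγ0 hx)) h1 (by linarith) h2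
  mono x hx y hy hxy := by
    have hm := leftInv_monotoneOn hγ0 hx hy hxy
    have h1 := hf.mono (leftInv_mem_unit hγ0 hx) (leftInv_mem_unit hγ0 hy) hm
    have key : ∀ z ∈ Ioc (0 : ℝ) 1, z ^ p * RandomLSV.leftTransfer γ f z
        = (1 + (2 * leftInv γ z) ^ γ) ^ p / (1 + (1 + γ) * (2 * leftInv γ z) ^ γ)
          * (leftInv γ z ^ p * f (leftInv γ z)) := by
      intro z hz
      have e := leftBranch_leftInv hγ0 (Ioc_subset_Icc_self hz)
      have : z ^ p = leftInv γ z ^ p * (1 + (2 * leftInv γ z) ^ γ) ^ p := by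
        rw [← mul_pow]; congr 1; exact e.symm
      rw [this, RandomLSV.leftTransfer, leftDeriv]
      ring
    simp only at h1 ⊢
    rw [key x hx, key y hy]
    have hx' := leftInv_mem_unit hγ0 hx
    have hy' := leftInv_mem_unit hγ0 hy
    have h2 : (2 * leftInv γ x) ^ γ ≤ (2 * leftInv γ y) ^ γ :=
      Real.rpow_le_rpow (by linarith [hx'.1]) (by linarith) hγ0.le
    have h3 : 0 ≤ (2 * leftInv γ x) ^ γ := Real.rpow_nonneg (by linarith [hx'.1]) _
    have h4 : 0 ≤ (2 * leftInv γ y) ^ γ := h3.trans h2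
    refine mul_le_mul (pow_div_leftDeriv_mono hp hγ0.le hγ h3 h2) h1
      (mul_nonneg (pow_nonneg hx'.1.le _) (hf.nonneg _ hx')) (by positivity)
  integrable := integrableOn_leftTransfer hγ0 hf.integrable

lemma weaken {q : ℕ} (hpq : p ≤ q) (hf : DecayClass p f) : DecayClass q f where
  nonneg := hf.nonneg
  anti := hf.anti
  mono x hx y hy hxy := by
    obtain ⟨k, rfl⟩ := Nat.exists_eq_add_of_le hpq
    have h := hf.mono hx hy hxy
    have h0 := hf.nonneg y hy
    have hk : x ^ k ≤ y ^ k := pow_le_pow_left₀ hx.1.le hxy k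
    have hx0 := hx.1
    have hy0 := hy.1
    simp only at h ⊢
    calc x ^ (p + k) * f x = x ^ k * (x ^ p * f x) := by ring
      _ ≤ y ^ k * (y ^ p * f y) := mul_le_mul hk h
          (mul_nonneg (by positivity) (hf.nonneg x hx)) (by positivity)
      _ = y ^ (p + k) * f y := by ring
  integrable := hf.integrable

lemma transfer (hp : 2 ≤ p) {γ : ℝ} (hγ0 : 0 < γ) (hγ : γ ≤ 1) (hf : DecayClass p f) :
    DecayClass p (transfer γ f) :=
  (hf.leftTransfer hp hγ0 hγ).add (hf.weaken (by omega : p ≤ 2 * p)).rightTransfer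

/-- Removing at most half of the minimum of `f` at most doubles the exponent of decay. -/
lemma sub_const {c : ℝ} (hc : 0 ≤ c) (h : ∀ x ∈ Ioc (0 : ℝ) 1, 2 * c ≤ f x)
    (hf : DecayClass p f) : DecayClass (2 * p) (fun x => f x - c) where
  nonneg x hx := by linarith [h x hx]
  anti x hx y hy hxy := sub_le_sub_right (hf.anti hx hy hxy) c
  mono x hx y hy hxy := by
    have h1 := hf.mono hx hy hxy
    have h2 := h y hy
    simp only at h1 ⊢
    have hxp : 0 < x ^ p := pow_pos hx.1 p
    have hxy' : x ^ p ≤ y ^ p := pow_le_pow_left₀ hx.1.le hxy p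
    rw [pow_mul', pow_mul']
    set X := x ^ p
    set Y := y ^ p
    -- First `X ^ 2 * f x ≤ X * Y * f y`. Then `f y ≥ 2 * c` leaves `2 * c * Y * (Y - X) - c * (Y ^
    -- 2 - X ^ 2) = c * (Y - X) ^ 2 ≥ 0`.
    nlinarith [mul_nonneg hxp.le (sub_nonneg.2 h1),
      mul_nonneg (mul_nonneg (hxp.le.trans hxy') (sub_nonneg.2 hxy')) (sub_nonneg.2 h2),
      mul_nonneg (mul_nonneg hc (sub_nonneg.2 hxy')) (sub_nonneg.2 hxy')]
  integrable := hf.integrable.sub (integrableOn_const (by simp))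

lemma integral_nonneg (hf : DecayClass p f) : 0 ≤ ∫ x in Ioc 0 1, f x :=
  setIntegral_nonneg measurableSet_Ioc hf.nonneg

lemma setIntegral_le (hf : DecayClass p f) {s : Set ℝ} (hs : s ⊆ Ioc 0 1) :
    ∫ x in s, f x ≤ ∫ x in Ioc 0 1, f x :=
  setIntegral_mono_set hf.integrable
    ((ae_restrict_iff' measurableSet_Ioc).2 (Filter.Eventually.of_forall hf.nonneg))
    (Filter.Eventually.of_forall hs)

/-- A decreasing density has its value at `1 / 2` bounded by its mass. -/
lemma half_le (hf : DecayClass p f) : f (1 / 2) ≤ 2 * ∫ x in Ioc 0 1, f x := by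
  have h1 : ∫ x in Ioc (0 : ℝ) (1 / 2), f (1 / 2) ≤ ∫ x in Ioc (0 : ℝ) (1 / 2), f x := by
    refine setIntegral_mono_on (integrableOn_const (by simp))
      (hf.integrable.mono_set (Ioc_subset_Ioc_right (by norm_num))) measurableSet_Ioc ?_
    intro x hx
    exact hf.anti ⟨hx.1, hx.2.trans (by norm_num)⟩ ⟨by norm_num, by norm_num⟩ hx.2
  have h2 := hf.setIntegral_le (s := Ioc 0 (1 / 2)) (Ioc_subset_Ioc_right (by norm_num))
  simp at h1
  norm_num at h1 h2 ⊢
  linarith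

/-- The right preimage of `(0, x]` has length `x / 2` and lies above `1/2`, where a decreasing `f`
is at most `f (1 / 2)`. -/
lemma rightTransfer_tail (hf : DecayClass p f) {x : ℝ} (hx : x ∈ Ioc (0 : ℝ) 1) :
    ∫ y in Ioc 0 x, RandomLSV.rightTransfer f y ≤ x / 2 * f (1 / 2) := by
  rw [integral_rightTransfer]
  have h1 : ∫ y in Ioc (1 / 2) ((x + 1) / 2), f y ≤ ∫ y in Ioc (1 / 2) ((x + 1) / 2), f (1 / 2) := by
    refine setIntegral_mono_on (hf.integrable.mono_set (Ioc_subset_Ioc (by norm_num)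
      (by linarith [hx.2]))) (integrableOn_const (by simp)) measurableSet_Ioc ?_
    intro y hy
    exact hf.anti ⟨by norm_num, by norm_num⟩ ⟨by linarith [hy.1], by linarith [hy.2, hx.2]⟩ hy.1.le
  refine h1.trans (le_of_eq ?_)
  rw [setIntegral_const, Measure.real, Real.volume_Ioc, ENNReal.toReal_ofReal (by linarith [hx.1])]
  rw [smul_eq_mul]; ring

end DecayClass

namespace LSVCone

variable {α A : ℝ} {p : ℕ} {f g : ℝ → ℝ}

lemma add (hf : LSVCone α p A f) (hg : LSVCone α p A g) :
    LSVCone α p A (fun x => f x + g x) where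
  toDecayClass := hf.toDecayClass.add hg.toDecayClass
  tail x hx := by
    have hs : Ioc (0 : ℝ) x ⊆ Ioc 0 1 := Ioc_subset_Ioc_right hx.2
    rw [integral_add (hf.integrable.mono_set hs) (hg.integrable.mono_set hs),
      integral_add hf.integrable hg.integrable, mul_add]
    exact add_le_add (hf.tail x hx) (hg.tail x hx)

lemma const_mul {c : ℝ} (hc : 0 ≤ c) (hf : LSVCone α p A f) :
    LSVCone α p A (fun x => c * f x) where
  toDecayClass := hf.toDecayClass.const_mul hc
  tail x hx := by
    rw [integral_const_mul, integral_const_mul]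
    have := mul_le_mul_of_nonneg_left (hf.tail x hx) hc
    linarith

lemma const {c : ℝ} (hc : 0 ≤ c) (hA : 1 ≤ A) (hα : 0 ≤ α) : LSVCone α p A (fun _ => c) where
  nonneg _ _ := hc
  anti := antitoneOn_const
  mono x hx y _ hxy := mul_le_mul_of_nonneg_right (pow_le_pow_left₀ hx.1.le hxy p) hc
  integrable := integrableOn_const (by simp)
  tail x hx := by
    have h1 : x ≤ x ^ (1 - α) := by
      simpa using Real.rpow_le_rpow_of_exponent_ge hx.1 hx.2 (by linarith : 1 - α ≤ 1)
    simp [hx.1.le]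
    have : x ≤ A * x ^ (1 - α) := by nlinarith [hx.1]
    nlinarith

/-- The right branch maps any function of controlled decay into the cone. -/
lemma of_rightTransfer (hA : 4 ^ p ≤ A) (hα0 : 0 ≤ α)
    (hf : DecayClass (2 * p) f) : LSVCone α p A (rightTransfer f) where
  toDecayClass := hf.rightTransfer
  tail x hx := by
    refine (hf.rightTransfer_tail hx).trans ?_
    rw [integral_rightTransfer]
    norm_num only
    -- Comparing `x ^ (2 * p) * f x` at `1/2` and `1` costs `2 ^ (2 * p) = 4 ^ p`. Together with `f
    -- 1 ≤ 2 * m` below, it bounds the tail by the mass `m` on `(1/2, 1]`, which is the whole mass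
    -- of the image.
    have h0 : f (1 / 2) ≤ 4 ^ p * f 1 := by
      have := hf.mono (a := 1 / 2) (b := 1) ⟨by norm_num, by norm_num⟩ ⟨by norm_num, by norm_num⟩
        (by norm_num)
      simp only [one_pow, one_mul, pow_mul] at this
      norm_num at this ⊢
      rw [div_pow, one_pow] at this
      field_simp at this
      linarith
    have h1 : f 1 ≤ 2 * ∫ y in Ioc (1 / 2 : ℝ) 1, f y := by
      have : ∫ y in Ioc (1 / 2 : ℝ) 1, f 1 ≤ ∫ y in Ioc (1 / 2 : ℝ) 1, f y := by
        refine setIntegral_mono_on (integrableOn_const (by simp))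
          (hf.integrable.mono_set (Ioc_subset_Ioc_left (by norm_num))) measurableSet_Ioc ?_
        intro y hy
        exact hf.anti ⟨by linarith [hy.1], hy.2⟩ ⟨by norm_num, by norm_num⟩ hy.2
      simp at this
      norm_num at this ⊢
      linarith
    have hx1 : x ≤ x ^ (1 - α) := by
      simpa using Real.rpow_le_rpow_of_exponent_ge hx.1 hx.2 (by linarith : 1 - α ≤ 1)
    have h2 : 0 ≤ f 1 := hf.nonneg 1 ⟨by norm_num, by norm_num⟩
    have h3 : (0 : ℝ) ≤ 4 ^ p := by positivity
    have hx0 := hx.1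
    set m := ∫ y in Ioc (1 / 2 : ℝ) 1, f y
    calc x / 2 * f (1 / 2) ≤ x / 2 * (4 ^ p * (2 * m)) := by gcongr; nlinarith
      _ = 4 ^ p * x * m := by ring
      _ ≤ A * x ^ (1 - α) * m := by
        have : 0 ≤ m := by linarith
        have : 0 ≤ A := h3.trans hA
        gcongr

/-- Bernoulli's inequality for the exponent `α` bounds the denominator of `(1 + t) / (1 + t) ^ α`.
The linear gain in `t` is what pays for the mass arriving through the right branch. -/
lemma one_add_rpow_lower {α t : ℝ} (hα0 : 0 ≤ α) (hα : α < 1) (ht0 : 0 ≤ t) (ht : t ≤ 1) :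
    1 + (1 - α) / 2 * t ≤ (1 + t) ^ (1 - α) := by
  have h1 : (1 + t) ^ α ≤ 1 + α * t :=
    rpow_one_add_le_one_add_mul_self (by linarith) hα0 hα.le
  have h2 : (1 + t) ^ (1 - α) = (1 + t) / (1 + t) ^ α := by
    rw [Real.rpow_sub (by linarith), Real.rpow_one]
  have h3 : 0 < (1 + t) ^ α := Real.rpow_pos_of_pos (by linarith) _
  rw [h2, le_div_iff₀ h3]
  refine (mul_le_mul_of_nonneg_left h1 (by nlinarith)).trans ?_
  nlinarith [mul_nonneg ht0 (sub_nonneg.2 hα.le), mul_nonneg (mul_nonneg ht0 (sub_nonneg.2 hα.le))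
    (sub_nonneg.2 (mul_le_one₀ hα.le ht0 ht))]

/-- The transfer operator preserves the cone. -/
lemma transfer (hp : 2 ≤ p) {γ : ℝ} (hγ0 : 0 < γ) (hγ : γ ≤ α) (hα : α < 1)
    (hA : 4 / (1 - α) ≤ A) (hf : LSVCone α p A f) : LSVCone α p A (transfer γ f) where
  toDecayClass := hf.toDecayClass.transfer hp hγ0 (hγ.trans hα.le)
  tail x hx := by
    have hm0 := hf.integral_nonneg
    have hs : Ioc (0 : ℝ) x ⊆ Ioc 0 1 := Ioc_subset_Ioc_right hx.2
    rw [integral_transfer hγ0 hf.integrable]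
    have e : ∫ y in Ioc 0 x, RandomLSV.transfer γ f y
        = (∫ y in Ioc 0 x, leftTransfer γ f y) + ∫ y in Ioc 0 x, rightTransfer f y :=
      integral_add ((integrableOn_leftTransfer hγ0 hf.integrable).mono_set hs)
        ((integrableOn_rightTransfer hf.integrable).mono_set hs)
    rw [e, integral_leftTransfer hγ0 hx]
    have h1 := hf.tail _ (leftInv_mem_unit hγ0 hx)
    have h2 := (hf.rightTransfer_tail hx).trans
      (mul_le_mul_of_nonneg_left hf.half_le (by linarith [hx.1] : 0 ≤ x / 2))
    have hy := leftInv_mem_Ioc hγ0 hx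
    have hxy := leftBranch_leftInv hγ0 (Ioc_subset_Icc_self hx)
    set y := leftInv γ x
    set m := ∫ y in Ioc 0 1, f y
    have hα0 : 0 < α := hγ0.trans_le hγ
    have ht0 : 0 ≤ (2 * y) ^ γ := Real.rpow_nonneg (by linarith [hy.1]) _
    have ht1 : (2 * y) ^ γ ≤ 1 := two_mul_rpow_le_one hγ0 hy.1.le hy.2
    have ht2 : y ^ α ≤ (2 * y) ^ γ := by
      calc y ^ α ≤ (2 * y) ^ α := Real.rpow_le_rpow hy.1.le (by linarith [hy.1]) hα0.le
        _ ≤ (2 * y) ^ γ :=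
          Real.rpow_le_rpow_of_exponent_ge (by linarith [hy.1]) (by linarith [hy.2]) hγ
    have hy1 : 0 < y ^ (1 - α) := Real.rpow_pos_of_pos hy.1 _
    have hyy : y = y ^ (1 - α) * y ^ α := by
      rw [← Real.rpow_add hy.1]; simp
    have hxpow : y ^ (1 - α) * (1 + (1 - α) / 2 * (2 * y) ^ γ) ≤ x ^ (1 - α) := by
      rw [← hxy, leftBranch, Real.mul_rpow hy.1.le (by linarith)]
      exact mul_le_mul_of_nonneg_left (one_add_rpow_lower hα0.le hα ht0 ht1) hy1.le
    -- The incoming mass is at most `x * m`; this expresses `x` in the same unit `y ^ (1 - α) * t`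
    -- as the gain in `hxpow`.
    have hx2 : x ≤ 2 * (y ^ (1 - α) * (2 * y) ^ γ) := by
      have h3 : x ≤ 2 * y := by
        rw [← hxy, leftBranch]; nlinarith [hy.1]
      have h4 : y ≤ y ^ (1 - α) * (2 * y) ^ γ := by
        nth_rewrite 1 [hyy]
        exact mul_le_mul_of_nonneg_left ht2 hy1.le
      linarith
    have hA' : 4 ≤ A * (1 - α) := by
      rwa [div_le_iff₀ (by linarith)] at hA
    have hA0 : 0 ≤ A := le_trans (by have : 0 < 1 - α := by linarith
                                     positivity) hA
    -- The gain is `A * (1 - α) / 2` units and the loss `2` units, hence the condition `A ≥ 4 / (1 -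
    -- α)`.
    have hfin : A * y ^ (1 - α) + x ≤ A * x ^ (1 - α) := by
      have h5 := mul_le_mul_of_nonneg_left hxpow hA0
      have h6 := mul_le_mul_of_nonneg_right hA' (mul_nonneg hy1.le ht0)
      nlinarith
    calc _ ≤ A * y ^ (1 - α) * m + x / 2 * (2 * m) := add_le_add h1 h2
      _ = (A * y ^ (1 - α) + x) * m := by ring
      _ ≤ A * x ^ (1 - α) * m := mul_le_mul_of_nonneg_right hfin hm0

lemma transferIter (hp : 2 ≤ p) {g : ℕ → ℝ} (hg0 : ∀ i, 0 < g i) (hg : ∀ i, g i ≤ α) (hα : α < 1)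
    (hA : 4 / (1 - α) ≤ A) (hf : LSVCone α p A f) (n : ℕ) :
    LSVCone α p A (transferIter g n f) := by
  induction n with
  | zero => exact hf
  | succ n ih => exact ih.transfer hp (hg0 n) (hg n) hα hA

/-- A positive lower bound for the functions of unit mass in the cone. -/
lemma exists_lower_bound (α : ℝ) (hα : α < 1) (p : ℕ) (A : ℝ) :
    ∃ κ : ℝ, 0 < κ ∧ κ ≤ 1 ∧ ∀ f, LSVCone α p A f →
      ∀ x ∈ Ioc (0 : ℝ) 1, κ * ∫ y in Ioc 0 1, f y ≤ f x := by
  -- By the tail bound, at most half of the mass lies in `(0, d]`.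
  obtain ⟨d, hd0, hd1, hd⟩ : ∃ d : ℝ, 0 < d ∧ d ≤ 1 ∧ A * d ^ (1 - α) ≤ 1 / 2 := by
    have : Filter.Tendsto (fun d : ℝ => A * d ^ (1 - α)) (nhds 0) (nhds (A * 0 ^ (1 - α))) :=
      (Real.continuous_rpow_const (by linarith)).continuousAt.const_mul A
    rw [Real.zero_rpow (by linarith), mul_zero] at this
    have h1 := (this.eventually_lt_const (by norm_num : (0 : ℝ) < 1 / 2))
    have h2 := h1.filter_mono (nhdsWithin_le_nhds (s := Ioi 0))
    obtain ⟨d, hd, hd'⟩ := (h2.and (Ioc_mem_nhdsGT (zero_lt_one (α := ℝ)))).exists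
    exact ⟨d, hd'.1, hd'.2, hd.le⟩
  refine ⟨d ^ p / 2, by positivity, ?_, fun f hf x hx => ?_⟩
  · have := pow_le_one₀ (n := p) hd0.le hd1
    linarith
  have h1 : f 1 ≤ f x := hf.anti hx ⟨by norm_num, le_rfl⟩ hx.2
  refine le_trans ?_ h1
  have hm0 := hf.integral_nonneg
  have hdp : 0 < d ^ p := pow_pos hd0 p
  have h2 := hf.tail d ⟨hd0, hd1⟩
  -- On `(d, 1]` monotonicity of `y ^ p * f y` gives `f y ≤ f 1 / d ^ p`, so the other half of the
  -- mass forces `f 1 ≥ d ^ p / 2 * m`, the minimum of `f`.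
  have h3 : ∫ y in Ioc d 1, f y ≤ f 1 / d ^ p := by
    have h4 : ∫ y in Ioc d 1, f y ≤ ∫ y in Ioc d 1, f 1 / d ^ p := by
      refine setIntegral_mono_on (hf.integrable.mono_set (Ioc_subset_Ioc_left hd0.le))
        (integrableOn_const (by simp)) measurableSet_Ioc fun y hy => ?_
      have hy' : y ∈ Ioc (0 : ℝ) 1 := ⟨hd0.trans hy.1, hy.2⟩
      have h5 := hf.mono hy' ⟨by norm_num, le_rfl⟩ hy.2
      simp only [one_pow, one_mul] at h5
      rw [le_div_iff₀ hdp, mul_comm]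
      exact (mul_le_mul_of_nonneg_right (pow_le_pow_left₀ hd0.le hy.1.le p)
        (hf.nonneg y hy')).trans h5
    have h6 : 0 ≤ f 1 / d ^ p := div_nonneg (hf.nonneg 1 ⟨by norm_num, le_rfl⟩) hdp.le
    refine h4.trans ?_
    rw [setIntegral_const, Measure.real, Real.volume_Ioc, ENNReal.toReal_ofReal (by linarith),
      smul_eq_mul]
    nlinarith
  have h7 : ∫ y in Ioc 0 1, f y = (∫ y in Ioc 0 d, f y) + ∫ y in Ioc d 1, f y := by
    rw [← setIntegral_union (Ioc_disjoint_Ioc_of_le le_rfl) measurableSet_Ioc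
      (hf.integrable.mono_set (Ioc_subset_Ioc_right hd1))
      (hf.integrable.mono_set (Ioc_subset_Ioc_left hd0.le)), Ioc_union_Ioc_eq_Ioc hd0.le hd1]
  rw [le_div_iff₀ hdp] at h3
  have h8 := mul_le_mul_of_nonneg_right hd hm0
  set m := ∫ y in Ioc 0 1, f y
  have h9 : m / 2 ≤ ∫ y in Ioc d 1, f y := by linarith
  nlinarith

end LSVCone

end RandomLSV

/-! ### Loss of memory in the cone. -/

namespace RandomLSV

/-- Each step along the left branch increases `x ^ (-α)` by a definite amount, backwards in time. -/
lemma rpow_neg_leftInv {α γ x : ℝ} (hγ0 : 0 < γ) (hγ : γ ≤ α) (hα : α < 1)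
    (hx : x ∈ Ioc (0 : ℝ) 1) : x ^ (-α) + α / 4 ≤ leftInv γ x ^ (-α) := by
  have hα0 : 0 < α := hγ0.trans_le hγ
  have hy := leftInv_mem_Ioc hγ0 hx
  have hxy := leftBranch_leftInv hγ0 (Ioc_subset_Icc_self hx)
  set y := leftInv γ x
  have ht0 : 0 ≤ (2 * y) ^ γ := Real.rpow_nonneg (by linarith [hy.1]) _
  have ht1 : (2 * y) ^ γ ≤ 1 := two_mul_rpow_le_one hγ0 hy.1.le hy.2
  have ht2 : y ^ α ≤ (2 * y) ^ γ := by
    calc y ^ α ≤ (2 * y) ^ α := Real.rpow_le_rpow hy.1.le (by linarith [hy.1]) hα0.le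
      _ ≤ (2 * y) ^ γ :=
        Real.rpow_le_rpow_of_exponent_ge (by linarith [hy.1]) (by linarith [hy.2]) hγ
  set t := (2 * y) ^ γ
  have h1 : x ^ α = y ^ α * (1 + t) ^ α := by
    rw [← hxy, leftBranch, Real.mul_rpow hy.1.le (by linarith)]
  have h2 : 1 + α / 2 * t ≤ (1 + t) ^ α := by
    -- Used with `1 - α` for `α`, so that the exponent becomes `α`.
    have := LSVCone.one_add_rpow_lower (α := 1 - α) (by linarith) (by linarith) ht0 ht1
    simpa using this
  have h3 : (1 + t) ^ α ≤ 2 := by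
    have := rpow_one_add_le_one_add_mul_self (by linarith : -1 ≤ t) hα0.le hα.le
    nlinarith
  have hya : 0 < y ^ α := Real.rpow_pos_of_pos hy.1 _
  have hta : 0 < (1 + t) ^ α := Real.rpow_pos_of_pos (by linarith) _
  rw [Real.rpow_neg hx.1.le, Real.rpow_neg hy.1.le, h1]
  rw [← sub_nonneg]
  have e : (y ^ α)⁻¹ - ((y ^ α * (1 + t) ^ α)⁻¹ + α / 4)
      = ((1 + t) ^ α - 1 - α / 4 * (y ^ α * (1 + t) ^ α)) / (y ^ α * (1 + t) ^ α) := by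
    field_simp
    ring
  rw [e]
  apply div_nonneg _ (by positivity)
  -- The numerator is at least `α / 2 * t - α / 4 * (2 * t) = 0`.
  nlinarith [mul_le_mul ht2 h3 hta.le ht0]

/-- The evolution of a function of controlled decay splits into a part in the cone, which has
visited `[1 / 2, 1]`, and a small remainder, which has not. -/
lemma exists_split {α : ℝ} (hα0 : 0 < α) (hα : α < 1) {p : ℕ} (hp : 2 ≤ p) {A : ℝ}
    (hA : 4 / (1 - α) ≤ A) (hA' : 4 ^ p ≤ A) {g : ℕ → ℝ} (hg0 : ∀ i, 0 < g i) (hg : ∀ i, g i ≤ α)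
    {B s : ℝ} (hB : 0 ≤ B) (hs : 0 ≤ s) {h : ℝ → ℝ} (hh : DecayClass (2 * p) h)
    (htail : ∀ x ∈ Ioc (0 : ℝ) 1, ∫ y in Ioc 0 x, h y ≤ B * (x ^ (-α)) ^ (-s)) (N : ℕ) :
    ∃ u r : ℝ → ℝ, LSVCone α p A u ∧ DecayClass (2 * p) r ∧
      (transferIter g N h = fun x => u x + r x) ∧
      ∀ x ∈ Ioc (0 : ℝ) 1, ∫ y in Ioc 0 x, r y ≤ B * (x ^ (-α) + α / 4 * N) ^ (-s) := by
  have hA1 : 1 ≤ A := (one_le_pow₀ (by norm_num : (1 : ℝ) ≤ 4)).trans hA'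
  induction N with
  | zero =>
    refine ⟨fun _ => 0, h, LSVCone.const le_rfl hA1 hα0.le, hh, ?_, ?_⟩
    · funext x; simp [transferIter]
    · simpa using htail
  | succ N ih =>
    obtain ⟨u, r, hu, hr, e, ht⟩ := ih
    -- Whatever leaves `r` through the right branch enters the cone and stays there. The new
    -- remainder has only used left branches, and each of them adds `α / 4` to `x ^ (-α)` in its
    -- tail bound.
    refine ⟨fun x => transfer (g N) u x + rightTransfer r x, leftTransfer (g N) r,
      (hu.transfer hp (hg0 N) (hg N) hα hA).add (LSVCone.of_rightTransfer hA' hα0.le hr),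
      hr.leftTransfer (by omega) (hg0 N) ((hg N).trans hα.le), ?_, ?_⟩
    · rw [transferIter, e, transfer_add]
      funext x
      simp only [transfer]
      ring
    · intro x hx
      rw [integral_leftTransfer (hg0 N) hx]
      refine (ht _ (leftInv_mem_unit (hg0 N) hx)).trans (mul_le_mul_of_nonneg_left ?_ hB)
      have h1 := rpow_neg_leftInv (hg0 N) (hg N) hα hx
      have h2 : 0 < x ^ (-α) := Real.rpow_pos_of_pos hx.1 _
      have h3 : 0 ≤ α / 4 * N := by positivity
      refine Real.rpow_le_rpow_of_nonpos ?_ ?_ (by linarith)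
      · push_cast; nlinarith
      · push_cast; linarith

/-- `d` bounds the loss of memory in `n` steps of the functions in the cone. -/
def IsDecayRate (α : ℝ) (p : ℕ) (A : ℝ) (n : ℕ) (d : ℝ) : Prop :=
  0 ≤ d ∧ ∀ g : ℕ → ℝ, (∀ i, 0 < g i) → (∀ i, g i ≤ α) → ∀ u v : ℝ → ℝ,
    LSVCone α p A u → LSVCone α p A v → ∫ x in Ioc 0 1, u x = ∫ x in Ioc 0 1, v x →
    ∫ x in Ioc 0 1, |transferIter g n u x - transferIter g n v x| ≤ d * ∫ x in Ioc 0 1, u x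

lemma integral_abs_sub_le {u v : ℝ → ℝ} (hu : IntegrableOn u (Ioc 0 1))
    (hv : IntegrableOn v (Ioc 0 1)) :
    ∫ x in Ioc (0 : ℝ) 1, |u x - v x|
      ≤ (∫ x in Ioc (0 : ℝ) 1, |u x|) + ∫ x in Ioc (0 : ℝ) 1, |v x| := by
  rw [← integral_add hu.abs hv.abs]
  exact integral_mono (hu.sub hv).abs (hu.abs.add hv.abs) fun x => abs_sub _ _

lemma integral_abs_add_le {u v : ℝ → ℝ} (hu : IntegrableOn u (Ioc 0 1))
    (hv : IntegrableOn v (Ioc 0 1)) :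
    ∫ x in Ioc (0 : ℝ) 1, |u x + v x|
      ≤ (∫ x in Ioc (0 : ℝ) 1, |u x|) + ∫ x in Ioc (0 : ℝ) 1, |v x| := by
  rw [← integral_add hu.abs hv.abs]
  exact integral_mono (hu.add hv).abs (hu.abs.add hv.abs) fun x => abs_add_le _ _

lemma DecayClass.integral_abs {p : ℕ} {f : ℝ → ℝ} (hf : DecayClass p f) :
    ∫ x in Ioc (0 : ℝ) 1, |f x| = ∫ x in Ioc (0 : ℝ) 1, f x :=
  setIntegral_congr_fun measurableSet_Ioc fun x hx => abs_of_nonneg (hf.nonneg x hx)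

lemma isDecayRate_two (α : ℝ) (p : ℕ) (A : ℝ) (n : ℕ) : IsDecayRate α p A n 2 := by
  refine ⟨by norm_num, fun g hg0 _ u v hu hv huv => ?_⟩
  refine (integral_abs_sub_le (integrableOn_transferIter hg0 n hu.integrable)
    (integrableOn_transferIter hg0 n hv.integrable)).trans ?_
  have h1 := integral_abs_transferIter_le hg0 n hu.integrable
  have h2 := integral_abs_transferIter_le hg0 n hv.integrable
  rw [hu.integral_abs] at h1
  rw [hv.integral_abs] at h2
  linarith

lemma IsDecayRate.succ {α : ℝ} {p : ℕ} {A : ℝ} {n : ℕ} {d : ℝ} (h : IsDecayRate α p A n d) :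
    IsDecayRate α p A (n + 1) d := by
  refine ⟨h.1, fun g hg0 hg u v hu hv huv => le_trans ?_ (h.2 g hg0 hg u v hu hv huv)⟩
  have := integral_abs_transfer_le (hg0 n) ((integrableOn_transferIter hg0 n hu.integrable).sub
    (integrableOn_transferIter hg0 n hv.integrable))
  rwa [show (transferIter g n u - transferIter g n v)
    = fun x => transferIter g n u x - transferIter g n v x from rfl, transfer_sub] at this

/-- Rescale `v` to the mass of `u` and apply the rate; the discarded fraction of `v` contributes
exactly the difference of the masses, since transfer operators contract `L¹`. -/
lemma IsDecayRate.of_le_mass {α : ℝ} {p : ℕ} {A : ℝ} {n : ℕ} {d : ℝ} (h : IsDecayRate α p A n d)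
    {g : ℕ → ℝ} (hg0 : ∀ i, 0 < g i) (hg : ∀ i, g i ≤ α) {u v : ℝ → ℝ} (hu : LSVCone α p A u)
    (hv : LSVCone α p A v) (huv : ∫ x in Ioc 0 1, u x ≤ ∫ x in Ioc 0 1, v x) :
    ∫ x in Ioc 0 1, |transferIter g n u x - transferIter g n v x|
      ≤ d * (∫ x in Ioc 0 1, u x) + ((∫ x in Ioc 0 1, v x) - ∫ x in Ioc 0 1, u x) := by
  rcases huv.eq_or_lt with heq | hlt
  · rw [heq, sub_self, add_zero, ← heq]
    exact h.2 g hg0 hg u v hu hv heq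
  have hU := hu.integral_nonneg
  have hV : 0 < ∫ x in Ioc 0 1, v x := hU.trans_lt hlt
  set U := ∫ x in Ioc 0 1, u x
  set V := ∫ x in Ioc 0 1, v x
  have hc0 : 0 ≤ U / V := by positivity
  have h1 := h.2 g hg0 hg u (fun x => U / V * v x) hu (hv.const_mul hc0) (by
    rw [integral_const_mul, div_mul_cancel₀ _ hV.ne'])
  rw [transferIter_const_mul] at h1
  have iu := integrableOn_transferIter hg0 n hu.integrable
  have iv := integrableOn_transferIter hg0 n hv.integrable
  have h2 := integral_abs_sub_le (iu.sub (iv.const_mul (U / V))) (iv.const_mul (1 - U / V))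
  have h3 := integral_abs_transferIter_le hg0 n hv.integrable
  rw [hv.integral_abs] at h3
  have h4 : 0 ≤ 1 - U / V := by
    rw [sub_nonneg, div_le_one hV]; exact hlt.le
  have h5 : ∫ x in Ioc (0 : ℝ) 1, |(1 - U / V) * transferIter g n v x| ≤ V - U := by
    simp only [abs_mul, abs_of_nonneg h4]
    rw [integral_const_mul]
    refine (mul_le_mul_of_nonneg_left h3 h4).trans (le_of_eq ?_)
    rw [sub_mul, one_mul, div_mul_cancel₀ _ hV.ne']
  have e : ∀ x, transferIter g n u x - transferIter g n v x
      = (transferIter g n u - fun x => U / V * transferIter g n v x) x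
        - (1 - U / V) * transferIter g n v x := fun x => by
    simp only [Pi.sub_apply]; ring
  simp only [e]
  simp only [Pi.sub_apply] at h2 ⊢
  linarith

lemma IsDecayRate.of_mass {α : ℝ} {p : ℕ} {A : ℝ} {n : ℕ} {d : ℝ} (h : IsDecayRate α p A n d)
    {g : ℕ → ℝ} (hg0 : ∀ i, 0 < g i) (hg : ∀ i, g i ≤ α) {u v : ℝ → ℝ} (hu : LSVCone α p A u)
    (hv : LSVCone α p A v) :
    ∫ x in Ioc 0 1, |transferIter g n u x - transferIter g n v x|
      ≤ d * (∫ x in Ioc 0 1, u x) + |(∫ x in Ioc 0 1, u x) - ∫ x in Ioc 0 1, v x| := by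
  rcases le_total (∫ x in Ioc 0 1, u x) (∫ x in Ioc 0 1, v x) with huv | huv
  · rw [abs_sub_comm, abs_of_nonneg (sub_nonneg.2 huv)]
    exact h.of_le_mass hg0 hg hu hv huv
  · rw [abs_of_nonneg (sub_nonneg.2 huv)]
    have := h.of_le_mass hg0 hg hv hu huv
    simp only [abs_sub_comm] at this ⊢
    have h1 := mul_le_mul_of_nonneg_left huv h.1
    linarith

/-- The recursive inequality for the loss of memory. -/
lemma exists_decay_recursion {α : ℝ} (hα0 : 0 < α) (hα : α < 1) {p : ℕ} (hp : 2 ≤ p) {A : ℝ}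
    (hA : 4 / (1 - α) ≤ A) (hA' : 4 ^ p ≤ A) :
    ∃ q : ℝ, 0 ≤ q ∧ q < 1 ∧ ∀ n d N, IsDecayRate α p A n d →
      IsDecayRate α p A (N + n) (q * d + 3 * (A * (1 + α / 4 * N) ^ (-((1 - α) / α)))) := by
  obtain ⟨κ, hκ0, hκ1, hκ⟩ := LSVCone.exists_lower_bound α hα p A
  have hA0 : 0 ≤ A := (by positivity : (0 : ℝ) ≤ 4 ^ p).trans hA'
  have hs : 0 ≤ (1 - α) / α := div_nonneg (by linarith) hα0.le
  -- Removing only half of the lower bound `κ * M` is what `sub_const` allows.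
  refine ⟨1 - κ / 2, by linarith, by linarith, fun n d N hd => ⟨?_, ?_⟩⟩
  · have h1 : 0 ≤ (1 - κ / 2) * d := mul_nonneg (by linarith) hd.1
    have h2 : (0 : ℝ) ≤ (1 + α / 4 * N) ^ (-((1 - α) / α)) :=
      Real.rpow_nonneg (by positivity) _
    have h3 := mul_nonneg hA0 h2
    linarith
  intro g hg0 hg f₁ f₂ hf₁ hf₂ hm
  set M := ∫ x in Ioc 0 1, f₁ x with hM
  have hM0 : 0 ≤ M := hf₁.integral_nonneg
  set t := A * (1 + α / 4 * (N : ℝ)) ^ (-((1 - α) / α))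
  have split : ∀ f, LSVCone α p A f → ∫ x in Ioc 0 1, f x = M →
      ∃ u r : ℝ → ℝ, LSVCone α p A u ∧ DecayClass (2 * p) r ∧
        (transferIter g N (fun x => f x - κ / 2 * M) = fun x => u x + r x) ∧
        (∫ x in Ioc 0 1, u x = (1 - κ / 2) * M - ∫ x in Ioc 0 1, r x) ∧
        ∫ x in Ioc 0 1, r x ≤ t * M := by
    intro f hf hfM
    have hh := hf.toDecayClass.sub_const (c := κ / 2 * M) (by positivity) fun x hx => by
      have := hκ f hf x hx
      rw [hfM] at this
      linarith
    -- With `s = (1 - α) / α` one has `(x ^ (-α)) ^ (-s) = x ^ (1 - α)`, so the cone's tail bound is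
    -- the required initial bound.
    obtain ⟨u, r, hu, hr, e, ht⟩ := exists_split hα0 hα hp hA hA' hg0 hg (B := A * M)
      (mul_nonneg hA0 hM0) hs hh (fun x hx => by
        have h1 := hf.tail x hx
        have h2 : ∫ y in Ioc 0 x, (f y - κ / 2 * M) ≤ ∫ y in Ioc 0 x, f y := by
          have hsub : Ioc (0 : ℝ) x ⊆ Ioc 0 1 := Ioc_subset_Ioc_right hx.2
          refine setIntegral_mono_on (hh.integrable.mono_set hsub) (hf.integrable.mono_set hsub)
            measurableSet_Ioc fun y _ => ?_
          have : 0 ≤ κ / 2 * M := by positivity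
          linarith
        refine h2.trans (h1.trans (le_of_eq ?_))
        rw [← Real.rpow_mul hx.1.le, hfM]
        have : -α * -((1 - α) / α) = 1 - α := by field_simp
        rw [this]
        ring) N
    refine ⟨u, r, hu, hr, e, ?_, ?_⟩
    · have h1 := integral_transferIter hg0 N hh.integrable
      rw [e, integral_add hu.integrable hr.integrable,
        integral_sub hf.integrable (integrableOn_const (by simp)), hfM] at h1
      simp at h1
      linarith
    · have := ht 1 ⟨zero_lt_one, le_rfl⟩
      rw [Real.one_rpow] at this
      refine this.trans (le_of_eq ?_)
      simp only [t]
      ring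
  obtain ⟨u₁, r₁, hu₁, hr₁, e₁, hmu₁, hmr₁⟩ := split f₁ hf₁ rfl
  obtain ⟨u₂, r₂, hu₂, hr₂, e₂, hmu₂, hmr₂⟩ := split f₂ hf₂ hm.symm
  have hr₁0 := hr₁.integral_nonneg
  have hr₂0 := hr₂.integral_nonneg
  set g' : ℕ → ℝ := fun i => g (N + i)
  have hg0' : ∀ i, 0 < g' i := fun i => hg0 _
  have hg' : ∀ i, g' i ≤ α := fun i => hg _
  have h1 := hd.of_mass hg0' hg' hu₁ hu₂
  have iu₁ := integrableOn_transferIter hg0' n hu₁.integrable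
  have iu₂ := integrableOn_transferIter hg0' n hu₂.integrable
  have ir₁ := integrableOn_transferIter hg0' n hr₁.integrable
  have ir₂ := integrableOn_transferIter hg0' n hr₂.integrable
  have h2 := integral_abs_add_le (iu₁.sub iu₂) (ir₁.sub ir₂)
  have h3 := integral_abs_sub_le ir₁ ir₂
  have h4 := integral_abs_transferIter_le hg0' n hr₁.integrable
  have h5 := integral_abs_transferIter_le hg0' n hr₂.integrable
  rw [hr₁.integral_abs] at h4
  rw [hr₂.integral_abs] at h5
  have e : ∀ x, transferIter g (N + n) f₁ x - transferIter g (N + n) f₂ x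
      = (transferIter g' n u₁ x - transferIter g' n u₂ x)
        + (transferIter g' n r₁ x - transferIter g' n r₂ x) := by
    intro x
    -- The same constant is removed from both densities, so it cancels in the difference and its own
    -- evolution never matters.
    have e0 : (fun x => f₁ x - f₂ x)
        = fun x => (f₁ x - κ / 2 * M) - (f₂ x - κ / 2 * M) := by funext x; ring
    have e3 := congrFun (transferIter_sub_fun g (N + n) f₁ f₂) x
    rw [e0, transferIter_sub_fun, transferIter_add, transferIter_add, e₁, e₂,
      transferIter_add_fun, transferIter_add_fun] at e3
    simp only at e3
    rw [← e3]
    ring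
  simp only [e]
  simp only [Pi.sub_apply] at h2
  -- The `u`-parts need not have equal mass; the mismatch is at most `t * M`. With the masses of the
  -- two remainders this gives the factor `3`.
  have h6 : |(∫ x in Ioc 0 1, u₁ x) - ∫ x in Ioc 0 1, u₂ x| ≤ t * M := by
    rw [hmu₁, hmu₂, abs_le]
    constructor <;> linarith
  have h7 : d * (∫ x in Ioc 0 1, u₁ x) ≤ d * ((1 - κ / 2) * M) :=
    mul_le_mul_of_nonneg_left (by linarith) hd.1
  linarith

/-! ### The optimal rate and its summability. -/

/-- The optimal rate of loss of memory. -/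
def decayRate (α : ℝ) (p : ℕ) (A : ℝ) (n : ℕ) : ℝ := sInf {d | IsDecayRate α p A n d}

lemma bddBelow_isDecayRate (α : ℝ) (p : ℕ) (A : ℝ) (n : ℕ) :
    BddBelow {d | IsDecayRate α p A n d} := ⟨0, fun _ hd => hd.1⟩

lemma isDecayRate_decayRate (α : ℝ) (p : ℕ) (A : ℝ) (n : ℕ) :
    IsDecayRate α p A n (decayRate α p A n) := by
  have hne : {d | IsDecayRate α p A n d}.Nonempty := ⟨2, isDecayRate_two α p A n⟩
  refine ⟨le_csInf hne fun _ hd => hd.1, fun g hg0 hg u v hu hv huv => ?_⟩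
  -- The infimum is attained because one may divide by the mass; zero mass is settled by the trivial
  -- rate `2`.
  rcases hu.integral_nonneg.eq_or_lt with h0 | hpos
  · have := (isDecayRate_two α p A n).2 g hg0 hg u v hu hv huv
    rw [← h0] at this ⊢
    simpa using this
  · rw [← div_le_iff₀ hpos]
    refine le_csInf hne fun d hd => ?_
    rw [div_le_iff₀ hpos]
    exact hd.2 g hg0 hg u v hu hv huv

lemma decayRate_le {α : ℝ} {p : ℕ} {A : ℝ} {n : ℕ} {d : ℝ} (h : IsDecayRate α p A n d) :
    decayRate α p A n ≤ d := csInf_le (bddBelow_isDecayRate α p A n) h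

lemma decayRate_antitone (α : ℝ) (p : ℕ) (A : ℝ) : Antitone (decayRate α p A) :=
  antitone_nat_of_succ_le fun n => decayRate_le (isDecayRate_decayRate α p A n).succ

/-- Summing `D (2 * N) ≤ q * D N + t N` closes only when `2 * q < 1`. The recursion is therefore
iterated `K` times, so that the contraction `q ^ K` beats the factor `K + 1` lost when the sum of
`D` is compared with its sum over multiples of `K + 1`. -/
lemma summable_of_recursion {D t : ℕ → ℝ} {q : ℝ} (hD : Antitone D) (hD0 : ∀ n, 0 ≤ D n)
    (ht0 : ∀ n, 0 ≤ t n) (ht : Summable t) (hq0 : 0 ≤ q) (hq : q < 1)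
    (h : ∀ N n, D (N + n) ≤ q * D n + t N) : Summable D := by
  obtain ⟨K, hK⟩ : ∃ K : ℕ, ((K : ℝ) + 1) * q ^ K ≤ 1 / 2 := by
    have h1 := tendsto_self_mul_const_pow_of_lt_one hq0 hq
    have h2 := tendsto_pow_atTop_nhds_zero_of_lt_one hq0 hq
    have h3 := h1.add h2
    rw [add_zero] at h3
    obtain ⟨K, hK⟩ := (h3.eventually_lt_const (by norm_num : (0 : ℝ) < 1 / 2)).exists
    exact ⟨K, by nlinarith⟩
  have hiter : ∀ k N : ℕ, D (k * N + N) ≤ q ^ k * D N + k * t N := by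
    intro k N
    induction k with
    | zero => simp
    | succ k ih =>
      have h1 := h N (k * N + N)
      have h2 : (k + 1) * N + N = N + (k * N + N) := by ring
      rw [h2]
      have h3 := mul_le_mul_of_nonneg_left ih hq0
      have h4 : q * (k * t N) ≤ k * t N := by
        have : 0 ≤ (k : ℝ) * t N := mul_nonneg (Nat.cast_nonneg k) (ht0 N)
        nlinarith
      push_cast
      rw [pow_succ]
      nlinarith
  -- Monotonicity bounds each block of `K + 1` consecutive terms by its first one.
  have hblock : ∀ m : ℕ, ∑ n ∈ Finset.range ((K + 1) * m), D n
      ≤ (K + 1) * ∑ N ∈ Finset.range m, D (K * N + N) := by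
    intro m
    induction m with
    | zero => simp
    | succ m ih =>
      rw [mul_add, mul_one, Finset.sum_range_add,
        Finset.sum_range_succ (fun N => D (K * N + N)), mul_add]
      refine add_le_add ih ?_
      calc ∑ x ∈ Finset.range (K + 1), D ((K + 1) * m + x)
          ≤ ∑ x ∈ Finset.range (K + 1), D (K * m + m) :=
            Finset.sum_le_sum fun x _ => hD (by nlinarith)
        _ = (K + 1) * D (K * m + m) := by simp
  -- The partial sum `S` satisfies `S ≤ S / 2 + (K + 1) * K * ∑ t`; it is finite, so half of it can
  -- be absorbed.
  refine summable_of_sum_range_le (c := 2 * ((K + 1) * (K * ∑' n, t n))) hD0 fun m => ?_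
  have h1 : ∑ n ∈ Finset.range m, D n ≤ ∑ n ∈ Finset.range ((K + 1) * m), D n :=
    Finset.sum_le_sum_of_subset_of_nonneg (Finset.range_mono (by nlinarith)) fun i _ _ => hD0 i
  have h2 : ∑ N ∈ Finset.range m, D (K * N + N)
      ≤ q ^ K * ∑ N ∈ Finset.range m, D N + K * ∑ N ∈ Finset.range m, t N := by
    rw [Finset.mul_sum, Finset.mul_sum, ← Finset.sum_add_distrib]
    exact Finset.sum_le_sum fun N _ => hiter K N
  have h3 : ∑ N ∈ Finset.range m, t N ≤ ∑' n, t n := ht.sum_le_tsum _ fun i _ => ht0 i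
  have h4 : 0 ≤ ∑ N ∈ Finset.range m, D N := Finset.sum_nonneg fun i _ => hD0 i
  have hK0 : (0 : ℝ) ≤ K := Nat.cast_nonneg K
  have h5 := mul_le_mul_of_nonneg_right hK h4
  have h6 := hblock m
  have h7 := mul_le_mul_of_nonneg_left h2 (by linarith : (0 : ℝ) ≤ K + 1)
  have h8 := mul_le_mul_of_nonneg_left (mul_le_mul_of_nonneg_left h3 hK0)
    (by linarith : (0 : ℝ) ≤ K + 1)
  nlinarith

/-- For exponents below `1 / 2`, the loss of memory is summable. -/
theorem summable_decayRate {α : ℝ} (hα0 : 0 < α) (hα : α < 1 / 2) {p : ℕ} (hp : 2 ≤ p) {A : ℝ}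
    (hA : 4 / (1 - α) ≤ A) (hA' : 4 ^ p ≤ A) : Summable (decayRate α p A) := by
  obtain ⟨q, hq0, hq, h⟩ := exists_decay_recursion hα0 (by linarith) hp hA hA'
  have hA0 : 0 ≤ A := (by positivity : (0 : ℝ) ≤ 4 ^ p).trans hA'
  -- The use of `α < 1 / 2`: the remainders in the recursion are summable.
  have hs : 1 < (1 - α) / α := by rw [lt_div_iff₀ hα0]; linarith
  refine summable_of_recursion (decayRate_antitone α p A)
    (fun n => (isDecayRate_decayRate α p A n).1)
    (t := fun N => 3 * (A * (1 + α / 4 * (N : ℝ)) ^ (-((1 - α) / α)))) (fun N => by positivity) ?_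
    hq0 hq (fun N n => decayRate_le (h n _ N (isDecayRate_decayRate α p A n)))
  refine (Summable.mul_left A ?_).mul_left 3
  set s := (1 - α) / α
  have h1 : Summable fun n : ℕ => ((n + 1 : ℕ) : ℝ) ^ (-s) :=
    (summable_nat_add_iff 1).2 (Real.summable_nat_rpow.2 (by linarith))
  refine (h1.mul_left ((α / 4) ^ (-s))).of_nonneg_of_le (fun N => by positivity) fun N => ?_
  rw [← Real.mul_rpow (by positivity) (by positivity)]
  refine Real.rpow_le_rpow_of_nonpos (by positivity) ?_ (by linarith)
  push_cast
  linarith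

end RandomLSV

/-! ### Lipschitz observables and decay of correlations. -/

namespace RandomLSV

/-- `f` is bounded by `M` and `M`-Lipschitz on `[0, 1]`. -/
structure LipBound (M : ℝ) (f : ℝ → ℝ) : Prop where
  bound : ∀ x ∈ Icc (0 : ℝ) 1, |f x| ≤ M
  lip : ∀ x ∈ Icc (0 : ℝ) 1, ∀ y ∈ Icc (0 : ℝ) 1, |f x - f y| ≤ M * |x - y|

lemma LipBound.continuousOn {M : ℝ} {f : ℝ → ℝ} (hf : LipBound M f) :
    ContinuousOn f (Icc 0 1) := by
  have hM : 0 ≤ M := (abs_nonneg _).trans (hf.bound 0 ⟨le_rfl, zero_le_one⟩)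
  have : LipschitzOnWith (Real.toNNReal M) f (Icc 0 1) := by
    refine LipschitzOnWith.of_dist_le_mul fun x hx y hy => ?_
    rw [Real.dist_eq, Real.dist_eq, Real.coe_toNNReal _ hM]
    exact hf.lip x hx y hy
  exact this.continuousOn

/-- Multiplication by a decreasing function bounded away from zero which varies little. -/
lemma LSVCone.mul {α A c : ℝ} {p : ℕ} {h φ : ℝ → ℝ} (hh : LSVCone α p A h) (hA : 0 ≤ A)
    (hc : 0 ≤ c) (hφ1 : ∀ x ∈ Ioc (0 : ℝ) 1, c ≤ φ x) (hφ2 : ∀ x ∈ Ioc (0 : ℝ) 1, φ x ≤ 2 * c)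
    (hanti : AntitoneOn φ (Ioc 0 1)) (hmono : MonotoneOn (fun x => x ^ 2 * φ x) (Ioc 0 1)) :
    LSVCone α (p + 2) (2 * A) (fun x => φ x * h x) := by
  have hint : IntegrableOn (fun x => φ x * h x) (Ioc 0 1) := by
    refine Integrable.bdd_mul (c := 2 * c) hh.integrable
      (aemeasurable_restrict_of_antitoneOn measurableSet_Ioc hanti).aestronglyMeasurable ?_
    rw [ae_restrict_iff' measurableSet_Ioc]
    refine Filter.Eventually.of_forall fun x hx => ?_
    rw [Real.norm_eq_abs, abs_of_nonneg (hc.trans (hφ1 x hx))]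
    exact hφ2 x hx
  have hφ0 : ∀ x ∈ Ioc (0 : ℝ) 1, 0 ≤ φ x := fun x hx => hc.trans (hφ1 x hx)
  refine ⟨⟨fun x hx => mul_nonneg (hφ0 x hx) (hh.nonneg x hx), fun x hx y hy hxy =>
    mul_le_mul (hanti hx hy hxy) (hh.anti hx hy hxy) (hh.nonneg y hy) (hφ0 x hx), ?_, hint⟩, ?_⟩
  · intro x hx y hy hxy
    have h1 := hmono hx hy hxy
    have h2 := hh.mono hx hy hxy
    simp only at h1 h2 ⊢
    have hx0 := hx.1
    have hy0 := hy.1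
    calc x ^ (p + 2) * (φ x * h x) = (x ^ 2 * φ x) * (x ^ p * h x) := by ring
      _ ≤ (y ^ 2 * φ y) * (y ^ p * h y) := mul_le_mul h1 h2
        (mul_nonneg (by positivity) (hh.nonneg x hx)) (mul_nonneg (by positivity) (hφ0 y hy))
      _ = y ^ (p + 2) * (φ y * h y) := by ring
  · intro x hx
    have hs : Ioc (0 : ℝ) x ⊆ Ioc 0 1 := Ioc_subset_Ioc_right hx.2
    have h1 : ∫ y in Ioc 0 x, φ y * h y ≤ 2 * c * ∫ y in Ioc 0 x, h y := by
      rw [← integral_const_mul]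
      exact setIntegral_mono_on (hint.mono_set hs) ((hh.integrable.mono_set hs).const_mul _)
        measurableSet_Ioc fun y hy =>
          mul_le_mul_of_nonneg_right (hφ2 y (hs hy)) (hh.nonneg y (hs hy))
    have h2 : c * ∫ y in Ioc 0 1, h y ≤ ∫ y in Ioc 0 1, φ y * h y := by
      rw [← integral_const_mul]
      exact setIntegral_mono_on (hh.integrable.const_mul _) hint
        measurableSet_Ioc fun y hy =>
          mul_le_mul_of_nonneg_right (hφ1 y hy) (hh.nonneg y hy)
    have h3 := hh.tail x hx
    have h4 : 0 ≤ x ^ (1 - α) := Real.rpow_nonneg hx.1.le _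
    calc _ ≤ 2 * c * ∫ y in Ioc 0 x, h y := h1
      _ ≤ 2 * c * (A * x ^ (1 - α) * ∫ y in Ioc 0 1, h y) := by gcongr
      _ = 2 * A * x ^ (1 - α) * (c * ∫ y in Ioc 0 1, h y) := by ring
      _ ≤ _ := by gcongr

/-- Functions of the form used to write a Lipschitz function as a difference of functions in the
cone. -/
lemma LSVCone.mul_lip {α A M : ℝ} {p : ℕ} {h f : ℝ → ℝ} (hh : LSVCone α p A h) (hA : 0 ≤ A)
    (hM : 0 ≤ M) (hf : ∀ x ∈ Icc (0 : ℝ) 1, |f x| ≤ 2 * M)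
    (hlip : ∀ x ∈ Icc (0 : ℝ) 1, ∀ y ∈ Icc (0 : ℝ) 1, |f x - f y| ≤ M * |x - y|) :
    LSVCone α (p + 2) (2 * A) (fun x => (10 * M + f x - M * x) * h x) := by
  -- Since `|f| ≤ 2 * M`, the factor lies between `7 * M` and `12 * M`. The term `-M * x` outweighs
  -- the Lipschitz variation of `f` and makes it decreasing.
  refine hh.mul hA (c := 7 * M) (by positivity) ?_ ?_ ?_ ?_
  · intro x hx
    have := abs_le.1 (hf x (Ioc_subset_Icc_self hx))
    nlinarith [hx.2]
  · intro x hx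
    have := abs_le.1 (hf x (Ioc_subset_Icc_self hx))
    nlinarith [hx.1]
  · intro x hx y hy hxy
    have := hlip y (Ioc_subset_Icc_self hy) x (Ioc_subset_Icc_self hx)
    rw [abs_of_nonneg (sub_nonneg.2 hxy)] at this
    have := (abs_le.1 this).2
    simp only
    linarith
  · intro x hx y hy hxy
    have h1 := hlip y (Ioc_subset_Icc_self hy) x (Ioc_subset_Icc_self hx)
    rw [abs_of_nonneg (sub_nonneg.2 hxy)] at h1
    have h2 := (abs_le.1 h1).1
    have h3 := (abs_le.1 (hf y (Ioc_subset_Icc_self hy))).1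
    have hx0 := hx.1
    have hy0 := hy.1
    have hx1 := hx.2
    have hy1 := hy.2
    simp only
    have h4 : 7 * M ≤ 10 * M + f y - M * y := by nlinarith
    -- The factor drops by at most `2 * M * (y - x)`, which the growth of `x ^ 2` against a value of
    -- at least `7 * M` compensates.
    have h5 : 10 * M + f x - M * x ≤ 10 * M + f y - M * y + 2 * M * (y - x) := by linarith
    have h6 : x ^ 2 ≤ x := by nlinarith
    have h7 : x ^ 2 * (10 * M + f x - M * x)
        ≤ x ^ 2 * (10 * M + f y - M * y + 2 * M * (y - x)) :=
      mul_le_mul_of_nonneg_left h5 (by positivity)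
    have h8 : x ^ 2 * (2 * M * (y - x)) ≤ x * (2 * M * (y - x)) :=
      mul_le_mul_of_nonneg_right h6 (mul_nonneg (by positivity) (by linarith))
    have h9 : (y - x) * (y + x) * (7 * M) ≤ (y - x) * (y + x) * (10 * M + f y - M * y) :=
      mul_le_mul_of_nonneg_left h4 (mul_nonneg (by linarith) (by linarith))
    nlinarith [mul_nonneg (mul_nonneg hM hx0.le) (sub_nonneg.2 hxy),
      mul_nonneg (mul_nonneg hM hy0.le) (sub_nonneg.2 hxy)]

/-- Decay of correlations against densities in the cone. -/
lemma abs_integral_lsvIter_mul_le {α A M d K c : ℝ} {p n : ℕ} (hA : 0 ≤ A)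
    (hd : IsDecayRate α (p + 2) (2 * A) n d) {g : ℕ → ℝ} (hg0 : ∀ i, 0 < g i) (hg : ∀ i, g i ≤ α)
    {h F φ : ℝ → ℝ} (hh : LSVCone α p A h) (hF : LipBound M F) (hc : |c| ≤ M)
    (hmean : ∫ x in Ioc 0 1, (F x - c) * h x = 0) (hφ : Measurable φ)
    (hK : ∀ x ∈ Icc (0 : ℝ) 1, |φ x| ≤ K) :
    |∫ x in Ioc 0 1, φ (lsvIter g n x) * ((F x - c) * h x)|
      ≤ K * (d * (14 * M * ∫ x in Ioc 0 1, h x)) := by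
  have hM : 0 ≤ M := (abs_nonneg c).trans hc
  have hK0 : 0 ≤ K := (abs_nonneg _).trans (hK 0 ⟨le_rfl, zero_le_one⟩)
  -- `(F - c) * h` is the difference of the cone functions built from `F - c` and from `0`; the
  -- mean-zero condition says that their masses agree.
  have hu := hh.mul_lip hA hM (f := fun x => F x - c)
    (fun x hx => by
      have := abs_sub (F x) c
      linarith [hF.bound x hx])
    (fun x hx y hy => by simpa using hF.lip x hx y hy)
  have hv := hh.mul_lip hA hM (f := fun _ => 0) (fun x _ => by simpa using hM)
    (fun x _ y _ => by simpa using mul_nonneg hM (abs_nonneg _))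
  set u : ℝ → ℝ := fun x => (10 * M + (F x - c) - M * x) * h x
  set v : ℝ → ℝ := fun x => (10 * M + 0 - M * x) * h x
  have huv : ∀ x, (F x - c) * h x = u x - v x := fun x => by simp only [u, v]; ring
  simp only [huv] at hmean ⊢
  rw [integral_sub hu.integrable hv.integrable, sub_eq_zero] at hmean
  rw [← integral_mul_transferIter hg0 n (f := fun x => u x - v x) hφ hK
      (hu.integrable.sub hv.integrable),
    transferIter_sub_fun]
  have h1 := hd.2 g hg0 hg u v hu hv hmean
  have iu := integrableOn_transferIter hg0 n hu.integrable
  have iv := integrableOn_transferIter hg0 n hv.integrable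
  have h2 : ∫ x in Ioc 0 1, v x ≤ 14 * M * ∫ x in Ioc 0 1, h x := by
    rw [← integral_const_mul]
    refine setIntegral_mono_on hv.integrable (hh.integrable.const_mul _) measurableSet_Ioc
      fun x hx => mul_le_mul_of_nonneg_right ?_ (hh.nonneg x hx)
    nlinarith [hx.1]
  calc _ ≤ ∫ x in Ioc (0 : ℝ) 1, K * |transferIter g n u x - transferIter g n v x| := by
        refine (abs_integral_le_integral_abs).trans ?_
        refine setIntegral_mono_on (integrableOn_bdd_mul hφ hK (iu.sub iv)).abs
          ((iu.sub iv).abs.const_mul K) measurableSet_Ioc fun x hx => ?_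
        rw [abs_mul]
        exact mul_le_mul_of_nonneg_right (hK x (Ioc_subset_Icc_self hx)) (abs_nonneg _)
    _ = K * ∫ x in Ioc (0 : ℝ) 1, |transferIter g n u x - transferIter g n v x| :=
        integral_const_mul _ _
    _ ≤ K * (d * ∫ x in Ioc 0 1, u x) := by gcongr
    _ ≤ _ := by
        rw [hmean]
        have := hd.1
        gcongr

/-- Loss of memory for densities in the cone. -/
lemma abs_integral_lsvIter_sub_le {α A d K : ℝ} {p n : ℕ}
    (hd : IsDecayRate α p A n d) {g : ℕ → ℝ} (hg0 : ∀ i, 0 < g i) (hg : ∀ i, g i ≤ α)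
    {u v φ : ℝ → ℝ} (hu : LSVCone α p A u) (hv : LSVCone α p A v)
    (huv : ∫ x in Ioc 0 1, u x = ∫ x in Ioc 0 1, v x) (hφ : Measurable φ)
    (hK : ∀ x ∈ Icc (0 : ℝ) 1, |φ x| ≤ K) :
    |(∫ x in Ioc 0 1, φ (lsvIter g n x) * u x) - ∫ x in Ioc 0 1, φ (lsvIter g n x) * v x|
      ≤ K * (d * ∫ x in Ioc 0 1, u x) := by
  have hK0 : 0 ≤ K := (abs_nonneg _).trans (hK 0 ⟨le_rfl, zero_le_one⟩)
  have iu := integrableOn_transferIter hg0 n hu.integrable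
  have iv := integrableOn_transferIter hg0 n hv.integrable
  rw [← integral_mul_transferIter hg0 n hφ hK hu.integrable,
    ← integral_mul_transferIter hg0 n hφ hK hv.integrable, ← integral_sub
      (integrableOn_bdd_mul hφ hK iu) (integrableOn_bdd_mul hφ hK iv)]
  simp only [← mul_sub]
  calc _ ≤ ∫ x in Ioc (0 : ℝ) 1, K * |transferIter g n u x - transferIter g n v x| := by
        refine (abs_integral_le_integral_abs).trans ?_
        refine setIntegral_mono_on (integrableOn_bdd_mul hφ hK (iu.sub iv)).abs
          ((iu.sub iv).abs.const_mul K) measurableSet_Ioc fun x hx => ?_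
        rw [abs_mul]
        exact mul_le_mul_of_nonneg_right (hK x (Ioc_subset_Icc_self hx)) (abs_nonneg _)
    _ = K * ∫ x in Ioc (0 : ℝ) 1, |transferIter g n u x - transferIter g n v x| :=
        integral_const_mul _ _
    _ ≤ _ := mul_le_mul_of_nonneg_left (hd.2 g hg0 hg u v hu hv huv) hK0

lemma exists_lipBound_polynomial (P : Polynomial ℝ) : ∃ M, LipBound M (fun x => P.eval x) := by
  obtain ⟨M₁, h₁⟩ := isCompact_Icc.exists_bound_of_continuousOn (s := Icc (0 : ℝ) 1)
    (f := fun x => P.eval x) P.continuous.continuousOn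
  obtain ⟨M₂, h₂⟩ := isCompact_Icc.exists_bound_of_continuousOn (s := Icc (0 : ℝ) 1)
    (f := fun x => P.derivative.eval x) P.derivative.continuous.continuousOn
  refine ⟨max M₁ M₂, fun x hx => (h₁ x hx).trans (le_max_left _ _), fun x hx y hy => ?_⟩
  exact (convex_Icc 0 1).norm_image_sub_le_of_norm_hasDerivWithin_le
    (fun z _ => (P.hasDerivAt z).hasDerivWithinAt)
    (fun z hz => (h₂ z hz).trans (le_max_right _ _)) hy hx

lemma exists_polynomial_integral_sub_le {h : ℝ → ℝ} (hh : IntegrableOn h (Ioc 0 1)) {ε : ℝ}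
    (hε : 0 < ε) : ∃ P : Polynomial ℝ, ∫ x in Ioc (0 : ℝ) 1, |h x - P.eval x| ≤ ε := by
  obtain ⟨G, -, hG, hGc, hGi⟩ := Integrable.exists_hasCompactSupport_integral_sub_le hh
    (half_pos hε)
  obtain ⟨P, hP⟩ := exists_polynomial_near_of_continuousOn 0 1 G hGc.continuousOn _ (half_pos hε)
  refine ⟨P, ?_⟩
  have hPi : IntegrableOn (fun x => P.eval x) (Ioc 0 1) :=
    (P.continuous.integrableOn_Icc (a := 0) (b := 1)).mono_set Ioc_subset_Icc_self
  have h1 : ∫ x in Ioc (0 : ℝ) 1, |G x - P.eval x| ≤ ∫ x in Ioc (0 : ℝ) 1, ε / 2 := by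
    refine setIntegral_mono_on (hGi.sub hPi).abs (integrableOn_const (by simp)) measurableSet_Ioc
      fun x hx => ?_
    rw [abs_sub_comm]
    exact (hP x (Ioc_subset_Icc_self hx)).le
  simp only [setIntegral_const, measureReal_def, Real.volume_Ioc] at h1
  norm_num at h1
  have h2 := integral_abs_add_le (hh.sub hGi) (hGi.sub hPi)
  simp only [Pi.sub_apply, sub_add_sub_cancel] at h2
  simp only [Real.norm_eq_abs] at hG
  linarith

/-- Loss of memory for arbitrary integrable densities, without a rate. -/
lemma eventually_abs_integral_lsvIter_le {α A : ℝ} {p : ℕ} {D : ℕ → ℝ} (hα0 : 0 ≤ α) (hA : 1 ≤ A)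
    (hD : ∀ n, IsDecayRate α (p + 2) (2 * A) n (D n))
    (hD0 : Filter.Tendsto D Filter.atTop (nhds 0)) {h : ℝ → ℝ}
    (hh : IntegrableOn h (Ioc 0 1)) {ε : ℝ} (hε : 0 < ε) :
    ∃ N₀, ∀ N ≥ N₀, ∀ g : ℕ → ℝ, (∀ i, 0 < g i) → (∀ i, g i ≤ α) → ∀ φ : ℝ → ℝ, Measurable φ →
      (∀ x ∈ Icc (0 : ℝ) 1, |φ x| ≤ 1) →
      |(∫ x in Ioc 0 1, φ (lsvIter g N x) * h x)
        - (∫ x in Ioc 0 1, h x) * ∫ x in Ioc 0 1, φ (lsvIter g N x)| ≤ ε := by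
  -- A polynomial is Lipschitz, so the decay estimate applies to it with respect to the constant
  -- density `1`. The two replacements of `h` by `P` cost `ε / 3` each, uniformly in `g` and `φ`.
  obtain ⟨P, hP⟩ := exists_polynomial_integral_sub_le hh (by positivity : 0 < ε / 3)
  obtain ⟨M, hM⟩ := exists_lipBound_polynomial P
  have hPi : IntegrableOn (fun x => P.eval x) (Ioc 0 1) :=
    (P.continuous.integrableOn_Icc (a := 0) (b := 1)).mono_set Ioc_subset_Icc_self
  set c := ∫ x in Ioc (0 : ℝ) 1, P.eval x with hc
  have hcM : |c| ≤ M := by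
    refine abs_integral_le_integral_abs.trans ?_
    have h1 : ∫ x in Ioc (0 : ℝ) 1, |P.eval x| ≤ ∫ x in Ioc (0 : ℝ) 1, M :=
      setIntegral_mono_on hPi.abs (integrableOn_const (by simp)) measurableSet_Ioc
        fun x hx => hM.bound x (Ioc_subset_Icc_self hx)
    simpa [measureReal_def] using h1
  have hlim : Filter.Tendsto (fun n => D n * (14 * M)) Filter.atTop (nhds 0) := by
    simpa using hD0.mul_const (14 * M)
  obtain ⟨N₀, hN₀⟩ := (hlim.eventually_le_const (by positivity : 0 < ε / 3)).exists_forall_of_atTop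
  refine ⟨N₀, fun N hN g hg0 hg φ hφ hφ1 => ?_⟩
  have hψ : Measurable fun x => φ (lsvIter g N x) := hφ.comp (measurable_lsvIter g N)
  have hψ1 : ∀ x ∈ Icc (0 : ℝ) 1, |φ (lsvIter g N x)| ≤ 1 :=
    fun x hx => hφ1 _ (lsvIter_mem hg0 N hx)
  have hone : IntegrableOn (fun _ => (1 : ℝ)) (Ioc (0 : ℝ) 1) := integrableOn_const (by simp)
  have hψi : IntegrableOn (fun x => φ (lsvIter g N x)) (Ioc 0 1) := by
    simpa using integrableOn_bdd_mul hψ hψ1 hone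
  have h1 := abs_integral_lsvIter_mul_le (by linarith) (hD N) hg0 hg
    (LSVCone.const (p := p) zero_le_one hA hα0) hM hcM (by
      simp only [mul_one]
      rw [integral_sub hPi (integrableOn_const (by simp)), ← hc]
      simp [measureReal_def]) hφ hφ1
  simp only [mul_one, one_mul, setIntegral_const, measureReal_def, Real.volume_Ioc, sub_zero,
    ENNReal.ofReal_one, ENNReal.toReal_one, smul_eq_mul, mul_sub] at h1
  have hψP := integrableOn_bdd_mul hψ hψ1 hPi
  have hψh := integrableOn_bdd_mul hψ hψ1 hh
  rw [integral_sub hψP (hψi.mul_const c), integral_mul_const] at h1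
  have h2 : |(∫ x in Ioc 0 1, φ (lsvIter g N x) * h x)
      - ∫ x in Ioc 0 1, φ (lsvIter g N x) * P.eval x| ≤ ε / 3 := by
    rw [← integral_sub hψh hψP]
    refine abs_integral_le_integral_abs.trans (le_trans ?_ hP)
    refine setIntegral_mono_on (hψh.sub hψP).abs (hh.sub hPi).abs measurableSet_Ioc fun x hx => ?_
    rw [← mul_sub, abs_mul]
    exact mul_le_of_le_one_left (abs_nonneg _) (hψ1 x (Ioc_subset_Icc_self hx))
  have h3 : |c - ∫ x in Ioc 0 1, h x| ≤ ε / 3 := by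
    rw [abs_sub_comm, hc, ← integral_sub hh hPi]
    exact abs_integral_le_integral_abs.trans hP
  have h4 : |∫ x in Ioc 0 1, φ (lsvIter g N x)| ≤ 1 := by
    refine abs_integral_le_integral_abs.trans ?_
    have h1 : ∫ x in Ioc (0 : ℝ) 1, |φ (lsvIter g N x)| ≤ ∫ x in Ioc (0 : ℝ) 1, 1 :=
      setIntegral_mono_on hψi.abs hone measurableSet_Ioc
        fun x hx => hψ1 x (Ioc_subset_Icc_self hx)
    simpa [measureReal_def] using h1
  have h5 := h1.trans (hN₀ N hN)
  set I := ∫ x in Ioc 0 1, φ (lsvIter g N x)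
  have h6 : |I * (c - ∫ x in Ioc 0 1, h x)| ≤ ε / 3 := by
    rw [abs_mul]
    exact (mul_le_of_le_one_left (abs_nonneg _) h4).trans h3
  rw [abs_le] at h2 h5 h6 ⊢
  constructor <;> linarith [h2.1, h2.2, h5.1, h5.2, h6.1, h6.2]

end RandomLSV

/-! ### Uniform estimates along a fixed sequence of parameters. -/

namespace RandomLSV

/-- A parameter for which the cone with exponent `α` is invariant. -/
def coneConst (α : ℝ) : ℝ := max (4 / (1 - α)) (4 ^ 4)

/-- The rate of loss of memory of compositions of LSV maps with parameters at most `α`. -/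
def memoryRate (α : ℝ) (n : ℕ) : ℝ := decayRate α (2 + 2) (2 * coneConst α) n

lemma coneConst_ge (α : ℝ) : 256 ≤ coneConst α := by
  refine le_trans (by norm_num) (le_max_right _ _)

lemma memoryRate_summable {α : ℝ} (hα0 : 0 < α) (hα : α < 1 / 2) : Summable (memoryRate α) := by
  have h := coneConst_ge α
  -- The exponent `2 + 2` and the doubled constant are those of the larger cone into which Lipschitz
  -- factors send the cone with `p = 2`; hence the requirement `4 ^ 4` in `coneConst`.
  refine summable_decayRate hα0 hα (by norm_num) ?_ (by norm_num; linarith)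
  have : 4 / (1 - α) ≤ coneConst α := le_max_left _ _
  linarith

lemma LSVCone.weaken_two {α : ℝ} {h : ℝ → ℝ} (hh : LSVCone α 2 (coneConst α) h) :
    LSVCone α (2 + 2) (2 * coneConst α) h where
  toDecayClass := hh.toDecayClass.weaken (by norm_num)
  tail x hx := by
    refine (hh.tail x hx).trans ?_
    have h1 := coneConst_ge α
    have h2 := hh.integral_nonneg
    have h3 : 0 ≤ x ^ (1 - α) := Real.rpow_nonneg hx.1.le _
    have h4 : 0 ≤ x ^ (1 - α) * ∫ y in Ioc 0 1, h y := by positivity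
    nlinarith

section Sequences

variable {α : ℝ} (hα0 : 0 < α) (hα : α < 1) {g : ℕ → ℝ} (hg0 : ∀ i, 0 < g i) (hg : ∀ i, g i ≤ α)
include hα0 hα hg0 hg

lemma lsvCone_transferIter_one (k : ℕ) :
    LSVCone α 2 (coneConst α) (transferIter g k fun _ => 1) :=
  (LSVCone.const zero_le_one (by linarith [coneConst_ge α] : 1 ≤ coneConst α)
    hα0.le).transferIter le_rfl hg0 hg hα
    (le_max_left _ _) k

omit hα0 hα hg in
lemma integral_transferIter_one (k : ℕ) :
    ∫ x in Ioc (0 : ℝ) 1, transferIter g k (fun _ => 1) x = 1 := by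
  rw [integral_transferIter hg0 k (integrableOn_const (by simp))]
  simp [measureReal_def]

omit hα0 hα hg in
lemma integral_lsvIter_eq (k : ℕ) {φ : ℝ → ℝ} {K : ℝ} (hφ : Measurable φ)
    (hK : ∀ x ∈ Icc (0 : ℝ) 1, |φ x| ≤ K) :
    ∫ x in Ioc (0 : ℝ) 1, φ (lsvIter g k x)
      = ∫ x in Ioc (0 : ℝ) 1, φ x * transferIter g k (fun _ => 1) x := by
  rw [integral_mul_transferIter hg0 k hφ hK (integrableOn_const (by simp))]
  simp

/-- The first `k` maps turn Lebesgue measure into a density of mass one in the cone, and the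
remaining `n` maps hardly distinguish it from the constant density. -/
lemma abs_integral_lsvIter_add_sub_le (k n : ℕ) {φ : ℝ → ℝ} {K : ℝ} (hφ : Measurable φ)
    (hK : ∀ x ∈ Icc (0 : ℝ) 1, |φ x| ≤ K) :
    |(∫ x in Ioc 0 1, φ (lsvIter g (k + n) x))
      - ∫ x in Ioc 0 1, φ (lsvIter (fun i => g (k + i)) n x)| ≤ K * memoryRate α n := by
  have hg0' : ∀ i, 0 < g (k + i) := fun i => hg0 _
  have hg' : ∀ i, g (k + i) ≤ α := fun i => hg _
  simp only [lsvIter_add]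
  have hK' : ∀ x ∈ Icc (0 : ℝ) 1, |φ (lsvIter (fun i => g (k + i)) n x)| ≤ K :=
    fun x hx => hK _ (lsvIter_mem hg0' n hx)
  rw [integral_lsvIter_eq hg0 k (φ := fun x => φ (lsvIter (fun i => g (k + i)) n x))
    (hφ.comp (measurable_lsvIter (fun i => g (k + i)) n)) hK']
  have h1 := (lsvCone_transferIter_one hα0 hα hg0 hg k).weaken_two
  have h2 := (LSVCone.const (α := α) (p := 2) zero_le_one
    (by linarith [coneConst_ge α] : 1 ≤ coneConst α) hα0.le).weaken_two
  have := abs_integral_lsvIter_sub_le (isDecayRate_decayRate _ _ _ n) hg0' hg' h1 h2 (by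
    rw [integral_transferIter_one hg0]; simp [measureReal_def]) hφ hK
  rw [integral_transferIter_one hg0] at this
  simpa [memoryRate] using this

/-- The image of Lebesgue measure after `k` steps has a density in the cone, and `F₁` centred with
respect to it decorrelates in the next `n` steps. The bound does not depend on `k`, so it survives
the limit that produces the invariant measure. -/
lemma abs_covariance_lsvIter_le (k n : ℕ) {M : ℝ} {F₁ F₂ : ℝ → ℝ} (hF₁ : LipBound M F₁)
    (hm₁ : Measurable F₁) (hm₂ : Measurable F₂) (hF₂ : ∀ x ∈ Icc (0 : ℝ) 1, |F₂ x| ≤ M) :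
    |(∫ x in Ioc 0 1, F₁ (lsvIter g k x) * F₂ (lsvIter g (k + n) x))
      - (∫ x in Ioc 0 1, F₁ (lsvIter g k x)) * ∫ x in Ioc 0 1, F₂ (lsvIter g (k + n) x)|
      ≤ 14 * M ^ 2 * memoryRate α n := by
  have hg0' : ∀ i, 0 < g (k + i) := fun i => hg0 _
  have hg' : ∀ i, g (k + i) ≤ α := fun i => hg _
  have hM : 0 ≤ M := (abs_nonneg _).trans (hF₂ 0 ⟨le_rfl, zero_le_one⟩)
  set h := transferIter g k fun _ => 1 with hh
  have hc := lsvCone_transferIter_one hα0 hα hg0 hg k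
  have h1 : ∫ x in Ioc (0 : ℝ) 1, h x = 1 := integral_transferIter_one hg0 k
  set S : ℝ → ℝ := fun x => F₂ (lsvIter (fun i => g (k + i)) n x) with hS
  have hSm : Measurable S := hm₂.comp (measurable_lsvIter _ _)
  have hSb : ∀ x ∈ Icc (0 : ℝ) 1, |S x| ≤ M := fun x hx => hF₂ _ (lsvIter_mem hg0' n hx)
  have e2 : ∫ x in Ioc 0 1, F₂ (lsvIter g (k + n) x) = ∫ x in Ioc (0 : ℝ) 1, S x * h x := by
    simp only [lsvIter_add]
    exact integral_lsvIter_eq hg0 k hSm hSb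
  have e1 : ∫ x in Ioc 0 1, F₁ (lsvIter g k x) = ∫ x in Ioc (0 : ℝ) 1, F₁ x * h x :=
    integral_lsvIter_eq hg0 k hm₁ hF₁.bound
  have e3 : ∫ x in Ioc 0 1, F₁ (lsvIter g k x) * F₂ (lsvIter g (k + n) x)
      = ∫ x in Ioc (0 : ℝ) 1, (F₁ x * S x) * h x := by
    simp only [lsvIter_add]
    refine integral_lsvIter_eq hg0 k (φ := fun x => F₁ x * S x) (K := M * M) (hm₁.mul hSm)
      fun x hx => ?_
    rw [abs_mul]
    exact mul_le_mul (hF₁.bound x hx) (hSb x hx) (abs_nonneg _) hM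
  have i1 := integrableOn_bdd_mul hm₁ hF₁.bound hc.integrable
  have i2 := integrableOn_bdd_mul hSm hSb hc.integrable
  have i3 := integrableOn_bdd_mul (φ := fun x => F₁ x * S x) (K := M * M) (hm₁.mul hSm)
      (fun x hx => by
        rw [abs_mul]
        exact mul_le_mul (hF₁.bound x hx) (hSb x hx) (abs_nonneg _) hM) hc.integrable
  rw [e1, e2, e3]
  set c := ∫ x in Ioc (0 : ℝ) 1, F₁ x * h x with hcdef
  have hcM : |c| ≤ M := by
    refine abs_integral_le_integral_abs.trans ?_
    have : ∫ x in Ioc (0 : ℝ) 1, |F₁ x * h x| ≤ ∫ x in Ioc (0 : ℝ) 1, M * h x := by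
      refine setIntegral_mono_on i1.abs (hc.integrable.const_mul M) measurableSet_Ioc
        fun x hx => ?_
      rw [abs_mul, abs_of_nonneg (hc.nonneg x hx)]
      exact mul_le_mul_of_nonneg_right (hF₁.bound x (Ioc_subset_Icc_self hx)) (hc.nonneg x hx)
    rwa [integral_const_mul, h1, mul_one] at this
  have key := abs_integral_lsvIter_mul_le (by linarith [coneConst_ge α])
    (isDecayRate_decayRate α (2 + 2) (2 * coneConst α) n) hg0' hg' hc hF₁ hcM (by
      simp only [sub_mul]
      rw [integral_sub i1 (hc.integrable.const_mul c), integral_const_mul]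
      change c - c * ∫ x in Ioc (0 : ℝ) 1, h x = 0
      rw [h1]; ring) hm₂ hF₂
  have e4 : ∫ x in Ioc (0 : ℝ) 1, F₂ (lsvIter (fun i => g (k + i)) n x)
        * ((F₁ x - c) * transferIter g k (fun _ => 1) x)
      = (∫ x in Ioc (0 : ℝ) 1, (F₁ x * S x) * h x) - c * ∫ x in Ioc (0 : ℝ) 1, S x * h x := by
    rw [← integral_const_mul, ← integral_sub i3 (i2.const_mul c)]
    refine integral_congr_ae (Filter.Eventually.of_forall fun x => ?_)
    simp only [hS]
    ring
  rw [e4] at key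
  refine key.trans (le_of_eq ?_)
  change M * (memoryRate α n * (14 * M * ∫ x in Ioc (0 : ℝ) 1, h x)) = _
  rw [h1]
  ring

end Sequences

lemma eventually_abs_integral_lsvIter_le' {α : ℝ} (hα0 : 0 < α) (hα : α < 1 / 2) {h : ℝ → ℝ}
    (hh : IntegrableOn h (Ioc 0 1)) {ε : ℝ} (hε : 0 < ε) :
    ∃ N₀, ∀ N ≥ N₀, ∀ g : ℕ → ℝ, (∀ i, 0 < g i) → (∀ i, g i ≤ α) → ∀ φ : ℝ → ℝ, Measurable φ →
      (∀ x ∈ Icc (0 : ℝ) 1, |φ x| ≤ 1) →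
      |(∫ x in Ioc 0 1, φ (lsvIter g N x) * h x)
        - (∫ x in Ioc 0 1, h x) * ∫ x in Ioc 0 1, φ (lsvIter g N x)| ≤ ε :=
  eventually_abs_integral_lsvIter_le hα0.le (by linarith [coneConst_ge α])
    (fun n => isDecayRate_decayRate α (2 + 2) (2 * coneConst α) n)
    (memoryRate_summable hα0 hα).tendsto_atTop_zero hh hε

lemma volume_lsvIter_preimage {g : ℕ → ℝ} (hg0 : ∀ i, 0 < g i) (n : ℕ) {s : Set ℝ}
    (hs : MeasurableSet s) (h0 : volume.restrict (Ioc (0 : ℝ) 1) s = 0) :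
    volume.restrict (Ioc (0 : ℝ) 1) (lsvIter g n ⁻¹' s) = 0 := by
  have h1 := integral_lsvIter_eq hg0 n (φ := s.indicator fun _ => 1) (K := 1)
    (measurable_const.indicator hs) (fun x _ => by
      by_cases hx : x ∈ s <;> simp [hx])
  have h2 : ∫ x in Ioc (0 : ℝ) 1, s.indicator (fun _ => (1 : ℝ)) x
      * transferIter g n (fun _ => 1) x = 0 := by
    refine integral_eq_zero_of_ae ?_
    filter_upwards [measure_eq_zero_iff_ae_notMem.1 h0] with x hx
    simp [hx]
  have h3 : (fun x => s.indicator (fun _ => (1 : ℝ)) (lsvIter g n x))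
      = (lsvIter g n ⁻¹' s).indicator fun _ => 1 := rfl
  rw [h2, h3, integral_indicator (measurable_lsvIter g n hs), setIntegral_const] at h1
  simp only [smul_eq_mul, mul_one, measureReal_def, ENNReal.toReal_eq_zero_iff] at h1
  exact h1.resolve_right (measure_ne_top _ _)

end RandomLSV

/-! ### The skew product, convergence of the images of Lebesgue measure, and uniqueness. -/

namespace RandomLSV

lemma tendsto_integral_lsvIter_sub {α : ℝ} (hα0 : 0 < α) (hα : α < 1 / 2) {g : ℕ → ℝ}
    (hg0 : ∀ i, 0 < g i) (hg : ∀ i, g i ≤ α) {h : ℝ → ℝ} (hh : IntegrableOn h (Ioc 0 1))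
    {φ : ℕ → ℝ → ℝ} {K : ℝ} (hφ : ∀ n, Measurable (φ n))
    (hK : ∀ n, ∀ x ∈ Icc (0 : ℝ) 1, |φ n x| ≤ K) :
    Filter.Tendsto (fun N => (∫ x in Ioc 0 1, φ N (lsvIter g N x) * h x)
      - (∫ x in Ioc 0 1, h x) * ∫ x in Ioc 0 1, φ N (lsvIter g N x)) Filter.atTop (nhds 0) := by
  have hK0 : 0 ≤ K := (abs_nonneg _).trans (hK 0 0 ⟨le_rfl, zero_le_one⟩)
  have hK1 : 0 < K + 1 := by linarith
  rw [Metric.tendsto_atTop]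
  intro ε hε
  obtain ⟨N₀, hN₀⟩ := eventually_abs_integral_lsvIter_le' hα0 hα hh
    (by positivity : 0 < ε / (2 * (K + 1)))
  refine ⟨N₀, fun N hN => ?_⟩
  -- The uniform statement takes test functions bounded by `1`; dividing by `K + 1` instead of `K`
  -- also covers `K = 0`.
  have := hN₀ N hN g hg0 hg (fun x => (K + 1)⁻¹ * φ N x) ((hφ N).const_mul _) fun x hx => by
    rw [abs_mul, abs_of_pos (inv_pos.2 hK1), inv_mul_le_iff₀ hK1]
    linarith [hK N x hx]
  simp only [mul_assoc, integral_const_mul] at this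
  rw [mul_left_comm, ← mul_sub, abs_mul, abs_of_pos (inv_pos.2 hK1), inv_mul_le_iff₀ hK1] at this
  rw [Real.dist_eq, sub_zero]
  refine this.trans_lt ?_
  have : (K + 1) * (ε / (2 * (K + 1))) = ε / 2 := by field_simp
  rw [this]
  linarith

/-- Lebesgue measure on the unit interval. -/
abbrev lebUnit : Measure ℝ := volume.restrict (Ioc 0 1)

instance : IsProbabilityMeasure lebUnit := ⟨by simp [lebUnit]⟩

lemma lebUnit_eq : volume.restrict (Icc (0 : ℝ) 1) = lebUnit :=
  Measure.restrict_congr_set Ioc_ae_eq_Icc.symm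

variable {Ω : Type*} [MeasurableSpace Ω]

/-- The iterates of the skew product. -/
def skew (σ : Ω → Ω) (a : Ω → ℝ) (n : ℕ) (p : Ω × ℝ) : Ω × ℝ := (σ^[n] p.1, cocycle σ a n p.1 p.2)

omit [MeasurableSpace Ω] in
lemma skew_add (σ : Ω → Ω) (a : Ω → ℝ) (k n : ℕ) (p : Ω × ℝ) :
    skew σ a (k + n) p = skew σ a n (skew σ a k p) := by
  simp only [skew, cocycle_eq_lsvIter, lsvIter_add, ← Function.iterate_add_apply]
  simp only [add_comm]

lemma measurable_skew {σ : Ω → Ω} (hσ : Measurable σ) {a : Ω → ℝ} (ha : Measurable a) (n : ℕ) :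
    Measurable (skew σ a n) := by
  refine ((hσ.iterate n).comp measurable_fst).prodMk ?_
  induction n with
  | zero => exact measurable_snd
  | succ n ih =>
    exact measurable_lsvMap_uncurry.comp
      ((ha.comp ((hσ.iterate n).comp measurable_fst)).prodMk ih)

omit [MeasurableSpace Ω] in
lemma cocycle_mem {σ : Ω → Ω} {a : Ω → ℝ} (ha0 : ∀ ω, 0 < a ω) (n : ℕ) (ω : Ω) {x : ℝ}
    (hx : x ∈ Icc (0 : ℝ) 1) : cocycle σ a n ω x ∈ Icc (0 : ℝ) 1 := by
  rw [cocycle_eq_lsvIter]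
  exact lsvIter_mem (fun i => ha0 _) n hx

/-- The mean of an observable over the `n`-th image of the fibre over `ω`. -/
def fiberMean (σ : Ω → Ω) (a : Ω → ℝ) (n : ℕ) (Φ : Ω × ℝ → ℝ) (ω : Ω) : ℝ :=
  ∫ x in Ioc 0 1, Φ (skew σ a n (ω, x))

lemma measurable_fiberMean {σ : Ω → Ω} (hσ : Measurable σ) {a : Ω → ℝ} (ha : Measurable a) (n : ℕ)
    {Φ : Ω × ℝ → ℝ} (hΦ : Measurable Φ) : Measurable (fiberMean σ a n Φ) :=
  (StronglyMeasurable.integral_prod_right' (ν := lebUnit)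
    (hΦ.comp (measurable_skew hσ ha n)).stronglyMeasurable).measurable

lemma abs_setIntegral_unit_le {φ : ℝ → ℝ} {K : ℝ} (hK : ∀ x ∈ Icc (0 : ℝ) 1, |φ x| ≤ K) :
    |∫ x in Ioc 0 1, φ x| ≤ K := by
  have := norm_integral_le_of_norm_le_const (μ := lebUnit) (f := φ) (C := K)
    ((ae_restrict_iff' measurableSet_Ioc).2 (Filter.Eventually.of_forall
      fun x hx => hK x (Ioc_subset_Icc_self hx)))
  simpa using this

omit [MeasurableSpace Ω] in
lemma abs_fiberMean_le {σ : Ω → Ω} {a : Ω → ℝ} (ha0 : ∀ ω, 0 < a ω) (n : ℕ)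
    {Φ : Ω × ℝ → ℝ} {K : ℝ} (hK : ∀ ω, ∀ x ∈ Icc (0 : ℝ) 1, |Φ (ω, x)| ≤ K) (ω : Ω) :
    |fiberMean σ a n Φ ω| ≤ K :=
  abs_setIntegral_unit_le fun _ hx => hK _ _ (cocycle_mem ha0 n ω hx)

omit [MeasurableSpace Ω] in
lemma fiberMean_eq (σ : Ω → Ω) (a : Ω → ℝ) (n : ℕ) (Φ : Ω × ℝ → ℝ) (ω : Ω) :
    fiberMean σ a n Φ ω = ∫ x in Ioc 0 1, Φ (σ^[n] ω, lsvIter (fun i => a (σ^[i] ω)) n x) := by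
  simp only [fiberMean, skew, cocycle_eq_lsvIter]

lemma integrable_of_abs_le {X : Type*} [MeasurableSpace X] {μ : Measure X} [IsFiniteMeasure μ]
    {f : X → ℝ} {K : ℝ} (hf : Measurable f) (hK : ∀ x, |f x| ≤ K) : Integrable f μ :=
  Integrable.of_bound hf.aestronglyMeasurable K (Filter.Eventually.of_forall hK)

lemma abs_integral_le_of_abs_le {X : Type*} [MeasurableSpace X] {μ : Measure X}
    [IsProbabilityMeasure μ] {f : X → ℝ} {K : ℝ} (hK : ∀ x, |f x| ≤ K) : |∫ x, f x ∂μ| ≤ K := by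
  have := norm_integral_le_of_norm_le_const (μ := μ) (f := f) (C := K)
    (Filter.Eventually.of_forall hK)
  simpa using this

variable {P : Measure Ω} {σ : Ω ≃ᵐ Ω}

lemma integral_comp_iterate (hσ : MeasurePreserving σ P P) (n : ℕ) {G : Ω → ℝ}
    (hG : Measurable G) : ∫ ω, G (σ^[n] ω) ∂P = ∫ ω, G ω ∂P := by
  have h := hσ.iterate n
  conv_rhs => rw [← h.map_eq]
  rw [integral_map h.measurable.aemeasurable hG.aestronglyMeasurable]

/-- The mean of an observable over the `n`-th image of `P × lebUnit` under the skew product. -/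
def pushMean (P : Measure Ω) (σ : Ω → Ω) (a : Ω → ℝ) (n : ℕ) (Φ : Ω × ℝ → ℝ) : ℝ :=
  ∫ ω, fiberMean σ a n Φ ω ∂P

variable [IsProbabilityMeasure P] {α : ℝ} {a : Ω → ℝ} {Φ : Ω × ℝ → ℝ} {K : ℝ}

/-- Fibrewise, time `k + n` over `ω` is compared with time `n` over `σ^[k] ω`. Averaging over the
`σ`-invariant `P` removes the shift of the base point. -/
lemma abs_pushMean_add_sub_le (hσ : MeasurePreserving σ P P) (ham : Measurable a)
    (ha0 : ∀ ω, 0 < a ω) (ha : ∀ ω, a ω ≤ α) (hα0 : 0 < α) (hα : α < 1 / 2)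
    (hΦ : Measurable Φ) (hK : ∀ ω, ∀ x ∈ Icc (0 : ℝ) 1, |Φ (ω, x)| ≤ K) (k n : ℕ) :
    |pushMean P σ a (k + n) Φ - pushMean P σ a n Φ| ≤ K * memoryRate α n := by
  have hm := measurable_fiberMean σ.measurable ham n hΦ
  have hm' := measurable_fiberMean σ.measurable ham (k + n) hΦ
  unfold pushMean
  rw [← integral_comp_iterate hσ k hm, ← integral_sub
    (integrable_of_abs_le hm' (abs_fiberMean_le ha0 _ hK))
    (integrable_of_abs_le (hm.comp (hσ.iterate k).measurable)
      fun ω => abs_fiberMean_le ha0 _ hK _ :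
      Integrable (fun ω => fiberMean σ a n Φ (σ^[k] ω)) P)]
  refine abs_integral_le_of_abs_le fun ω => ?_
  have h := abs_integral_lsvIter_add_sub_le hα0 (by linarith) (g := fun i => a (σ^[i] ω))
    (fun i => ha0 _) (fun i => ha _) k n (φ := fun x => Φ (σ^[k + n] ω, x)) (K := K)
    (hΦ.comp measurable_prodMk_left) (fun x hx => hK _ x hx)
  rw [fiberMean_eq, fiberMean_eq]
  have e : ∀ i, σ^[k + i] ω = σ^[i] (σ^[k] ω) := fun i => by
    rw [add_comm, Function.iterate_add_apply]
  simpa only [e] using h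

namespace IsRandomACIM

variable {ν : Kernel Ω ℝ}

omit [IsProbabilityMeasure P] in
lemma ae_absolutelyContinuous (hν : IsRandomACIM P σ a ν) : ∀ᵐ ω ∂P, ν ω ≪ lebUnit := by
  have := hν.absolutelyContinuous
  rwa [lebUnit_eq] at this

omit [IsProbabilityMeasure P] in
lemma ae_mem (hν : IsRandomACIM P σ a ν) : ∀ᵐ ω ∂P, ∀ᵐ x ∂ν ω, x ∈ Icc (0 : ℝ) 1 := by
  filter_upwards [hν.absolutelyContinuous] with ω hω
  exact hω.ae_le (ae_restrict_mem measurableSet_Icc)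

omit [IsProbabilityMeasure P] in
lemma ae_map_cocycle (hσ : MeasurePreserving σ P P) (ham : Measurable a)
    (hν : IsRandomACIM P σ a ν) (n : ℕ) :
    ∀ᵐ ω ∂P, (ν ω).map (cocycle σ a n ω) = ν (σ^[n] ω) := by
  induction n with
  | zero =>
    refine Filter.Eventually.of_forall fun ω => ?_
    exact Measure.map_id
  | succ n ih =>
    have h1 := (hσ.iterate n).quasiMeasurePreserving.ae hν.equivariant
    filter_upwards [ih, h1] with ω hω h1ω
    have hc : Measurable (cocycle σ a n ω) :=
      (measurable_snd.comp (measurable_skew σ.measurable ham n)).comp measurable_prodMk_left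
    rw [Function.iterate_succ_apply', ← h1ω, ← hω,
      Measure.map_map (measurable_lsvMap _) hc]
    rfl

omit [IsProbabilityMeasure P] in
lemma measurable_mean (hν : IsRandomACIM P σ a ν) (hΦ : Measurable Φ) :
    Measurable fun ω => ∫ x, Φ (ω, x) ∂ν ω := by
  have := hν.isMarkovKernel
  exact (StronglyMeasurable.integral_kernel_prod_right' hΦ.stronglyMeasurable).measurable

omit [IsProbabilityMeasure P] in
lemma ae_abs_mean_le (hν : IsRandomACIM P σ a ν)
    (hK : ∀ ω, ∀ x ∈ Icc (0 : ℝ) 1, |Φ (ω, x)| ≤ K) :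
    ∀ᵐ ω ∂P, |∫ x, Φ (ω, x) ∂ν ω| ≤ K := by
  have := hν.isMarkovKernel
  filter_upwards [hν.ae_mem] with ω hω
  have := norm_integral_le_of_norm_le_const (μ := ν ω) (f := fun x => Φ (ω, x)) (C := K)
    (by filter_upwards [hω] with x hx using hK ω x hx)
  simpa using this

omit [IsProbabilityMeasure P] in
lemma ae_integrable (hν : IsRandomACIM P σ a ν) (hΦ : Measurable Φ)
    (hK : ∀ ω, ∀ x ∈ Icc (0 : ℝ) 1, |Φ (ω, x)| ≤ K) :
    ∀ᵐ ω ∂P, Integrable (fun x => Φ (ω, x)) (ν ω) := by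
  have := hν.isMarkovKernel
  filter_upwards [hν.ae_mem] with ω hω
  refine Integrable.of_bound (hΦ.comp measurable_prodMk_left).aestronglyMeasurable K ?_
  filter_upwards [hω] with x hx using hK ω x hx

lemma integrable_mean (hν : IsRandomACIM P σ a ν) (hΦ : Measurable Φ)
    (hK : ∀ ω, ∀ x ∈ Icc (0 : ℝ) 1, |Φ (ω, x)| ≤ K) :
    Integrable (fun ω => ∫ x, Φ (ω, x) ∂ν ω) P :=
  Integrable.of_bound (hν.measurable_mean hΦ).aestronglyMeasurable K (hν.ae_abs_mean_le hK)

omit [IsProbabilityMeasure P] in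
lemma ae_mean_comp_skew (hσ : MeasurePreserving σ P P) (ham : Measurable a)
    (hν : IsRandomACIM P σ a ν) (hΦ : Measurable Φ) (n : ℕ) :
    ∀ᵐ ω ∂P, ∫ x, Φ (skew σ a n (ω, x)) ∂ν ω = ∫ x, Φ (σ^[n] ω, x) ∂ν (σ^[n] ω) := by
  filter_upwards [hν.ae_map_cocycle hσ ham n] with ω hω
  have hc : Measurable (cocycle σ a n ω) :=
    (measurable_snd.comp (measurable_skew σ.measurable ham n)).comp measurable_prodMk_left
  rw [← hω, integral_map hc.aemeasurable (f := fun x => Φ (σ^[n] ω, x))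
    (hΦ.comp measurable_prodMk_left).aestronglyMeasurable]
  rfl

omit [IsProbabilityMeasure P] in
lemma integral_mean_comp_skew (hσ : MeasurePreserving σ P P) (ham : Measurable a)
    (hν : IsRandomACIM P σ a ν) (hΦ : Measurable Φ) (n : ℕ) :
    ∫ ω, ∫ x, Φ (skew σ a n (ω, x)) ∂ν ω ∂P = ∫ ω, ∫ x, Φ (ω, x) ∂ν ω ∂P := by
  rw [integral_congr_ae (hν.ae_mean_comp_skew hσ ham hΦ n)]
  exact integral_comp_iterate hσ n (hν.measurable_mean hΦ)

/-- The images of Lebesgue measure converge to any random a.c.i.m. -/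
lemma tendsto_pushMean (hσ : MeasurePreserving σ P P) (ham : Measurable a)
    (ha0 : ∀ ω, 0 < a ω) (ha : ∀ ω, a ω ≤ α) (hα0 : 0 < α) (hα : α < 1 / 2)
    (hν : IsRandomACIM P σ a ν)
    (hΦ : Measurable Φ) (hK : ∀ ω, ∀ x ∈ Icc (0 : ℝ) 1, |Φ (ω, x)| ≤ K) :
    Filter.Tendsto (fun n => pushMean P σ a n Φ) Filter.atTop
      (nhds (∫ ω, ∫ x, Φ (ω, x) ∂ν ω ∂P)) := by
  have := hν.isMarkovKernel
  have hsk := measurable_skew σ.measurable ham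
  have hK' : ∀ n ω, ∀ x ∈ Icc (0 : ℝ) 1, |Φ (skew σ a n (ω, x))| ≤ K :=
    fun n ω x hx => hK _ _ (cocycle_mem ha0 n ω hx)
  have hm1 : ∀ n, Measurable fun ω => ∫ x, Φ (skew σ a n (ω, x)) ∂ν ω :=
    fun n => hν.measurable_mean (Φ := Φ ∘ skew σ a n) (hΦ.comp (hsk n))
  have hm2 : ∀ n, Measurable (fiberMean σ a n Φ) :=
    fun n => measurable_fiberMean σ.measurable ham n hΦ
  have hi1 : ∀ n, Integrable (fun ω => ∫ x, Φ (skew σ a n (ω, x)) ∂ν ω) P :=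
    fun n => hν.integrable_mean (Φ := Φ ∘ skew σ a n) (hΦ.comp (hsk n)) (hK' n)
  have hi2 : ∀ n, Integrable (fiberMean σ a n Φ) P :=
    fun n => integrable_of_abs_le (hm2 n) (abs_fiberMean_le ha0 n hK)
  -- Fibre by fibre, `ν ω` and Lebesgue measure are merged by the dynamics, because `ν ω` has an
  -- integrable density of mass one. Dominated convergence then averages over the base, without any
  -- rate yet.
  have hlim : Filter.Tendsto (fun n => ∫ ω, ((∫ x, Φ (skew σ a n (ω, x)) ∂ν ω)
      - fiberMean σ a n Φ ω) ∂P) Filter.atTop (nhds (∫ ω, (0 : ℝ) ∂P)) := by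
    refine tendsto_integral_of_dominated_convergence (fun _ => K + K)
      (fun n => ((hm1 n).sub (hm2 n)).aestronglyMeasurable) (integrable_const _) (fun n => ?_) ?_
    · filter_upwards [hν.ae_abs_mean_le (Φ := Φ ∘ skew σ a n) (hK' n)] with ω hω
      exact (abs_sub _ _).trans (add_le_add hω (abs_fiberMean_le ha0 n hK ω))
    · filter_upwards [hν.ae_absolutelyContinuous] with ω hω
      have h1 := tendsto_integral_lsvIter_sub hα0 hα (g := fun i => a (σ^[i] ω))
        (fun i => ha0 _) (fun i => ha _)
        (h := fun x => ((ν ω).rnDeriv lebUnit x).toReal) Measure.integrable_toReal_rnDeriv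
        (φ := fun n x => Φ (σ^[n] ω, x)) (K := K) (fun n => hΦ.comp measurable_prodMk_left)
        (fun n x hx => hK _ x hx)
      have h2 : ∫ x in Ioc 0 1, ((ν ω).rnDeriv lebUnit x).toReal = 1 := by
        have := integral_rnDeriv_smul hω (f := fun _ => (1 : ℝ))
        simpa using this
      rw [h2] at h1
      refine h1.congr fun n => ?_
      rw [one_mul, fiberMean_eq, ← integral_rnDeriv_smul hω]
      simp only [smul_eq_mul, skew, cocycle_eq_lsvIter, mul_comm]
  rw [integral_zero] at hlim
  have hlim' := (tendsto_const_nhds (x := ∫ ω, ∫ x, Φ (ω, x) ∂ν ω ∂P)).sub hlim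
  rw [sub_zero] at hlim'
  refine hlim'.congr fun n => ?_
  rw [integral_sub (hi1 n) (hi2 n), hν.integral_mean_comp_skew hσ ham hΦ n, pushMean]
  ring

/-- The images of Lebesgue measure converge to any random a.c.i.m. at the rate `memoryRate`. -/
lemma abs_pushMean_sub_le (hσ : MeasurePreserving σ P P) (ham : Measurable a)
    (ha0 : ∀ ω, 0 < a ω) (ha : ∀ ω, a ω ≤ α) (hα0 : 0 < α) (hα : α < 1 / 2)
    (hν : IsRandomACIM P σ a ν)
    (hΦ : Measurable Φ) (hK : ∀ ω, ∀ x ∈ Icc (0 : ℝ) 1, |Φ (ω, x)| ≤ K) (n : ℕ) :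
    |pushMean P σ a n Φ - ∫ ω, ∫ x, Φ (ω, x) ∂ν ω ∂P| ≤ K * memoryRate α n := by
  have h := hν.tendsto_pushMean hσ ham ha0 ha hα0 hα hΦ hK
  have h1 : Filter.Tendsto (fun k => pushMean P σ a (k + n) Φ) Filter.atTop
      (nhds (∫ ω, ∫ x, Φ (ω, x) ∂ν ω ∂P)) := h.comp (Filter.tendsto_add_atTop_nat n)
  have h2 := (h1.sub_const (pushMean P σ a n Φ)).abs
  rw [abs_sub_comm]
  exact le_of_tendsto h2 (Filter.Eventually.of_forall fun k =>
    abs_pushMean_add_sub_le hσ ham ha0 ha hα0 hα hΦ hK k n)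

/-- Both measures on `Ω × ℝ` are the limit of the same images of `P × Lebesgue`, tested on
indicators; a kernel is determined almost everywhere by its product with `P`. -/
theorem unique (hσ : MeasurePreserving σ P P) (ham : Measurable a)
    (ha0 : ∀ ω, 0 < a ω) (ha : ∀ ω, a ω ≤ α) (hα0 : 0 < α) (hα : α < 1 / 2)
    {ν' : Kernel Ω ℝ} (hν : IsRandomACIM P σ a ν) (hν' : IsRandomACIM P σ a ν') :
    ∀ᵐ ω ∂P, ν' ω = ν ω := by
  have := hν.isMarkovKernel
  have := hν'.isMarkovKernel
  refine Kernel.ae_eq_of_compProd_eq ?_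
  ext s hs
  have key : ∀ {η : Kernel Ω ℝ} (hη : IsRandomACIM P σ a η),
      ((P ⊗ₘ η) s).toReal = ∫ ω, ∫ x, s.indicator (fun _ => (1 : ℝ)) (ω, x) ∂η ω ∂P := by
    intro η hη
    have := hη.isMarkovKernel
    rw [← Measure.integral_compProd, integral_indicator hs]
    · simp [measureReal_def]
    · exact (integrable_const _).indicator hs
  have hK : ∀ ω, ∀ x ∈ Icc (0 : ℝ) 1, |s.indicator (fun _ => (1 : ℝ)) (ω, x)| ≤ 1 := by
    intro ω x _
    by_cases h : (ω, x) ∈ s <;> simp [h]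
  have hm : Measurable (s.indicator fun _ => (1 : ℝ)) := measurable_const.indicator hs
  rw [← ENNReal.toReal_eq_toReal_iff' (measure_ne_top _ _) (measure_ne_top _ _), key hν, key hν']
  exact tendsto_nhds_unique (hν'.tendsto_pushMean hσ ham ha0 ha hα0 hα hm hK)
    (hν.tendsto_pushMean hσ ham ha0 ha hα0 hα hm hK)

end IsRandomACIM

end RandomLSV

/-! ### Existence of the random a.c.i.m. -/

namespace RandomLSV

/-- A sequence of absolutely continuous probability measures which is Cauchy in total variation
converges to an absolutely continuous probability measure. -/
lemma exists_limit_measure {X : Type*} [MeasurableSpace X] (ρ : Measure X) [IsFiniteMeasure ρ]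
    (Q : ℕ → Measure X) [∀ n, IsProbabilityMeasure (Q n)] (hac : ∀ n, Q n ≪ ρ) {r : ℕ → ℝ}
    (hr : Summable r)
    (h : ∀ k n (Φ : X → ℝ), Measurable Φ → (∀ x, |Φ x| ≤ 1) →
      |(∫ x, Φ x ∂Q (k + n)) - ∫ x, Φ x ∂Q n| ≤ r n) :
    ∃ Q' : Measure X, IsProbabilityMeasure Q' ∧ Q' ≪ ρ ∧
      ∀ Φ : X → ℝ, Measurable Φ → (∀ x, |Φ x| ≤ 1) →
        Filter.Tendsto (fun n => ∫ x, Φ x ∂Q n) Filter.atTop (nhds (∫ x, Φ x ∂Q')) := by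
  set q : ℕ → X → ℝ := fun n x => ((Q n).rnDeriv ρ x).toReal with hq
  have hqm : ∀ n, Measurable (q n) := fun n => (Measure.measurable_rnDeriv _ _).ennreal_toReal
  have hqi : ∀ n, Integrable (q n) ρ := fun n => Measure.integrable_toReal_rnDeriv
  have hq0 : ∀ n x, 0 ≤ q n x := fun n x => ENNReal.toReal_nonneg
  have hint : ∀ n (Φ : X → ℝ), ∫ x, Φ x ∂Q n = ∫ x, q n x * Φ x ∂ρ := fun n Φ =>
    (integral_rnDeriv_smul (hac n)).symm
  have hr0 : ∀ n, 0 ≤ r n := fun n =>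
    (abs_nonneg _).trans (h 0 n (fun _ => 0) measurable_const (by simp))
  have hdist : ∀ k n, ∫ x, ‖q (k + n) x - q n x‖ ∂ρ ≤ r n := by
    intro k n
    -- Testing against the sign of the difference of the densities turns the hypothesis into an `L¹`
    -- bound.
    set s : X → ℝ := fun x => if q n x ≤ q (k + n) x then 1 else -1
    have hsm : Measurable s :=
      Measurable.ite (measurableSet_le (hqm n) (hqm (k + n))) measurable_const measurable_const
    have hs1 : ∀ x, |s x| ≤ 1 := fun x => by
      by_cases hx : q n x ≤ q (k + n) x <;> simp [s, hx]
    have h1 := h k n s hsm hs1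
    rw [hint, hint] at h1
    have hi : ∀ n, Integrable (fun x => q n x * s x) ρ := fun n =>
      (hqi n).mul_bdd (c := 1) hsm.aestronglyMeasurable (Filter.Eventually.of_forall hs1)
    rw [← integral_sub (hi _) (hi _)] at h1
    refine le_trans (le_of_eq ?_) ((le_abs_self _).trans h1)
    refine integral_congr_ae (Filter.Eventually.of_forall fun x => ?_)
    simp only [Real.norm_eq_abs]
    by_cases hx : q n x ≤ q (k + n) x
    · simp [s, hx]
    · simp only [s, if_neg hx]
      rw [abs_of_neg (by linarith)]
      ring
  have hnorm : ∀ k n, eLpNorm (q (k + n) - q n) 1 ρ ≤ ENNReal.ofReal (r n) := by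
    intro k n
    rw [eLpNorm_one_eq_lintegral_enorm,
      ← ofReal_integral_norm_eq_lintegral_enorm ((hqi _).sub (hqi _))]
    exact ENNReal.ofReal_le_ofReal (hdist k n)
  -- The geometric term only serves to make the Cauchy bounds strict.
  have hB : ∑' n, ENNReal.ofReal (2 * r n + (1 / 2) ^ n) ≠ ∞ := by
    refine Summable.tsum_ofReal_ne_top ?_
    exact (hr.mul_left 2).add (summable_geometric_of_lt_one (by norm_num) (by norm_num))
  obtain ⟨w, hw, hlim⟩ := Lp.cauchy_complete_eLpNorm le_rfl
    (fun n => memLp_one_iff_integrable.2 (hqi n)) hB (fun N n m hn hm => by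
      have h1 : q n - q m = (q n - q N) - (q m - q N) := by ring
      rw [h1]
      refine (eLpNorm_sub_le ((hqm _).sub (hqm _)).aestronglyMeasurable
        ((hqm _).sub (hqm _)).aestronglyMeasurable le_rfl).trans_lt ?_
      obtain ⟨i, rfl⟩ := Nat.exists_eq_add_of_le' hn
      obtain ⟨j, rfl⟩ := Nat.exists_eq_add_of_le' hm
      refine (add_le_add (hnorm i N) (hnorm j N)).trans_lt ?_
      rw [← ENNReal.ofReal_add (hr0 N) (hr0 N)]
      have : (0 : ℝ) < (1 / 2) ^ N := by positivity
      rw [ENNReal.ofReal_lt_ofReal_iff (by linarith [hr0 N])]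
      linarith)
  have hwi : Integrable w ρ := memLp_one_iff_integrable.1 hw
  -- Taking `‖w‖` as density makes it nonnegative everywhere; it is still the limit, as the `q n`
  -- are nonnegative.
  have hconv : ∀ Φ : X → ℝ, Measurable Φ → (∀ x, |Φ x| ≤ 1) →
      Filter.Tendsto (fun n => ∫ x, Φ x ∂Q n) Filter.atTop (nhds (∫ x, ‖w x‖ * Φ x ∂ρ)) := by
    intro Φ hΦ hΦ1
    have hi : Integrable (fun x => ‖w x‖ * Φ x) ρ :=
      hwi.norm.mul_bdd (c := 1) hΦ.aestronglyMeasurable (Filter.Eventually.of_forall hΦ1)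
    have hi' : ∀ n, Integrable (fun x => q n x * Φ x) ρ := fun n =>
      (hqi n).mul_bdd (c := 1) hΦ.aestronglyMeasurable (Filter.Eventually.of_forall hΦ1)
    simp only [hint]
    have h2 : Filter.Tendsto (fun n => ∫ x, ‖q n x - w x‖ ∂ρ) Filter.atTop (nhds 0) := by
      have h3 := (ENNReal.tendsto_toReal ENNReal.zero_ne_top).comp hlim
      refine h3.congr fun n => ?_
      rw [Function.comp_apply, eLpNorm_one_eq_lintegral_enorm,
        ← ofReal_integral_norm_eq_lintegral_enorm ((hqi _).sub hwi),
        ENNReal.toReal_ofReal (integral_nonneg fun _ => norm_nonneg _)]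
      rfl
    rw [tendsto_iff_norm_sub_tendsto_zero]
    refine squeeze_zero (fun _ => norm_nonneg _) (fun n => ?_) h2
    rw [← integral_sub (hi' n) hi]
    refine (norm_integral_le_integral_norm _).trans ?_
    refine integral_mono ((hi' n).sub hi).norm ((hqi n).sub hwi).norm fun x => ?_
    simp only [← sub_mul, norm_mul]
    refine (mul_le_of_le_one_right (norm_nonneg _) (hΦ1 x)).trans ?_
    have := abs_norm_sub_norm_le (q n x) (w x)
    rwa [Real.norm_of_nonneg (hq0 n x)] at this
  have hwm : AEMeasurable (fun x => ENNReal.ofReal ‖w x‖) ρ :=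
    hwi.norm.aemeasurable.ennreal_ofReal
  have hQ' : ∀ Φ : X → ℝ, ∫ x, Φ x ∂ρ.withDensity (fun x => ENNReal.ofReal ‖w x‖)
      = ∫ x, ‖w x‖ * Φ x ∂ρ := fun Φ => by
    rw [integral_withDensity_eq_integral_toReal_smul₀ hwm
      (Filter.Eventually.of_forall fun x => ENNReal.ofReal_lt_top)]
    simp only [ENNReal.toReal_ofReal (norm_nonneg _), smul_eq_mul]
  refine ⟨ρ.withDensity fun x => ENNReal.ofReal ‖w x‖, ⟨?_⟩, withDensity_absolutelyContinuous _ _,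
    fun Φ hΦ hΦ1 => by rw [hQ']; exact hconv Φ hΦ hΦ1⟩
  have h1 := hconv (fun _ => 1) measurable_const (by simp)
  simp only [integral_const, probReal_univ, smul_eq_mul, mul_one] at h1
  have h2 := tendsto_nhds_unique h1 tendsto_const_nhds
  rw [withDensity_apply _ MeasurableSet.univ, Measure.restrict_univ,
    ← ofReal_integral_eq_lintegral_ofReal hwi.norm
      (Filter.Eventually.of_forall fun _ => norm_nonneg _), h2, ENNReal.ofReal_one]

variable {Ω : Type*} [MeasurableSpace Ω] {P : Measure Ω} [IsProbabilityMeasure P] {σ : Ω ≃ᵐ Ω}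
  {α : ℝ} {a : Ω → ℝ}

omit [IsProbabilityMeasure P] in
lemma map_skew_absolutelyContinuous (hσ : MeasurePreserving σ P P) (ham : Measurable a)
    (ha0 : ∀ ω, 0 < a ω) (n : ℕ) :
    (P.prod lebUnit).map (skew σ a n) ≪ P.prod lebUnit := by
  have hsk := measurable_skew σ.measurable ham n
  refine Measure.AbsolutelyContinuous.mk fun s hs h0 => ?_
  rw [Measure.map_apply hsk hs, Measure.measure_prod_null (hsk hs)]
  rw [Measure.measure_prod_null hs] at h0
  filter_upwards [(hσ.iterate n).quasiMeasurePreserving.ae h0] with ω hω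
  have h1 := volume_lsvIter_preimage (g := fun i => a (σ^[i] ω)) (fun i => ha0 _) n
    (measurable_prodMk_left hs) hω
  refine (congrArg _ ?_).trans h1
  ext x
  simp only [mem_preimage, skew, cocycle_eq_lsvIter]

lemma integral_map_skew (ham : Measurable a) (n : ℕ) {Φ : Ω × ℝ → ℝ} (hΦ : Measurable Φ)
    (hΦ1 : ∀ p, |Φ p| ≤ 1) :
    ∫ p, Φ p ∂(P.prod lebUnit).map (skew σ a n) = pushMean P σ a n Φ := by
  have hsk := measurable_skew σ.measurable ham n
  rw [integral_map hsk.aemeasurable hΦ.aestronglyMeasurable, integral_prod]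
  · rfl
  · exact integrable_of_abs_le (hΦ.comp hsk) fun p => hΦ1 _

/-- An invariant measure of the skew product which is absolutely continuous. -/
lemma exists_invariant_measure (hσ : MeasurePreserving σ P P) (ham : Measurable a)
    (ha0 : ∀ ω, 0 < a ω) (ha : ∀ ω, a ω ≤ α) (hα0 : 0 < α) (hα : α < 1 / 2) :
    ∃ Q : Measure (Ω × ℝ), IsProbabilityMeasure Q ∧ Q ≪ P.prod lebUnit ∧ Q.fst = P ∧
      Q.map (skew σ a 1) = Q := by
  have hsk := measurable_skew σ.measurable ham
  have hprob : ∀ n, IsProbabilityMeasure ((P.prod lebUnit).map (skew σ a n)) := fun n =>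
    Measure.isProbabilityMeasure_map (hsk n).aemeasurable
  obtain ⟨Q, hQ, hQR, hlim⟩ := exists_limit_measure (P.prod lebUnit)
    (fun n => (P.prod lebUnit).map (skew σ a n))
    (map_skew_absolutelyContinuous hσ ham ha0) (memoryRate_summable hα0 hα)
    (fun k n Φ hΦ hΦ1 => by
      rw [integral_map_skew ham _ hΦ hΦ1, integral_map_skew ham _ hΦ hΦ1]
      have := abs_pushMean_add_sub_le hσ ham ha0 ha hα0 hα hΦ (K := 1) (fun ω x _ => hΦ1 _) k n
      rwa [one_mul] at this)
  have hind : ∀ s : Set (Ω × ℝ), ∀ p, |s.indicator (fun _ => (1 : ℝ)) p| ≤ 1 := fun s p => by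
    by_cases hp : p ∈ s <;> simp [hp]
  have hlim' : ∀ Φ : Ω × ℝ → ℝ, Measurable Φ → (∀ p, |Φ p| ≤ 1) →
      Filter.Tendsto (fun n => pushMean P σ a n Φ) Filter.atTop (nhds (∫ p, Φ p ∂Q)) := by
    intro Φ hΦ hΦ1
    refine (hlim Φ hΦ hΦ1).congr fun n => integral_map_skew ham n hΦ hΦ1
  have hset : ∀ s : Set (Ω × ℝ), MeasurableSet s →
      Filter.Tendsto (fun n => pushMean P σ a n (s.indicator fun _ => 1)) Filter.atTop
        (nhds (Q s).toReal) := by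
    intro s hs
    have := hlim' _ (measurable_const.indicator hs) (hind s)
    rwa [integral_indicator hs, setIntegral_const, smul_eq_mul, mul_one] at this
  -- Every image has first marginal `P`, so the limit has too; invariance follows by shifting the
  -- index of the sequence by one.
  refine ⟨Q, hQ, hQR, ?_, ?_⟩
  · ext A hA
    rw [Measure.fst_apply hA, ← ENNReal.toReal_eq_toReal_iff' (measure_ne_top _ _)
      (measure_ne_top _ _)]
    refine tendsto_nhds_unique (hset _ (measurable_fst hA)) (tendsto_const_nhds.congr fun n => ?_)
    have h1 : ∀ ω, fiberMean σ a n ((Prod.fst ⁻¹' A).indicator fun _ => 1) ω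
        = A.indicator (fun _ => (1 : ℝ)) (σ^[n] ω) := by
      intro ω
      by_cases hω : σ^[n] ω ∈ A <;> simp [fiberMean, skew, indicator, hω]
    simp only [pushMean, h1]
    rw [integral_comp_iterate hσ n (measurable_const.indicator hA), integral_indicator hA,
      setIntegral_const, smul_eq_mul, mul_one]
    rfl
  · ext s hs
    rw [Measure.map_apply (hsk 1) hs, ← ENNReal.toReal_eq_toReal_iff' (measure_ne_top _ _)
      (measure_ne_top _ _)]
    refine tendsto_nhds_unique (hset _ (hsk 1 hs))
      (((hset s hs).comp (Filter.tendsto_add_atTop_nat 1)).congr fun n => ?_)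
    simp only [pushMean, fiberMean, Function.comp_apply, skew_add]
    rfl

/-- Existence of the random a.c.i.m. -/
theorem exists_isRandomACIM (hσ : MeasurePreserving σ P P) (ham : Measurable a)
    (ha0 : ∀ ω, 0 < a ω) (ha : ∀ ω, a ω ≤ α) (hα0 : 0 < α) (hα : α < 1 / 2) :
    ∃ ν : Kernel Ω ℝ, IsRandomACIM P σ a ν := by
  obtain ⟨Q, hQ, hQR, hfst, hinv⟩ := exists_invariant_measure hσ ham ha0 ha hα0 hα
  have hsk := measurable_skew σ.measurable ham 1
  have hT : Measurable fun p : Ω × ℝ => lsvMap (a p.1) p.2 :=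
    measurable_lsvMap_uncurry.comp ((ham.comp measurable_fst).prodMk measurable_snd)
  have hdis : P ⊗ₘ Q.condKernel = Q := by
    conv_rhs => rw [← Q.disintegrate Q.condKernel, hfst]
  refine ⟨Q.condKernel, inferInstance, ?_, ?_⟩
  · rw [← hdis, ← Measure.compProd_const] at hQR
    rw [lebUnit_eq]
    simpa using hQR.kernel_of_compProd
  -- The fibre measures pushed forward and those over `σ ω` are compared as kernels over `P`. Moving
  -- the base coordinate back by `σ.symm` turns the second into `Q`, and the invariance of `Q`
  -- identifies it with the first.
  · set κ₁ : Kernel Ω ℝ := (Kernel.id ×ₖ Q.condKernel).map fun p => lsvMap (a p.1) p.2 with hκ₁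
    set κ₂ : Kernel Ω ℝ := Q.condKernel.comap σ σ.measurable with hκ₂
    have e₁ : ∀ ω, κ₁ ω = (Q.condKernel ω).map (lsvMap (a ω)) := by
      intro ω
      rw [hκ₁, Kernel.map_apply _ hT, Kernel.prod_apply, Kernel.id_apply, Measure.dirac_prod,
        Measure.map_map hT measurable_prodMk_left]
      rfl
    have : IsMarkovKernel κ₁ := Kernel.IsMarkovKernel.map _ hT
    have heq : P ⊗ₘ κ₁ = P ⊗ₘ κ₂ := by
      ext s hs
      have hs' : MeasurableSet {p : Ω × ℝ | (σ.symm p.1, p.2) ∈ s} :=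
        ((σ.symm.measurable.comp measurable_fst).prodMk measurable_snd) hs
      have h2 : (P ⊗ₘ κ₂) s = Q {p | (σ.symm p.1, p.2) ∈ s} := by
        rw [Measure.compProd_apply hs]
        conv_rhs => rw [← hdis, Measure.compProd_apply hs', ← hσ.map_eq,
          lintegral_map_equiv]
        simp only [hκ₂, Kernel.comap_apply]
        refine lintegral_congr fun ω => ?_
        congr 1
        ext x
        simp
      rw [h2]
      conv_rhs => rw [← hinv, Measure.map_apply hsk hs', ← hdis,
        Measure.compProd_apply (hsk hs')]
      rw [Measure.compProd_apply hs]
      refine lintegral_congr fun ω => ?_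
      rw [e₁, Measure.map_apply (measurable_lsvMap _) (measurable_prodMk_left hs)]
      congr 1
      ext x
      simp [skew, cocycle]
    filter_upwards [Kernel.ae_eq_of_compProd_eq heq] with ω hω
    rw [← e₁, hω, hκ₂, Kernel.comap_apply]

end RandomLSV

/-! ### Averaged covariances and continuity in the parameter. -/

namespace RandomLSV

lemma continuousAt_lsvMap {γ x : ℝ} (hγ : 0 < γ) (hx : x ≠ 1 / 2) :
    ContinuousAt (fun p : ℝ × ℝ => lsvMap p.1 p.2) (γ, x) := by
  rcases lt_or_gt_of_ne hx with h | h
  · have h1 : (fun p : ℝ × ℝ => p.2 * (1 + 2 ^ p.1 * p.2 ^ p.1)) =ᶠ[nhds (γ, x)]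
        fun p : ℝ × ℝ => lsvMap p.1 p.2 := by
      filter_upwards [continuous_snd.continuousAt.eventually_lt_const h] with p hp
      simp only [lsvMap, if_pos hp]
    refine ContinuousAt.congr ?_ h1
    refine continuousAt_snd.mul (continuousAt_const.add (ContinuousAt.mul ?_ ?_))
    · exact continuousAt_const.rpow continuousAt_fst (Or.inr hγ)
    · exact continuousAt_snd.rpow continuousAt_fst (Or.inr hγ)
  · have h1 : (fun p : ℝ × ℝ => 2 * p.2 - 1) =ᶠ[nhds (γ, x)]
        fun p : ℝ × ℝ => lsvMap p.1 p.2 := by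
      filter_upwards [continuous_snd.continuousAt.eventually_const_lt h] with p hp
      simp only [lsvMap, if_neg (not_lt.2 (le_of_lt hp))]
    refine ContinuousAt.congr ?_ h1
    fun_prop

/-- Only the unperturbed orbit has to avoid `1/2`: continuity of the map is used at the points of
that orbit alone. -/
lemma continuousAt_lsvIter {G : ℝ → ℕ → ℝ} (hG : ∀ i, ContinuousAt (fun ε => G ε i) 0)
    (hG0 : ∀ i, 0 < G 0 i) {x : ℝ} (hx : ∀ j, lsvIter (G 0) j x ≠ 1 / 2) (n : ℕ) :
    ContinuousAt (fun ε => lsvIter (G ε) n x) 0 := by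
  induction n with
  | zero => exact continuousAt_const
  | succ n ih =>
    exact (continuousAt_lsvMap (hG0 n) (hx n)).comp (f := fun ε => (G ε n, lsvIter (G ε) n x))
      ((hG n).prodMk ih)

lemma ae_lsvIter_ne_half {g : ℕ → ℝ} (hg0 : ∀ i, 0 < g i) :
    ∀ᵐ x ∂lebUnit, ∀ j, lsvIter g j x ≠ 1 / 2 := by
  rw [ae_all_iff]
  intro j
  exact measure_eq_zero_iff_ae_notMem.1
    (volume_lsvIter_preimage hg0 j (measurableSet_singleton (1 / 2)) (by simp))

variable {Ω : Type*} [MeasurableSpace Ω]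

/-- The fibrewise covariance of an observable with its `n`-th image, averaged over the base, with
respect to the `k`-th image of Lebesgue measure. -/
def covApprox (P : Measure Ω) (σ : Ω → Ω) (a : Ω → ℝ) (Φ : Ω × ℝ → ℝ) (k n : ℕ) : ℝ :=
  ∫ ω, (fiberMean σ a k (fun p => Φ p * Φ (skew σ a n p)) ω
    - fiberMean σ a k Φ ω * fiberMean σ a (k + n) Φ ω) ∂P

variable {P : Measure Ω} [IsProbabilityMeasure P] {σ : Ω ≃ᵐ Ω} {α M : ℝ} {a : Ω → ℝ}
  {Φ : Ω × ℝ → ℝ}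

lemma abs_covApprox_le (ha0 : ∀ ω, 0 < a ω) (ha : ∀ ω, a ω ≤ α) (hα0 : 0 < α) (hα : α < 1 / 2)
    (hΦ : Measurable Φ) (hM : ∀ ω, LipBound M fun x => Φ (ω, x)) (k n : ℕ) :
    |covApprox P σ a Φ k n| ≤ 14 * M ^ 2 * memoryRate α n := by
  refine abs_integral_le_of_abs_le fun ω => ?_
  have := abs_covariance_lsvIter_le hα0 (by linarith) (g := fun i => a (σ^[i] ω)) (fun i => ha0 _)
    (fun i => ha _) k n (hM (σ^[k] ω)) (F₂ := fun x => Φ (σ^[k + n] ω, x))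
    (hΦ.comp measurable_prodMk_left) (hΦ.comp measurable_prodMk_left) (hM _).bound
  simp only [fiberMean, ← skew_add]
  simpa only [skew, cocycle_eq_lsvIter] using this

omit [MeasurableSpace Ω] in
lemma abs_mul_comp_skew_le {σ : Ω → Ω} (ha0 : ∀ ω, 0 < a ω)
    (hM : ∀ ω, LipBound M fun x => Φ (ω, x)) (n : ℕ) (ω : Ω) :
    ∀ x ∈ Icc (0 : ℝ) 1, |Φ (ω, x) * Φ (skew σ a n (ω, x))| ≤ M * M := by
  intro x hx
  rw [abs_mul]
  have h1 := (hM ω).bound x hx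
  exact mul_le_mul h1 ((hM _).bound _ (cocycle_mem ha0 n ω hx)) (abs_nonneg _)
    ((abs_nonneg _).trans h1)

/-- The mean of the observable with respect to `ν ω`. -/
def kernelMean (ν : Kernel Ω ℝ) (Φ : Ω × ℝ → ℝ) (ω : Ω) : ℝ := ∫ x, Φ (ω, x) ∂ν ω

namespace IsRandomACIM

variable {ν : Kernel Ω ℝ}

/-- Expanding the product of centred observables, equivariance makes both cross terms equal to the
product of the means at `ω` and `σ^[n] ω`, so one copy with a minus sign survives. -/
lemma correlation_eq (hσ : MeasurePreserving σ P P) (ham : Measurable a) (ha0 : ∀ ω, 0 < a ω)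
    (hν : IsRandomACIM P σ a ν) (hΦ : Measurable Φ) (hM : ∀ ω, LipBound M fun x => Φ (ω, x))
    (n : ℕ) :
    correlation P σ a ν (fun ω x => Φ (ω, x)) n
      = (∫ ω, ∫ x, Φ (ω, x) * Φ (skew σ a n (ω, x)) ∂ν ω ∂P)
        - ∫ ω, kernelMean ν Φ ω * kernelMean ν Φ (σ^[n] ω) ∂P := by
  have := hν.isMarkovKernel
  have hsk := measurable_skew σ.measurable ham n
  have hb := abs_mul_comp_skew_le (σ := σ) ha0 hM n
  have hm : Measurable fun p => Φ p * Φ (skew σ a n p) := hΦ.mul (hΦ.comp hsk)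
  have hb1 : ∀ ω, ∀ x ∈ Icc (0 : ℝ) 1, |Φ (ω, x)| ≤ M := fun ω => (hM ω).bound
  have hb2 : ∀ ω, ∀ x ∈ Icc (0 : ℝ) 1, |(Φ ∘ skew σ a n) (ω, x)| ≤ M :=
    fun ω x hx => (hM _).bound _ (cocycle_mem ha0 n ω hx)
  have hc : ∀ᵐ ω ∂P, |kernelMean ν Φ ω| ≤ M := hν.ae_abs_mean_le hb1
  have hcm : Measurable (kernelMean ν Φ) := hν.measurable_mean hΦ
  have hcc : Integrable (fun ω => kernelMean ν Φ ω * kernelMean ν Φ (σ^[n] ω)) P := by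
    refine Integrable.of_bound (hcm.mul (hcm.comp (hσ.iterate n).measurable)).aestronglyMeasurable
      (M * M) ?_
    filter_upwards [hc, (hσ.iterate n).quasiMeasurePreserving.ae hc] with ω h1 h2
    rw [norm_mul]
    exact mul_le_mul h1 h2 (abs_nonneg _) ((abs_nonneg _).trans h1)
  rw [← integral_sub (hν.integrable_mean hm hb) hcc, correlation]
  refine integral_congr_ae ?_
  filter_upwards [hν.ae_mean_comp_skew hσ ham hΦ n, hν.ae_integrable hΦ hb1,
    hν.ae_integrable (hΦ.comp hsk) hb2, hν.ae_integrable hm hb] with ω h1 i1 i2 i3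
  have e : ∀ x, corrIntegrand σ a ν (fun ω x => Φ (ω, x)) n ω x
      = Φ (ω, x) * Φ (skew σ a n (ω, x)) - kernelMean ν Φ (σ^[n] ω) * Φ (ω, x)
        - kernelMean ν Φ ω * (Φ ∘ skew σ a n) (ω, x)
        + kernelMean ν Φ ω * kernelMean ν Φ (σ^[n] ω) := by
    intro x
    simp only [corrIntegrand, centred, kernelMean, skew, Function.comp_apply]
    ring
  simp only [e]
  have j1 : Integrable (fun x => Φ (ω, x) * Φ (skew σ a n (ω, x))
      - kernelMean ν Φ (σ^[n] ω) * Φ (ω, x)) (ν ω) := i3.sub (i1.const_mul _)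
  have j2 : Integrable (fun x => kernelMean ν Φ ω * (Φ ∘ skew σ a n) (ω, x)) (ν ω) :=
    i2.const_mul _
  have j3 : Integrable (fun x => Φ (ω, x) * Φ (skew σ a n (ω, x))
      - kernelMean ν Φ (σ^[n] ω) * Φ (ω, x)
      - kernelMean ν Φ ω * (Φ ∘ skew σ a n) (ω, x)) (ν ω) := j1.sub j2
  rw [integral_add j3 (integrable_const _), integral_sub j1 j2, integral_sub i3 (i1.const_mul _),
    integral_const_mul, integral_const_mul]
  simp only [Function.comp_apply, h1, integral_const, probReal_univ, one_smul]
  change _ - kernelMean ν Φ (σ^[n] ω) * kernelMean ν Φ ω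
    - kernelMean ν Φ ω * kernelMean ν Φ (σ^[n] ω) + _ = _
  ring

/-- Integrals over the base of the difference between approximate and exact fibre means. -/
lemma abs_integral_mul_fiberMean_sub_le (hσ : MeasurePreserving σ P P) (ham : Measurable a)
    (ha0 : ∀ ω, 0 < a ω) (ha : ∀ ω, a ω ≤ α) (hα0 : 0 < α) (hα : α < 1 / 2)
    (hν : IsRandomACIM P σ a ν) (hΦ : Measurable Φ)
    (hM : ∀ ω, ∀ x ∈ Icc (0 : ℝ) 1, |Φ (ω, x)| ≤ M)
    {ψ : Ω → ℝ} (hψ : Measurable ψ) (hψM : ∀ᵐ ω ∂P, |ψ ω| ≤ M) (n : ℕ) :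
    |(∫ ω, ψ ω * fiberMean σ a n Φ ω ∂P) - ∫ ω, ψ ω * kernelMean ν Φ (σ^[n] ω) ∂P|
      ≤ M * M * memoryRate α n := by
  obtain ⟨ω₀⟩ : Nonempty Ω := nonempty_of_isProbabilityMeasure P
  have hM0 : 0 ≤ M := (abs_nonneg _).trans (hM ω₀ 0 ⟨le_rfl, zero_le_one⟩)
  -- Truncation makes the almost sure bound on `ψ` hold everywhere.
  set χ : Ω → ℝ := fun ω => max (-M) (min M (ψ ω)) with hχ
  have hχm : Measurable χ := measurable_const.max (measurable_const.min hψ)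
  have hχM : ∀ ω, |χ ω| ≤ M := fun ω => abs_le.2 ⟨le_max_left _ _,
    max_le (by linarith) (min_le_left _ _)⟩
  have hχψ : ∀ᵐ ω ∂P, ψ ω = χ ω := by
    filter_upwards [hψM] with ω hω
    rw [abs_le] at hω
    simp only [hχ, min_eq_right hω.2, max_eq_right hω.1]
  have hinv : ∀ ω, (σ.symm)^[n] (σ^[n] ω) = ω := fun ω =>
    (Function.LeftInverse.iterate σ.left_inv n) ω
  -- Convergence to `ν` is known with a rate only after averaging over the base. A weight `ψ` at
  -- time `0` is carried to time `n` by `σ⁻ⁿ`, becoming part of the observable, with a bound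
  -- independent of `n`.
  set Ψ : Ω × ℝ → ℝ := fun p => χ ((σ.symm)^[n] p.1) * Φ p with hΨ
  have hΨm : Measurable Ψ :=
    (hχm.comp ((σ.symm.measurable.iterate n).comp measurable_fst)).mul hΦ
  have hΨM : ∀ ω, ∀ x ∈ Icc (0 : ℝ) 1, |Ψ (ω, x)| ≤ M * M := by
    intro ω x hx
    rw [hΨ, abs_mul]
    exact mul_le_mul (hχM _) (hM ω x hx) (abs_nonneg _) hM0
  have key := hν.abs_pushMean_sub_le hσ ham ha0 ha hα0 hα hΨm hΨM n
  have e1 : pushMean P σ a n Ψ = ∫ ω, ψ ω * fiberMean σ a n Φ ω ∂P := by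
    refine integral_congr_ae ?_
    filter_upwards [hχψ] with ω hω
    simp only [fiberMean, hΨ]
    rw [← integral_const_mul]
    simp only [skew, hinv, hω]
  have e2 : ∫ ω, ∫ x, Ψ (ω, x) ∂ν ω ∂P = ∫ ω, ψ ω * kernelMean ν Φ (σ^[n] ω) ∂P := by
    rw [← integral_comp_iterate hσ n (hν.measurable_mean hΨm)]
    refine integral_congr_ae ?_
    filter_upwards [hχψ] with ω hω
    simp only [hΨ, kernelMean, hinv, integral_const_mul, hω]
  rwa [e1, e2] at key

/-- Three replacements are made: the mean of the product, then the fibre mean at time `k`, then the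
one at time `k + n`. In the last two the other factor acts as a weight on the base. The bound
involves the parameters only through `α`. -/
lemma abs_covApprox_sub_correlation_le (hσ : MeasurePreserving σ P P) (ham : Measurable a)
    (ha0 : ∀ ω, 0 < a ω) (ha : ∀ ω, a ω ≤ α) (hα0 : 0 < α) (hα : α < 1 / 2)
    (hν : IsRandomACIM P σ a ν) (hΦ : Measurable Φ) (hM : ∀ ω, LipBound M fun x => Φ (ω, x))
    (k n : ℕ) :
    |covApprox P σ a Φ k n - correlation P σ a ν (fun ω x => Φ (ω, x)) n|
      ≤ M * M * (2 * memoryRate α k + memoryRate α (k + n)) := by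
  have hsk := measurable_skew σ.measurable ham n
  have hb := abs_mul_comp_skew_le (σ := σ) ha0 hM n
  have hm : Measurable fun p => Φ p * Φ (skew σ a n p) := hΦ.mul (hΦ.comp hsk)
  have hb1 : ∀ ω, ∀ x ∈ Icc (0 : ℝ) 1, |Φ (ω, x)| ≤ M := fun ω => (hM ω).bound
  have hc : ∀ᵐ ω ∂P, |kernelMean ν Φ ω| ≤ M := hν.ae_abs_mean_le hb1
  have hcm : Measurable (kernelMean ν Φ) := hν.measurable_mean hΦ
  have hfm := fun j => measurable_fiberMean σ.measurable ham j hΦ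
  have hfb := fun j => abs_fiberMean_le (σ := σ) ha0 j hb1
  have hck : ∀ᵐ ω ∂P, |kernelMean ν Φ (σ^[k] ω)| ≤ M :=
    (hσ.iterate k).quasiMeasurePreserving.ae hc
  have hckm : Measurable fun ω => kernelMean ν Φ (σ^[k] ω) := hcm.comp (hσ.iterate k).measurable
  have h1 := hν.abs_pushMean_sub_le hσ ham ha0 ha hα0 hα hm hb k
  have h2 := hν.abs_integral_mul_fiberMean_sub_le hσ ham ha0 ha hα0 hα hΦ hb1 (hfm (k + n))
    (Filter.Eventually.of_forall (hfb (k + n))) k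
  have h3 := hν.abs_integral_mul_fiberMean_sub_le hσ ham ha0 ha hα0 hα hΦ hb1 hckm hck (k + n)
  have hcorr := hν.correlation_eq hσ ham ha0 hΦ hM n
  have e1 : covApprox P σ a Φ k n = pushMean P σ a k (fun p => Φ p * Φ (skew σ a n p))
      - ∫ ω, fiberMean σ a (k + n) Φ ω * fiberMean σ a k Φ ω ∂P := by
    rw [covApprox, integral_sub, pushMean]
    · simp only [mul_comm]
    · exact integrable_of_abs_le (measurable_fiberMean σ.measurable ham k hm)
        (abs_fiberMean_le ha0 k hb)
    · refine integrable_of_abs_le (K := M * M) ((hfm k).mul (hfm (k + n))) fun ω => ?_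
      rw [abs_mul]
      exact mul_le_mul (hfb k ω) (hfb _ ω) (abs_nonneg _) ((abs_nonneg _).trans (hfb k ω))
  have e2 : ∫ ω, fiberMean σ a (k + n) Φ ω * kernelMean ν Φ (σ^[k] ω) ∂P
      = ∫ ω, kernelMean ν Φ (σ^[k] ω) * fiberMean σ a (k + n) Φ ω ∂P := by
    simp only [mul_comm]
  have e3 : ∫ ω, kernelMean ν Φ (σ^[k] ω) * kernelMean ν Φ (σ^[k + n] ω) ∂P
      = ∫ ω, kernelMean ν Φ ω * kernelMean ν Φ (σ^[n] ω) ∂P := by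
    rw [← integral_comp_iterate hσ k (G := fun ω => kernelMean ν Φ ω * kernelMean ν Φ (σ^[n] ω))
      (hcm.mul (hcm.comp (hσ.iterate n).measurable))]
    simp only [← Function.iterate_add_apply, add_comm]
  rw [e2] at h2
  rw [e3] at h3
  rw [e1, hcorr]
  rw [abs_le] at h1 h2 h3 ⊢
  constructor <;> linarith [h1.1, h1.2, h2.1, h2.2, h3.1, h3.2]

lemma tendsto_covApprox (hσ : MeasurePreserving σ P P) (ham : Measurable a)
    (ha0 : ∀ ω, 0 < a ω) (ha : ∀ ω, a ω ≤ α) (hα0 : 0 < α) (hα : α < 1 / 2)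
    (hν : IsRandomACIM P σ a ν) (hΦ : Measurable Φ) (hM : ∀ ω, LipBound M fun x => Φ (ω, x))
    (n : ℕ) :
    Filter.Tendsto (fun k => covApprox P σ a Φ k n) Filter.atTop
      (nhds (correlation P σ a ν (fun ω x => Φ (ω, x)) n)) := by
  have hr := (memoryRate_summable hα0 hα).tendsto_atTop_zero
  have hr' := ((hr.const_mul 2).add (hr.comp (Filter.tendsto_add_atTop_nat n))).const_mul (M * M)
  simp only [mul_zero, add_zero] at hr'
  rw [tendsto_iff_norm_sub_tendsto_zero]
  exact squeeze_zero (fun _ => norm_nonneg _)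
    (fun k => hν.abs_covApprox_sub_correlation_le hσ ham ha0 ha hα0 hα hΦ hM k n) hr'

/-- Decay of the averaged correlations. -/
lemma abs_correlation_le (hσ : MeasurePreserving σ P P) (ham : Measurable a)
    (ha0 : ∀ ω, 0 < a ω) (ha : ∀ ω, a ω ≤ α) (hα0 : 0 < α) (hα : α < 1 / 2)
    (hν : IsRandomACIM P σ a ν) (hΦ : Measurable Φ) (hM : ∀ ω, LipBound M fun x => Φ (ω, x))
    (n : ℕ) :
    |correlation P σ a ν (fun ω x => Φ (ω, x)) n| ≤ 14 * M ^ 2 * memoryRate α n :=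
  le_of_tendsto (hν.tendsto_covApprox hσ ham ha0 ha hα0 hα hΦ hM n).abs
    (Filter.Eventually.of_forall fun k => abs_covApprox_le ha0 ha hα0 hα hΦ hM k n)

end IsRandomACIM

section Continuity

variable {ε₀ : ℝ} {β δ : Ω → ℝ}

/-- Continuity in the parameter of the fibre integrals of products of observables. -/
lemma continuousAt_integral_lsvIter {G : ℝ → ℕ → ℝ} (hε₀ : 0 < ε₀)
    (hG : ∀ i, ContinuousAt (fun ε => G ε i) 0) (hG0 : ∀ ε ∈ Ioo (-ε₀) ε₀, ∀ i, 0 < G ε i)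
    {F : ℝ → ℝ} {H : ℝ → ℝ} (hF : LipBound M F) (hH : LipBound M H)
    (hFm : Measurable F) (hHm : Measurable H) (m n : ℕ) :
    ContinuousAt (fun ε => ∫ x in Ioc 0 1, F (lsvIter (G ε) m x) * H (lsvIter (G ε) n x)) 0 := by
  have hmem : Ioo (-ε₀) ε₀ ∈ nhds (0 : ℝ) := Ioo_mem_nhds (by linarith) hε₀
  have hM0 : 0 ≤ M := (abs_nonneg _).trans (hF.bound 0 ⟨le_rfl, zero_le_one⟩)
  refine tendsto_integral_filter_of_dominated_convergence (fun _ => M * M)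
    (Filter.Eventually.of_forall fun ε => ((hFm.comp (measurable_lsvIter _ m)).mul
      (hHm.comp (measurable_lsvIter _ n))).aestronglyMeasurable) ?_ (integrable_const _) ?_
  · filter_upwards [hmem] with ε hε
    filter_upwards [ae_restrict_mem measurableSet_Ioc] with x hx
    have hx' := Ioc_subset_Icc_self hx
    rw [norm_mul]
    exact mul_le_mul (hF.bound _ (lsvIter_mem (hG0 ε hε) m hx'))
      (hH.bound _ (lsvIter_mem (hG0 ε hε) n hx')) (norm_nonneg _) hM0
  · have h0 : (0 : ℝ) ∈ Ioo (-ε₀) ε₀ := ⟨by linarith, hε₀⟩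
    filter_upwards [ae_restrict_mem measurableSet_Ioc, ae_lsvIter_ne_half (hG0 0 h0)] with x hx hx2
    have hx' := Ioc_subset_Icc_self hx
    have key : ∀ (f : ℝ → ℝ), LipBound M f → ∀ j, Filter.Tendsto (fun ε => f (lsvIter (G ε) j x))
        (nhds 0) (nhds (f (lsvIter (G 0) j x))) := by
      intro f hf j
      have h1 := hf.continuousOn _ (lsvIter_mem (hG0 0 h0) j hx')
      refine h1.tendsto.comp (tendsto_nhdsWithin_iff.2
        ⟨continuousAt_lsvIter hG (hG0 0 h0) hx2 j, ?_⟩)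
      filter_upwards [hmem] with ε hε using lsvIter_mem (hG0 ε hε) j hx'
    exact (key F hF m).mul (key H hH n)

lemma continuousAt_covApprox (hε₀ : 0 < ε₀) (hβ : Measurable β) (hδ : Measurable δ)
    (ha0 : ∀ ε ∈ Ioo (-ε₀) ε₀, ∀ ω, 0 < β ω + ε * δ ω)
    (hΦ : Measurable Φ) (hM : ∀ ω, LipBound M fun x => Φ (ω, x)) (k n : ℕ) :
    ContinuousAt (fun ε => covApprox P σ (fun ω => β ω + ε * δ ω) Φ k n) 0 := by
  obtain ⟨ω₀⟩ : Nonempty Ω := nonempty_of_isProbabilityMeasure P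
  have hmem : Ioo (-ε₀) ε₀ ∈ nhds (0 : ℝ) := Ioo_mem_nhds (by linarith) hε₀
  have hM0 : 0 ≤ M := (abs_nonneg _).trans ((hM ω₀).bound 0 ⟨le_rfl, zero_le_one⟩)
  have hm : ∀ ε, Measurable fun ω => β ω + ε * δ ω := fun ε => hβ.add (hδ.const_mul ε)
  have hG : ∀ ω i, ContinuousAt (fun ε => β (σ^[i] ω) + ε * δ (σ^[i] ω)) 0 := fun ω i =>
    (continuous_const.add (continuous_id.mul continuous_const)).continuousAt
  have hb1 : ∀ ω, ∀ x ∈ Icc (0 : ℝ) 1, |Φ (ω, x)| ≤ M := fun ω => (hM ω).bound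
  have hprod : ∀ ε, Measurable fun p => Φ p * Φ (skew σ (fun ω => β ω + ε * δ ω) n p) :=
    fun ε => hΦ.mul (hΦ.comp (measurable_skew σ.measurable (hm ε) n))
  have hfm := fun j ε => measurable_fiberMean σ.measurable (hm ε) j hΦ
  -- The constant `1` serves as second factor, so that a single fibre mean is also an integral of a
  -- product; its bound must be at least `1`, hence `M + 1`.
  have hlip1 : LipBound (M + 1) fun _ : ℝ => (1 : ℝ) :=
    ⟨fun _ _ => by simp [hM0], fun x _ y _ => by simp; positivity⟩
  have hlip : ∀ ω, LipBound (M + 1) fun x => Φ (ω, x) := fun ω =>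
    ⟨fun x hx => ((hM ω).bound x hx).trans (by linarith), fun x hx y hy =>
      ((hM ω).lip x hx y hy).trans (by gcongr; linarith)⟩
  refine tendsto_integral_filter_of_dominated_convergence (fun _ => M * M + M * M)
    (Filter.Eventually.of_forall fun ε =>
      ((measurable_fiberMean σ.measurable (hm ε) k (hprod ε)).sub
        ((hfm k ε).mul (hfm (k + n) ε))).aestronglyMeasurable) ?_ (integrable_const _) ?_
  · filter_upwards [hmem] with ε hε
    refine Filter.Eventually.of_forall fun ω => ?_
    refine (norm_sub_le _ _).trans (add_le_add ?_ ?_)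
    · exact abs_fiberMean_le (ha0 ε hε) k (abs_mul_comp_skew_le (ha0 ε hε) hM n) ω
    · rw [norm_mul]
      exact mul_le_mul (abs_fiberMean_le (ha0 ε hε) k hb1 ω)
        (abs_fiberMean_le (ha0 ε hε) _ hb1 ω) (norm_nonneg _) hM0
  · refine Filter.Eventually.of_forall fun ω => ?_
    have hc1 : ∀ j, ContinuousAt
        (fun ε => fiberMean σ (fun ω => β ω + ε * δ ω) j Φ ω) 0 := by
      intro j
      have := continuousAt_integral_lsvIter hε₀ (hG ω) (fun ε hε i => ha0 ε hε _)
        (hlip (σ^[j] ω)) hlip1 (hΦ.comp measurable_prodMk_left) measurable_const j j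
      simpa only [fiberMean_eq, mul_one] using this
    have hc2 : ContinuousAt (fun ε => fiberMean σ (fun ω => β ω + ε * δ ω) k
        (fun p => Φ p * Φ (skew σ (fun ω => β ω + ε * δ ω) n p)) ω) 0 := by
      have := continuousAt_integral_lsvIter hε₀ (hG ω) (fun ε hε i => ha0 ε hε _)
        (hM (σ^[k] ω)) (hM (σ^[k + n] ω)) (hΦ.comp measurable_prodMk_left)
        (hΦ.comp measurable_prodMk_left) k (k + n)
      simp only [fiberMean, ← skew_add]
      simpa only [skew, cocycle_eq_lsvIter] using this
    exact hc2.sub ((hc1 k).mul (hc1 (k + n)))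

/-- A limit that is uniform near `0` of functions continuous at `0`: the time `k` is chosen before
`ε`, as the error of `covApprox` does not depend on `ε`. -/
lemma continuousAt_correlation (hσ : MeasurePreserving σ P P) (hε₀ : 0 < ε₀) (hβ : Measurable β)
    (hδ : Measurable δ) (ha0 : ∀ ε ∈ Ioo (-ε₀) ε₀, ∀ ω, 0 < β ω + ε * δ ω)
    (ha : ∀ ε ∈ Ioo (-ε₀) ε₀, ∀ ω, β ω + ε * δ ω ≤ α) (hα0 : 0 < α) (hα : α < 1 / 2)
    {μ : ℝ → Kernel Ω ℝ}
    (hμ : ∀ ε ∈ Ioo (-ε₀) ε₀, IsRandomACIM P σ (fun ω => β ω + ε * δ ω) (μ ε))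
    (hΦ : Measurable Φ) (hM : ∀ ω, LipBound M fun x => Φ (ω, x)) (n : ℕ) :
    ContinuousAt (fun ε => correlation P σ (fun ω => β ω + ε * δ ω) (μ ε)
      (fun ω x => Φ (ω, x)) n) 0 := by
  have hmem : Ioo (-ε₀) ε₀ ∈ nhds (0 : ℝ) := Ioo_mem_nhds (by linarith) hε₀
  have hr := (memoryRate_summable hα0 hα).tendsto_atTop_zero
  have hr' := ((hr.const_mul 2).add (hr.comp (Filter.tendsto_add_atTop_nat n))).const_mul (M * M)
  simp only [mul_zero, add_zero] at hr'
  refine continuousAt_of_locally_uniform_approx_of_continuousAt fun u hu => ?_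
  obtain ⟨r, hr0, hru⟩ := Metric.mem_uniformity_dist.1 hu
  obtain ⟨k, hk⟩ := (hr'.eventually_lt_const hr0).exists
  refine ⟨_, hmem, fun ε => covApprox P σ (fun ω => β ω + ε * δ ω) Φ k n,
    continuousAt_covApprox hε₀ hβ hδ ha0 hΦ hM k n, fun ε hε => hru ?_⟩
  rw [dist_comm, Real.dist_eq]
  exact ((hμ ε hε).abs_covApprox_sub_correlation_le hσ (hβ.add (hδ.const_mul ε)) (ha0 ε hε)
    (ha ε hε) hα0 hα hΦ hM k n).trans_lt hk

omit [IsProbabilityMeasure P] in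
lemma limitVariance_eq (σ : Ω → Ω) (a : Ω → ℝ) (ν : Kernel Ω ℝ) (F : Ω → ℝ → ℝ) :
    limitVariance P σ a ν F
      = correlation P σ a ν F 0 + 2 * ∑' n : ℕ, correlation P σ a ν F (n + 1) := by
  simp only [limitVariance, correlation, corrIntegrand, cocycle, Function.iterate_zero, id, sq]

theorem continuousAt_limitVariance (hσ : MeasurePreserving σ P P) (hε₀ : 0 < ε₀)
    (hβ : Measurable β)
    (hδ : Measurable δ) (ha0 : ∀ ε ∈ Ioo (-ε₀) ε₀, ∀ ω, 0 < β ω + ε * δ ω)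
    (ha : ∀ ε ∈ Ioo (-ε₀) ε₀, ∀ ω, β ω + ε * δ ω ≤ α) (hα0 : 0 < α) (hα : α < 1 / 2)
    {μ : ℝ → Kernel Ω ℝ}
    (hμ : ∀ ε ∈ Ioo (-ε₀) ε₀, IsRandomACIM P σ (fun ω => β ω + ε * δ ω) (μ ε))
    (hΦ : Measurable Φ) (hM : ∀ ω, LipBound M fun x => Φ (ω, x)) :
    ContinuousAt (fun ε => limitVariance P σ (fun ω => β ω + ε * δ ω) (μ ε)
      (fun ω x => Φ (ω, x))) 0 := by
  have hmem : Ioo (-ε₀) ε₀ ∈ nhds (0 : ℝ) := Ioo_mem_nhds (by linarith) hε₀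
  have hc := continuousAt_correlation hσ hε₀ hβ hδ ha0 ha hα0 hα hμ hΦ hM
  simp only [limitVariance_eq]
  refine (hc 0).add (ContinuousAt.mul continuousAt_const ?_)
  have hs := ((summable_nat_add_iff 1).2 (memoryRate_summable hα0 hα)).mul_left (14 * M ^ 2)
  refine tendsto_tsum_of_dominated_convergence hs (fun n => hc (n + 1)) ?_
  filter_upwards [hmem] with ε hε n
  exact (hμ ε hε).abs_correlation_le hσ (hβ.add (hδ.const_mul ε)) (ha0 ε hε) (ha ε hε) hα0 hα hΦ
    hM (n + 1)

end Continuity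

end RandomLSV

/-! ### From essential to everywhere bounds, and joint integrability. -/

namespace RandomLSV

lemma lipBound_of_c1Norm_le {f : ℝ → ℝ} {M : ℝ} (hf : ContDiffOn ℝ 1 f (Icc 0 1)) (hM0 : 0 ≤ M)
    (hM : c1Norm f ≤ ENNReal.ofReal M) : LipBound M f := by
  have conv : ∀ y : ℝ, ‖y‖ₑ ≤ ENNReal.ofReal M → |y| ≤ M := by
    intro y hy
    rwa [← ofReal_norm, ENNReal.ofReal_le_ofReal_iff hM0] at hy
  refine ⟨fun x hx => conv _ (le_trans ?_ hM), fun x hx y hy => ?_⟩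
  · exact (le_iSup₂ (f := fun (x : ℝ) (_ : x ∈ Icc (0 : ℝ) 1) => ‖f x‖ₑ) x hx).trans le_self_add
  · have h1 : ∀ z ∈ Icc (0 : ℝ) 1, ‖derivWithin f (Icc 0 1) z‖ ≤ M := by
      intro z hz
      refine conv _ (le_trans ?_ hM)
      exact (le_iSup₂ (f := fun (x : ℝ) (_ : x ∈ Icc (0 : ℝ) 1) =>
        ‖derivWithin f (Icc (0 : ℝ) 1) x‖ₑ) z hz).trans le_add_self
    exact (convex_Icc 0 1).norm_image_sub_le_of_norm_derivWithin_le
      (hf.differentiableOn one_ne_zero) h1 hy hx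

variable {Ω : Type*} [MeasurableSpace Ω] {P : Measure Ω} {σ : Ω ≃ᵐ Ω}
  {M : ℝ} {a a' : Ω → ℝ} {Φ : Ω × ℝ → ℝ} {ν : Kernel Ω ℝ}

/-- The observables may be extended from `[0, 1]`, and discarded on a null set of the base, in
such a way that they are measurable and uniformly Lipschitz. -/
lemma exists_lipBound_modification (F : Ω → ℝ → ℝ)
    (hFm : Measurable (fun p : Ω × Icc (0 : ℝ) 1 => F p.1 p.2))
    (hFC1 : ∀ ω, ContDiffOn ℝ 1 (F ω) (Icc 0 1))
    (hFbdd : essSup (fun ω => c1Norm (F ω)) P < ∞) :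
    ∃ (M : ℝ) (Φ : Ω × ℝ → ℝ), Measurable Φ ∧ (∀ ω, LipBound M fun x => Φ (ω, x)) ∧
      ∀ᵐ ω ∂P, ∀ x ∈ Icc (0 : ℝ) 1, F ω x = Φ (ω, x) := by
  set M := (essSup (fun ω => c1Norm (F ω)) P).toReal
  have hM0 : 0 ≤ M := ENNReal.toReal_nonneg
  have h1 : ∀ᵐ ω ∂P, c1Norm (F ω) ≤ ENNReal.ofReal M := by
    rw [ENNReal.ofReal_toReal hFbdd.ne]
    exact ae_le_essSup
  obtain ⟨S, hS, hSm, hSF⟩ := h1.exists_measurable_mem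
  have hproj : ∀ x ∈ Icc (0 : ℝ) 1, ((projIcc 0 1 zero_le_one x : Icc (0 : ℝ) 1) : ℝ) = x :=
    fun x hx => by rw [projIcc_of_mem zero_le_one hx]
  classical
  refine ⟨M, fun p => if p.1 ∈ S then F p.1 (projIcc 0 1 zero_le_one p.2 : Icc (0 : ℝ) 1) else 0,
    ?_, fun ω => ?_, ?_⟩
  · refine Measurable.ite (measurable_fst hSm) ?_ measurable_const
    exact hFm.comp (measurable_fst.prodMk ((continuous_projIcc (h := zero_le_one)).measurable.comp measurable_snd))
  · by_cases hω : ω ∈ S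
    · have h2 := lipBound_of_c1Norm_le (hFC1 ω) hM0 (hSF ω hω)
      simp only [if_pos hω]
      refine ⟨fun x hx => ?_, fun x hx y hy => ?_⟩
      · rw [hproj x hx]; exact h2.bound x hx
      · rw [hproj x hx, hproj y hy]; exact h2.lip x hx y hy
    · simp only [if_neg hω]
      exact ⟨fun x _ => by simpa using hM0, fun x _ y _ => by simp; positivity⟩
  · filter_upwards [hS] with ω hω x hx
    simp only [if_pos hω, hproj x hx]

lemma IsRandomACIM.congr (h : a =ᵐ[P] a') (hν : IsRandomACIM P σ a ν) : IsRandomACIM P σ a' ν where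
  isMarkovKernel := hν.isMarkovKernel
  absolutelyContinuous := hν.absolutelyContinuous
  equivariant := by
    filter_upwards [h, hν.equivariant] with ω h1 h2
    rw [← h1, h2]

namespace IsRandomACIM

/-- The modifications are null on the base, and since `σ` preserves `P`, almost every orbit avoids
the exceptional set at all times. -/
lemma ae_corrIntegrand_eq (hσ : MeasurePreserving σ P P) (h : a =ᵐ[P] a') (ha0 : ∀ ω, 0 < a' ω)
    (hν : IsRandomACIM P σ a ν) {F : Ω → ℝ → ℝ}
    (hF : ∀ᵐ ω ∂P, ∀ x ∈ Icc (0 : ℝ) 1, F ω x = Φ (ω, x)) :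
    ∀ᵐ ω ∂P, ∀ n, ∀ x ∈ Icc (0 : ℝ) 1, corrIntegrand σ a ν F n ω x
      = corrIntegrand σ a' ν (fun ω x => Φ (ω, x)) n ω x := by
  have orbit : ∀ {p : Ω → Prop}, (∀ᵐ ω ∂P, p ω) → ∀ᵐ ω ∂P, ∀ n, p (σ^[n] ω) := fun hp =>
    ae_all_iff.2 fun n => (hσ.iterate n).quasiMeasurePreserving.ae hp
  have hmean : ∀ᵐ ω ∂P, ∫ y, F ω y ∂ν ω = ∫ y, Φ (ω, y) ∂ν ω := by
    filter_upwards [hF, hν.ae_mem] with ω h1 h2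
    refine integral_congr_ae ?_
    filter_upwards [h2] with x hx using h1 x hx
  filter_upwards [orbit h, orbit hF, orbit hmean] with ω h1 h2 h3 n x hx
  have hcoc : cocycle σ a n ω x = cocycle σ a' n ω x := by
    rw [cocycle_eq_lsvIter, cocycle_eq_lsvIter]
    congr 1
    funext i
    exact h1 i
  have e0 := h2 0 x hx
  have m0 := h3 0
  simp only [Function.iterate_zero, id] at e0 m0
  simp only [corrIntegrand, centred, hcoc, h3 n, m0, e0,
    h2 n _ (cocycle_mem ha0 n ω hx)]

lemma correlation_congr (hσ : MeasurePreserving σ P P) (h : a =ᵐ[P] a') (ha0 : ∀ ω, 0 < a' ω)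
    (hν : IsRandomACIM P σ a ν) {F : Ω → ℝ → ℝ}
    (hF : ∀ᵐ ω ∂P, ∀ x ∈ Icc (0 : ℝ) 1, F ω x = Φ (ω, x)) (n : ℕ) :
    correlation P σ a ν F n = correlation P σ a' ν (fun ω x => Φ (ω, x)) n := by
  refine integral_congr_ae ?_
  filter_upwards [hν.ae_corrIntegrand_eq hσ h ha0 hF, hν.ae_mem] with ω h1 h2
  refine integral_congr_ae ?_
  filter_upwards [h2] with x hx using h1 n x hx

variable [IsProbabilityMeasure P]

omit [IsProbabilityMeasure P] in
lemma ae_compProd_mem (hν : IsRandomACIM P σ a ν) : ∀ᵐ p ∂(P ⊗ₘ ν), p.2 ∈ Icc (0 : ℝ) 1 := by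
  have := hν.isMarkovKernel
  exact Measure.ae_compProd_of_ae_ae (measurable_snd measurableSet_Icc) hν.ae_mem

lemma ae_compProd_of_ae_fst (hν : IsRandomACIM P σ a ν) {p : Ω → Prop} (hp : ∀ᵐ ω ∂P, p ω) :
    ∀ᵐ q ∂(P ⊗ₘ ν), p q.1 := by
  have := hν.isMarkovKernel
  rw [← Measure.fst_compProd P ν] at hp
  exact ae_of_ae_map measurable_fst.aemeasurable hp

lemma integrable_corrIntegrand (hσ : MeasurePreserving σ P P) (ham : Measurable a)
    (ha0 : ∀ ω, 0 < a ω) (hν : IsRandomACIM P σ a ν) (hΦ : Measurable Φ)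
    (hM : ∀ ω, LipBound M fun x => Φ (ω, x)) (n : ℕ) :
    Integrable (fun p : Ω × ℝ => corrIntegrand σ a ν (fun ω x => Φ (ω, x)) n p.1 p.2)
      (P ⊗ₘ ν) := by
  have := hν.isMarkovKernel
  have hsk := measurable_skew σ.measurable ham n
  have hcm : Measurable (kernelMean ν Φ) := hν.measurable_mean hΦ
  have hc : ∀ᵐ ω ∂P, |kernelMean ν Φ ω| ≤ M := hν.ae_abs_mean_le fun ω => (hM ω).bound
  have hm : Measurable fun p : Ω × ℝ =>
      corrIntegrand σ a ν (fun ω x => Φ (ω, x)) n p.1 p.2 :=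
    (hΦ.sub (hcm.comp measurable_fst)).mul ((hΦ.comp hsk).sub
      (hcm.comp ((hσ.iterate n).measurable.comp measurable_fst)))
  refine Integrable.of_bound hm.aestronglyMeasurable ((M + M) * (M + M)) ?_
  filter_upwards [hν.ae_compProd_mem, hν.ae_compProd_of_ae_fst hc,
    hν.ae_compProd_of_ae_fst ((hσ.iterate n).quasiMeasurePreserving.ae hc)] with p h1 h2 h3
  have b1 := (hM p.1).bound p.2 h1
  have b2 := (hM (σ^[n] p.1)).bound _ (cocycle_mem (σ := σ) ha0 n p.1 h1)
  have hM0 : 0 ≤ M := (abs_nonneg _).trans b1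
  rw [corrIntegrand, norm_mul]
  exact mul_le_mul ((abs_sub _ _).trans (add_le_add b1 h2))
    ((abs_sub _ _).trans (add_le_add b2 h3)) (norm_nonneg _) (by positivity)

end IsRandomACIM

end RandomLSV

end

/-! ### Assembly. -/

theorem theorem2 {Ω : Type*} [MeasurableSpace Ω] (P : Measure Ω) [IsProbabilityMeasure P]
    (σ : Ω ≃ᵐ Ω) (hσ : Ergodic σ P)
    (ε₀ : ℝ) (hε₀ : 0 < ε₀)
    (β δ : Ω → ℝ) (hβm : Measurable β) (hδm : Measurable δ)
    (hβ : ∀ ω, β ω ∈ Ioo (0 : ℝ) 1) (hδ : ∀ ω, δ ω ∈ Ioo (0 : ℝ) 1)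
    (hsup : essSup β P + ε₀ < 1 / 2) (hinf : 0 < essInf β P - ε₀)
    (F : Ω → ℝ → ℝ)
    (hFm : Measurable (fun p : Ω × Icc (0 : ℝ) 1 => F p.1 p.2))
    (hFC1 : ∀ ω, ContDiffOn ℝ 1 (F ω) (Icc 0 1))
    (hFbdd : essSup (fun ω => RandomLSV.c1Norm (F ω)) P < ∞) :
    -- for each `ε` there is exactly one random a.c.i.m. (up to `P`-null sets)
    (∀ ε ∈ Ioo (-ε₀) ε₀, ∃ ν : Kernel Ω ℝ,
      RandomLSV.IsRandomACIM P σ (fun ω => β ω + ε * δ ω) ν ∧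
      ∀ ν' : Kernel Ω ℝ, RandomLSV.IsRandomACIM P σ (fun ω => β ω + ε * δ ω) ν' →
        ∀ᵐ ω ∂P, ν' ω = ν ω) ∧
    -- its limit variance is well defined, and continuous in `ε` at `0`
    ∀ μ : ℝ → Kernel Ω ℝ,
      (∀ ε ∈ Ioo (-ε₀) ε₀, RandomLSV.IsRandomACIM P σ (fun ω => β ω + ε * δ ω) (μ ε)) →
      (∀ ε ∈ Ioo (-ε₀) ε₀,
        (∀ n : ℕ, Integrable
          (fun p : Ω × ℝ =>
            RandomLSV.corrIntegrand σ (fun ω => β ω + ε * δ ω) (μ ε) F n p.1 p.2)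
          (P ⊗ₘ μ ε)) ∧
        Summable (fun n : ℕ =>
          RandomLSV.correlation P σ (fun ω => β ω + ε * δ ω) (μ ε) F (n + 1))) ∧
      ContinuousAt
        (fun ε : ℝ => RandomLSV.limitVariance P σ (fun ω => β ω + ε * δ ω) (μ ε) F) 0 := by
  have hσ' : MeasurePreserving σ P P := hσ.toMeasurePreserving
  obtain ⟨M, Φ, hΦ, hM, hFΦ⟩ := RandomLSV.exists_lipBound_modification F hFm hFC1 hFbdd
  set b := essSup β P
  set c := essInf β P
  -- For real-valued functions the essential bounds are meaningful because `β` takes values in `(0,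
  -- 1)`.
  have hb : ∀ᵐ ω ∂P, β ω ≤ b :=
    ae_le_essSup (Filter.isBoundedUnder_of ⟨1, fun ω => (hβ ω).2.le⟩)
  have hc : ∀ᵐ ω ∂P, c ≤ β ω :=
    ae_essInf_le (Filter.isBoundedUnder_of ⟨0, fun ω => (hβ ω).1.le⟩)
  have hcb : c ≤ b := by
    obtain ⟨ω, h1, h2⟩ := (hb.and hc).exists
    exact h2.trans h1
  -- Clamping to `[c, b]` changes `β` on a null set only. It keeps all perturbed parameters in `(0,
  -- b + ε₀]` for every `ω`, so `α = b + ε₀` serves all `ε` at once.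
  set β' : Ω → ℝ := fun ω => max c (min b (β ω)) with hβ'
  have hβ'm : Measurable β' := measurable_const.max (measurable_const.min hβm)
  have hβ'c : ∀ ω, c ≤ β' ω := fun ω => le_max_left _ _
  have hβ'b : ∀ ω, β' ω ≤ b := fun ω => max_le hcb (min_le_left _ _)
  have hββ' : β =ᵐ[P] β' := by
    filter_upwards [hb, hc] with ω h1 h2
    simp only [hβ', min_eq_right h1, max_eq_right h2]
  have heq : ∀ ε : ℝ, (fun ω => β ω + ε * δ ω) =ᵐ[P] fun ω => β' ω + ε * δ ω := by
    intro ε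
    filter_upwards [hββ'] with ω h
    rw [h]
  have hεδ : ∀ ε ∈ Ioo (-ε₀) ε₀, ∀ ω, |ε * δ ω| ≤ ε₀ := by
    intro ε hε ω
    rw [abs_mul, abs_of_pos (hδ ω).1]
    have h1 : |ε| ≤ ε₀ := abs_le.2 ⟨hε.1.le, hε.2.le⟩
    exact (mul_le_of_le_one_right (abs_nonneg _) (hδ ω).2.le).trans h1
  have ha0 : ∀ ε ∈ Ioo (-ε₀) ε₀, ∀ ω, 0 < β' ω + ε * δ ω := fun ε hε ω => by
    linarith [hβ'c ω, (abs_le.1 (hεδ ε hε ω)).1]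
  have ha : ∀ ε ∈ Ioo (-ε₀) ε₀, ∀ ω, β' ω + ε * δ ω ≤ b + ε₀ := fun ε hε ω => by
    linarith [hβ'b ω, (abs_le.1 (hεδ ε hε ω)).2]
  have hα0 : 0 < b + ε₀ := by linarith
  have ham : ∀ ε : ℝ, Measurable fun ω => β' ω + ε * δ ω := fun ε =>
    hβ'm.add (hδm.const_mul ε)
  refine ⟨fun ε hε => ?_, fun μ hμ => ?_⟩
  · obtain ⟨ν, hν⟩ := RandomLSV.exists_isRandomACIM hσ' (ham ε) (ha0 ε hε) (ha ε hε) hα0 hsup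
    exact ⟨ν, hν.congr (heq ε).symm, fun ν' hν' =>
      hν.unique hσ' (ham ε) (ha0 ε hε) (ha ε hε) hα0 hsup (hν'.congr (heq ε))⟩
  have hμ' : ∀ ε ∈ Ioo (-ε₀) ε₀, RandomLSV.IsRandomACIM P σ (fun ω => β' ω + ε * δ ω) (μ ε) :=
    fun ε hε => (hμ ε hε).congr (heq ε)
  have hcorr : ∀ ε ∈ Ioo (-ε₀) ε₀, ∀ n,
      RandomLSV.correlation P σ (fun ω => β ω + ε * δ ω) (μ ε) F n
        = RandomLSV.correlation P σ (fun ω => β' ω + ε * δ ω) (μ ε) (fun ω x => Φ (ω, x)) n :=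
    fun ε hε => (hμ ε hε).correlation_congr hσ' (heq ε) (ha0 ε hε) hFΦ
  refine ⟨fun ε hε => ⟨fun n => ?_, ?_⟩, ?_⟩
  · refine ((hμ' ε hε).integrable_corrIntegrand hσ' (ham ε) (ha0 ε hε) hΦ hM n).congr ?_
    filter_upwards [(hμ ε hε).ae_compProd_mem, (hμ ε hε).ae_compProd_of_ae_fst
      ((hμ ε hε).ae_corrIntegrand_eq hσ' (heq ε) (ha0 ε hε) hFΦ)] with p h1 h2
    exact (h2 n p.2 h1).symm
  · simp only [hcorr ε hε]
    refine Summable.of_norm_bounded (((summable_nat_add_iff 1).2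
      (RandomLSV.memoryRate_summable hα0 hsup)).mul_left (14 * M ^ 2)) fun n => ?_
    exact (hμ' ε hε).abs_correlation_le hσ' (ham ε) (ha0 ε hε) (ha ε hε) hα0 hsup hΦ hM (n + 1)
  · refine (RandomLSV.continuousAt_limitVariance hσ' hε₀ hβ'm hδm ha0 ha hα0 hsup hμ' hΦ
      hM).congr ?_
    filter_upwards [Ioo_mem_nhds (by linarith : -ε₀ < 0) hε₀] with ε hε
    simp only [RandomLSV.limitVariance_eq, hcorr ε hε]
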